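/- **Notation.** Fix $d$, and let $\phi=(Q,P):\mathbb R^{2d}\to\mathbb R^{2d}$, $z=(q,p)\mapsto(Q(z),P(z))$, be a smooth symplectic diffeomorphism such that $\phi,\phi^{-1}$ are Lipschitz and all derivatives of $\phi$ of order $\ge1$ are bounded. Let $S:\mathbb R^{2d}\to\mathbb R$ be an action of $\phi$, i.e. $dS=P\cdot dQ-p\cdot dq$. Let $\mathcal O_0(n)$ be the set of smooth complex functions on $\mathbb R^n$ that are bounded with all their derivatives, and $\Sigma_+(d)$ the set of complex symmetric $d\times d$ matrices with positive definite imaginary part. Let $\Theta:\mathbb R^{2d}\to\Sigma_+(d)$ be smooth, with $$\exists c>0\ \forall z,v:\ \Im\Theta(z)v\cdot v\ge c|v|^2,\qquad \sup_z\|\partial^\gamma_z\Theta(z)\|<\infty\ \text{ for all }|\gamma|\ge1 .$$ For $\Gamma\in\Sigma_+(d)$, $a=a(x,z)\in\mathcal O_0(3d)$ and $u=u(x,y,p)\in\mathcal O_0(3d)$, put $$\Phi^{(\phi,\Theta,\Gamma)}(z;x,y)=S(z)+P\cdot(x-Q)-p\cdot(y-q)+\tfrac12\bigl(\Theta(z)(x-Q)\cdot(x-Q)-\overline\Gamma(y-q)\cdot(y-q)\bigr),$$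 with $(Q,P)=\phi(z)$, and $$\Psi^{(\phi,\Theta)}(p;x,y)=S(y,p)+P\cdot(x-Q)+\tfrac12\Theta(y,p)(x-Q)\cdot(x-Q),\qquad (Q,P)=\phi(y,p).$$ For $\hbar\in(0,1]$ and $\psi\in\mathcal S(\mathbb R^d)$ define, with the iterated integrals taken in the order written, $$\mathcal I(a,\Phi^{(\phi,\Theta,\Gamma)})\psi(x)=(2\pi\hbar)^{-3d/2}\int_{\mathbb R^{2d}}\Bigl(\int_{\mathbb R^d}e^{\frac i\hbar\Phi^{(\phi,\Theta,\Gamma)}(z;x,y)}a(x,z)\psi(y)\,dy\Bigr)dz,$$ $$\mathcal J(u,\Psi^{(\phi,\Theta)})\psi(x)=(2\pi\hbar)^{-d}\int_{\mathbb R^{d}}\Bigl(\int_{\mathbb R^d}e^{\frac i\hbar\Psi^{(\phi,\Theta)}(p;x,y)}u(x,y,p)\psi(y)\,dy\Bigr)dp .$$ Let $\varphi_z(x)=(\pi\hbar)^{-d/4}\exp\bigl(\frac i\hbar(p\cdot x-\frac{p\cdot q}2)-\frac{|x-q|^2}{2\hbar}\bigr)$ be the coherent state at $z=(q,p)$, and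 $\mathcal F_{\mathcal B}\psi(z)=(2\pi\hbar)^{-d/2}\langle\psi,\varphi_z\rangle$ the Fourier–Bargmann transform, an isometry $L^2(\mathbb R^d)\to L^2(\mathbb R^{2d})$. For continuous $U:\mathcal S(\mathbb R^d)\to\mathcal S'(\mathbb R^d)$, the Schwartz kernel of $\mathcal F_{\mathcal B}U\mathcal F_{\mathcal B}^*$ is $\tilde K_U(X,Y)=(2\pi\hbar)^{-d}\langle U\varphi_X,\varphi_Y\rangle$. A family $U^\hbar:\mathcal S(\mathbb R^d)\to\mathcal S'(\mathbb R^d)$, $\hbar\in(0,1]$, is a *semiclassical Fourier integral operator of order $m$ associated with $\phi$* if for every $N'$ one can write $U^\hbar=U^\hbar_{N'}+R^\hbar_{N'}$ with $\|R^\hbar_{N'}\|_{L^2\to L^2}=O(\hbar^{N'})$ and, for every $N\ge0$, a constant $C_N$ such that $$|\tilde K_{U^\hbar_{N'}}(X,Y)|\le C_N\,\hbar^{m-d}\Bigl(1+\frac{|Y-\phi(X)|}{\sqrt\hbar}\Bigr)^{-N}\qquad\forall X,Y\in\mathbb R^{2d},\ \hbar\in(0,1].\tag{$*$}$$ **Proposition.**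 (i) For all $\Theta,\Gamma,a$ as above, and (ii) for all $\Theta,u$ as above with $\Theta$ moreover bounded on $\mathbb R^{2d}$, the following holds for $\mathcal I(a,\Phi^{(\phi,\Theta,\Gamma)})$, respectively for $\mathcal J(u,\Psi^{(\phi,\Theta)})$. The two successive integrations in the definition converge absolutely for all $\psi\in\mathcal S(\mathbb R^d)$, $x\in\mathbb R^d$, $\hbar\in(0,1]$. They define a family of continuous operators $\mathcal S(\mathbb R^d)\to\mathcal S'(\mathbb R^d)$, which is a semiclassical Fourier integral operator of order $0$ associated with $\phi$; the kernels of the family itself satisfy $(*)$ with $m=0$; and the operators are bounded on $L^2(\mathbb R^d)$, uniformly in $\hbar\in(0,1]$. -/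

import Mathlib

open MeasureTheory SchwartzMap
open scoped ContDiff ComplexConjugate

noncomputable section

namespace SemiclassicalFIO

/-! ### Configuration space, phase space, symbols -/

/-- Configuration space `ℝ^d` with its Euclidean norm. -/
abbrev Conf (d : ℕ) : Type := EuclideanSpace ℝ (Fin d)

/-- Phase space `T^*(ℝ^d) = ℝ^d × ℝ^d`, with points `z = (q, p)` and Lebesgue measure. Its default
norm is the maximum of the two Euclidean norms; it is equivalent to the Euclidean norm of `ℝ^{2d}`,
so that symbol classes and Lipschitz continuity do not depend on the choice. -/
abbrev Phase (d : ℕ) : Type := Conf d × Conf d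

/-- The Euclidean norm on phase space. -/
def phaseNorm {d : ℕ} (z : Phase d) : ℝ := Real.sqrt (‖z.1‖ ^ 2 + ‖z.2‖ ^ 2)

/-- The symbol class `𝒪_m`: smooth functions all of whose derivatives of order at least `m`
are bounded. -/
def IsSymbol {V W : Type*} [NormedAddCommGroup V] [NormedSpace ℝ V]
    [NormedAddCommGroup W] [NormedSpace ℝ W] (m : ℕ) (f : V → W) : Prop :=
  ContDiff ℝ ∞ f ∧ ∀ k : ℕ, m ≤ k → ∃ C : ℝ, ∀ x, ‖iteratedFDeriv ℝ k f x‖ ≤ C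

/-- The standard symplectic form `σ(X, X') = JX · X'`, that is `ξ · x' - x · ξ'`. -/
def sympForm {d : ℕ} (X X' : Phase d) : ℝ := inner ℝ X.2 X'.1 - inner ℝ X.1 X'.2

/-- Bilipschitz canonical transformations of phase space: smooth symplectic diffeomorphisms `φ` with
`φ`, `φ⁻¹` Lipschitz and `φ ∈ 𝒪_1`. -/
structure IsCanonical {d : ℕ} (φ : Phase d ≃ Phase d) : Prop where
  symbol : IsSymbol 1 φ
  smooth_symm : ContDiff ℝ ∞ φ.symm
  lipschitz : ∃ K : NNReal, LipschitzWith K φ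
  lipschitz_symm : ∃ K : NNReal, LipschitzWith K φ.symm
  symplectic : ∀ z u v, sympForm (fderiv ℝ φ z u) (fderiv ℝ φ z v) = sympForm u v

/-- `S` is an action for `φ = (Q, P)`: a primitive of the one-form `P dQ - p dq`. -/
def IsAction {d : ℕ} (φ : Phase d → Phase d) (S : Phase d → ℝ) : Prop :=
  Differentiable ℝ S ∧
    ∀ z v, fderiv ℝ S z v = inner ℝ (φ z).2 (fderiv ℝ φ z v).1 - inner ℝ z.2 v.1

/-! ### Complex quadratic phases -/

/-- The quadratic form `Γ v · v` of a complex matrix at a real vector. -/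
def quadForm {d : ℕ} (Γ : Matrix (Fin d) (Fin d) ℂ) (v : Conf d) : ℂ :=
  ∑ i, ∑ j, Γ i j * (v j : ℂ) * (v i : ℂ)

/-- The Siegel space `Σ_+(d)`: complex symmetric matrices with positive definite imaginary part. -/
def siegel (d : ℕ) : Set (Matrix (Fin d) (Fin d) ℂ) :=
  {Γ | Γ.IsSymm ∧ (Γ.map Complex.im).PosDef}

/-- Admissible fields of Siegel matrices on phase space: smooth, with imaginary part bounded below
by a positive constant, and with bounded derivatives of every order at least one. -/
structure IsSiegelField {d : ℕ} (Θ : Phase d → Matrix (Fin d) (Fin d) ℂ) : Prop where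
  mem : ∀ z, Θ z ∈ siegel d
  lower : ∃ c > (0 : ℝ), ∀ z v, c * ‖v‖ ^ 2 ≤ (quadForm (Θ z) v).im
  symbol : ∀ i j, IsSymbol 1 (fun z => Θ z i j)

/-- The phase `Φ^{(φ,Θ,Γ)}(z; x, y)`, where `z = (q, p)` and `φ z = (Q, P)`. -/
def phaseI {d : ℕ} (φ : Phase d → Phase d) (S : Phase d → ℝ)
    (Θ : Phase d → Matrix (Fin d) (Fin d) ℂ) (Γ : Matrix (Fin d) (Fin d) ℂ)
    (z : Phase d) (x y : Conf d) : ℂ :=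
  ((S z + inner ℝ (φ z).2 (x - (φ z).1) - inner ℝ z.2 (y - z.1) : ℝ) : ℂ)
    + (1 / 2) * (quadForm (Θ z) (x - (φ z).1) - quadForm (Γ.map conj) (y - z.1))

/-- The phase `Ψ^{(φ,Θ)}(p; x, y)`, where `φ (y, p) = (Q, P)`. -/
def phaseJ {d : ℕ} (φ : Phase d → Phase d) (S : Phase d → ℝ)
    (Θ : Phase d → Matrix (Fin d) (Fin d) ℂ) (p x y : Conf d) : ℂ :=
  ((S (y, p) + inner ℝ (φ (y, p)).2 (x - (φ (y, p)).1) : ℝ) : ℂ)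
    + (1 / 2) * quadForm (Θ (y, p)) (x - (φ (y, p)).1)

/-! ### The two kinds of operators

The Schwartz kernels are oscillatory integrals over the frequency variables. As usual for such
kernels, the operator is applied to a Schwartz function by integrating first in `y` and then in the
frequency variables; both integrations then converge absolutely. -/

/-- The integrand `e^{iΦ/ħ} a(x, z) ψ(y)` of the operator with `2d` frequency variables. -/
def integrandI {d : ℕ} (φ : Phase d → Phase d) (S : Phase d → ℝ)
    (Θ : Phase d → Matrix (Fin d) (Fin d) ℂ) (Γ : Matrix (Fin d) (Fin d) ℂ)
    (a : Conf d × Phase d → ℂ) (ħ : ℝ) (ψ : 𝓢(Conf d, ℂ)) (x : Conf d) (z : Phase d)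
    (y : Conf d) : ℂ :=
  Complex.exp (Complex.I / ħ * phaseI φ S Θ Γ z x y) * a (x, z) * ψ y

/-- The operator `ℐ(a, Φ^{(φ,Θ,Γ)})` on Schwartz functions. -/
def opI {d : ℕ} (φ : Phase d → Phase d) (S : Phase d → ℝ)
    (Θ : Phase d → Matrix (Fin d) (Fin d) ℂ) (Γ : Matrix (Fin d) (Fin d) ℂ)
    (a : Conf d × Phase d → ℂ) (ħ : ℝ) (ψ : 𝓢(Conf d, ℂ)) (x : Conf d) : ℂ :=
  (((2 * Real.pi * ħ) ^ (-(3 * (d : ℝ) / 2)) : ℝ) : ℂ) *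
    ∫ z : Phase d, ∫ y : Conf d, integrandI φ S Θ Γ a ħ ψ x z y

/-- The integrand `e^{iΨ/ħ} u(x, y, p) ψ(y)` of the operator with `d` frequency variables. -/
def integrandJ {d : ℕ} (φ : Phase d → Phase d) (S : Phase d → ℝ)
    (Θ : Phase d → Matrix (Fin d) (Fin d) ℂ) (u : Conf d × Conf d × Conf d → ℂ)
    (ħ : ℝ) (ψ : 𝓢(Conf d, ℂ)) (x p y : Conf d) : ℂ :=
  Complex.exp (Complex.I / ħ * phaseJ φ S Θ p x y) * u (x, y, p) * ψ y

/-- The operator `𝒥(u, Ψ^{(φ,Θ)})` on Schwartz functions. -/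
def opJ {d : ℕ} (φ : Phase d → Phase d) (S : Phase d → ℝ)
    (Θ : Phase d → Matrix (Fin d) (Fin d) ℂ) (u : Conf d × Conf d × Conf d → ℂ)
    (ħ : ℝ) (ψ : 𝓢(Conf d, ℂ)) (x : Conf d) : ℂ :=
  (((2 * Real.pi * ħ) ^ (-(d : ℝ)) : ℝ) : ℂ) *
    ∫ p : Conf d, ∫ y : Conf d, integrandJ φ S Θ u ħ ψ x p y

/-- The iterated integral of `F` (inner variable second) converges absolutely at both stages. -/
def IteratedIntegrable {V W : Type*} [MeasureSpace V] [MeasureSpace W] (F : V → W → ℂ) : Prop :=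
  (∀ v, Integrable (F v)) ∧ Integrable (fun v => ∫ w, F v w)

/-- A continuous operator `T : 𝓢 → 𝓢'` is given by the function-valued operator `A`. -/
def IsGivenBy {d : ℕ} (T : 𝓢(Conf d, ℂ) →L[ℂ] 𝓢'(Conf d, ℂ))
    (A : 𝓢(Conf d, ℂ) → Conf d → ℂ) : Prop :=
  ∀ ψ χ : 𝓢(Conf d, ℂ), Integrable (fun x => χ x * A ψ x) ∧ T ψ χ = ∫ x, χ x * A ψ x

/-! ### Coherent states and the Fourier-Bargmann transform -/

/-- The exponent of the coherent state centred at `z = (q, p)`. -/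
def coherentExponent {d : ℕ} (ħ : ℝ) (z : Phase d) (x : Conf d) : ℂ :=
  Complex.I / ħ * ((inner ℝ z.2 x - inner ℝ z.2 z.1 / 2 : ℝ) : ℂ)
    - ((‖x - z.1‖ ^ 2 / (2 * ħ) : ℝ) : ℂ)

section GaussianDecay

variable {E : Type} [NormedAddCommGroup E] [InnerProductSpace ℝ E]

lemma temperate_fderiv {F : Type} [NormedAddCommGroup F] [NormedSpace ℝ F]
    {G : E → F} (hG : G.HasTemperateGrowth) : (fderiv ℝ G).HasTemperateGrowth := by
  refine ⟨hG.1.fderiv_right (by simp), fun n => ?_⟩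
  obtain ⟨k, C, h⟩ := hG.2 (n + 1)
  refine ⟨k, C, fun x => ?_⟩
  rw [norm_iteratedFDeriv_fderiv]
  exact h x

lemma exp_smul_bound {h : E → ℂ} (hh : h.HasTemperateGrowth) (n : ℕ) :
    ∀ (F : Type) [NormedAddCommGroup F] [NormedSpace ℝ F] [NormedSpace ℂ F]
      [IsScalarTower ℝ ℂ F] [SMulCommClass ℝ ℂ F] (G : E → F), G.HasTemperateGrowth →
      ∃ (k : ℕ) (C : ℝ), ∀ x, ‖iteratedFDeriv ℝ n (fun x => Complex.exp (h x) • G x) x‖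
        ≤ C * (1 + ‖x‖) ^ k * Real.exp (h x).re := by
  induction n with
  | zero =>
    intro F _ _ _ _ _ G hG
    obtain ⟨k, C, hC⟩ := hG.2 0
    refine ⟨k, C, fun x => ?_⟩
    have := hC x
    simp only [norm_iteratedFDeriv_zero] at this ⊢
    rw [norm_smul, Complex.norm_exp, mul_comm]
    gcongr
  | succ n ih =>
    intro F _ _ _ _ _ G hG
    have hd : Differentiable ℝ h := hh.1.differentiable (by simp)
    have hGd : Differentiable ℝ G := hG.1.differentiable (by simp)
    let B : (E →L[ℝ] ℂ) →L[ℝ] F →L[ℝ] (E →L[ℝ] F) :=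
      ((ContinuousLinearMap.compL ℝ E ℂ F).comp
        (ContinuousLinearMap.lsmul ℝ ℂ : ℂ →L[ℝ] F →L[ℝ] F).flip).flip
    have hB : (fun x => B (fderiv ℝ h x) (G x)).HasTemperateGrowth :=
      B.bilinear_hasTemperateGrowth (𝕜 := ℝ) (temperate_fderiv hh) hG
    obtain ⟨k, C, hC⟩ := ih (E →L[ℝ] F) (fun x => fderiv ℝ G x + B (fderiv ℝ h x) (G x))
      ((temperate_fderiv hG).add hB)
    refine ⟨k, C, fun x => ?_⟩
    rw [← norm_iteratedFDeriv_fderiv]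
    convert hC x using 4 with y
    refine ((hd y).hasFDerivAt.cexp.smul (hGd y).hasFDerivAt).fderiv.trans ?_
    ext v
    simp [B, smul_smul]

lemma exp_decay (k : ℕ) {c : ℝ} (hc : 0 < c) (b : ℝ) :
    ∃ C : ℝ, ∀ t : ℝ, 0 ≤ t → (1 + t) ^ k * Real.exp (b * t - c * t ^ 2) ≤ C := by
  refine ⟨k.factorial * Real.exp (1 + (b + 1) ^ 2 / (4 * c)), fun t ht => ?_⟩
  have h1 : (1 + t) ^ k ≤ k.factorial * Real.exp (1 + t) := by
    have := Real.pow_div_factorial_le_exp (1 + t) (by positivity) k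
    rwa [div_le_iff₀ (by positivity), mul_comm] at this
  calc (1 + t) ^ k * Real.exp (b * t - c * t ^ 2)
      ≤ k.factorial * Real.exp (1 + t) * Real.exp (b * t - c * t ^ 2) := by gcongr
    _ = k.factorial * Real.exp (1 + t + (b * t - c * t ^ 2)) := by
        rw [mul_assoc, ← Real.exp_add]
    _ ≤ _ := by
        gcongr ?_ * ?_
        rw [Real.exp_le_exp]
        have : (b + 1) * t - c * t ^ 2 ≤ (b + 1) ^ 2 / (4 * c) := by
          rw [le_div_iff₀ (by positivity)]
          nlinarith [sq_nonneg (2 * c * t - (b + 1))]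
        linarith

lemma exp_schwartz {h : E → ℂ} (hh : h.HasTemperateGrowth) {c : ℝ} (hc : 0 < c) (b a : ℝ)
    (hre : ∀ x, (h x).re ≤ a + b * ‖x‖ - c * ‖x‖ ^ 2) (k n : ℕ) :
    ∃ C : ℝ, ∀ x, ‖x‖ ^ k * ‖iteratedFDeriv ℝ n (fun x => Complex.exp (h x)) x‖ ≤ C := by
  obtain ⟨l, C, hC⟩ := exp_smul_bound hh n ℂ (fun _ => (1 : ℂ)) (.const 1)
  simp only [smul_eq_mul, mul_one] at hC
  obtain ⟨D, hD⟩ := exp_decay (k + l) hc b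
  refine ⟨|C| * Real.exp a * D, fun x => ?_⟩
  calc _ ≤ (1 + ‖x‖) ^ k * (|C| * (1 + ‖x‖) ^ l * Real.exp (a + b * ‖x‖ - c * ‖x‖ ^ 2)) := by
        gcongr
        · linarith
        · refine (hC x).trans ?_
          gcongr
          · exact le_abs_self C
          · exact hre x
    _ = |C| * Real.exp a * ((1 + ‖x‖) ^ (k + l) * Real.exp (b * ‖x‖ - c * ‖x‖ ^ 2)) := by
        rw [add_sub_assoc, Real.exp_add, pow_add]; ring
    _ ≤ _ := by
        gcongr
        exact hD _ (norm_nonneg x)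
end GaussianDecay


lemma coherentExponent_temperate {d : ℕ} (ħ : ℝ) (z : Phase d) :
    (coherentExponent ħ z).HasTemperateGrowth := by
  have h1 : (fun x : Conf d => ‖x - z.1‖ ^ 2).HasTemperateGrowth :=
    (Function.hasTemperateGrowth_norm_sq (Conf d)).comp (g := fun x : Conf d => ‖x‖ ^ 2)
      (f := fun x => x - z.1) (by fun_prop)
  unfold coherentExponent
  simp only [div_eq_mul_inv]
  fun_prop

lemma coherentExponent_re {d : ℕ} {ħ : ℝ} (hħ : 0 < ħ) (z : Phase d) (x : Conf d) :
    (coherentExponent ħ z x).re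
      ≤ 0 + (‖z.1‖ / ħ) * ‖x‖ - (1 / (2 * ħ)) * ‖x‖ ^ 2 := by
  have h1 : (coherentExponent ħ z x).re = -(‖x - z.1‖ ^ 2 / (2 * ħ)) := by
    unfold coherentExponent
    rw [Complex.sub_re, Complex.ofReal_re, Complex.re_mul_ofReal]
    simp [Complex.div_ofReal_re]
  have h2 : ‖x‖ ^ 2 - 2 * ‖z.1‖ * ‖x‖ ≤ ‖x - z.1‖ ^ 2 := by
    rw [norm_sub_sq_real]
    nlinarith [real_inner_le_norm x z.1, sq_nonneg ‖z.1‖]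
  rw [h1]
  have h3 : (‖x‖ ^ 2 - 2 * ‖z.1‖ * ‖x‖) / (2 * ħ) ≤ ‖x - z.1‖ ^ 2 / (2 * ħ) := by gcongr
  have h4 : (‖x‖ ^ 2 - 2 * ‖z.1‖ * ‖x‖) / (2 * ħ)
      = (1 / (2 * ħ)) * ‖x‖ ^ 2 - (‖z.1‖ / ħ) * ‖x‖ := by field_simp
  linarith

/-- The coherent state `φ_z(x) = (πħ)^{-d/4} exp((i/ħ)(p · x - p · q / 2) - |x - q|² / (2ħ))` at
`z = (q, p)`, as a Schwartz function. -/
def coherentState {d : ℕ} {ħ : ℝ} (hħ : 0 < ħ) (z : Phase d) : 𝓢(Conf d, ℂ) where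
  toFun x := (((Real.pi * ħ) ^ (-((d : ℝ) / 4)) : ℝ) : ℂ) * Complex.exp (coherentExponent ħ z x)
  smooth' := contDiff_const.mul (coherentExponent_temperate ħ z).1.cexp
  decay' k n := by
    obtain ⟨C, hC⟩ := exp_schwartz (coherentExponent_temperate ħ z) (c := 1 / (2 * ħ))
      (by positivity) (‖z.1‖ / ħ) 0 (coherentExponent_re hħ z) k n
    refine ⟨|(Real.pi * ħ) ^ (-((d : ℝ) / 4))| * C, fun x => ?_⟩
    have h := iteratedFDeriv_const_smul_apply' (𝕜 := ℝ) (i := n) (x := x)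
      (a := (((Real.pi * ħ) ^ (-((d : ℝ) / 4)) : ℝ) : ℂ))
      (f := fun x => Complex.exp (coherentExponent ħ z x))
      ((coherentExponent_temperate ħ z).1.cexp.contDiffAt.of_le (mod_cast le_top))
    simp only [smul_eq_mul] at h
    rw [h, norm_smul, Complex.norm_real, Real.norm_eq_abs, mul_left_comm]
    gcongr
    exact hC x

/-- The complex conjugate of the coherent state. -/
def conjCoherentState {d : ℕ} {ħ : ℝ} (hħ : 0 < ħ) (z : Phase d) : 𝓢(Conf d, ℂ) :=
  SchwartzMap.postcompCLM (𝕜 := ℝ) (Complex.conjCLE : ℂ →L[ℝ] ℂ) (coherentState hħ z)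

/-- The Fourier-Bargmann transform `F_B T(z) = (2πħ)^{-d/2} ⟨T, φ_z⟩` of a tempered
distribution. On `L²` functions this is the integral of `T` against the conjugate of `φ_z`. -/
def fourierBargmann {d : ℕ} {ħ : ℝ} (hħ : 0 < ħ) (T : 𝓢'(Conf d, ℂ)) (z : Phase d) : ℂ :=
  (((2 * Real.pi * ħ) ^ (-((d : ℝ) / 2)) : ℝ) : ℂ) * T (conjCoherentState hħ z)

/-- The image `F_B^* δ_X = (2πħ)^{-d/2} φ_X` of a point mass under the adjoint transform
`F_B^* f = (2πħ)^{-d/2} ∫ f(X) φ_X dX`. -/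
def bargmannAdjointDelta {d : ℕ} {ħ : ℝ} (hħ : 0 < ħ) (X : Phase d) : 𝓢(Conf d, ℂ) :=
  (((2 * Real.pi * ħ) ^ (-((d : ℝ) / 2)) : ℝ) : ℂ) • coherentState hħ X

/-- The Schwartz kernel of `F_B T F_B^*`: its value at `(X, Y)` (`X` the incoming, `Y` the outgoing
variable) is `F_B T F_B^* δ_X` at `Y`, that is `(2πħ)^{-d} ⟨T φ_X, φ_Y⟩`. -/
def bargmannKernel {d : ℕ} {ħ : ℝ} (hħ : 0 < ħ) (T : 𝓢(Conf d, ℂ) →L[ℂ] 𝓢'(Conf d, ℂ))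
    (X Y : Phase d) : ℂ :=
  fourierBargmann hħ (T (bargmannAdjointDelta hħ X)) Y

/-! ### Semiclassical Fourier integral operators -/

/-- `T : 𝓢 → 𝓢'` extends to a bounded operator on `L²` with operator norm at most `C`. -/
def IsL2BoundedBy {d : ℕ} (T : 𝓢(Conf d, ℂ) →L[ℂ] 𝓢'(Conf d, ℂ)) (C : ℝ) : Prop :=
  ∃ B : Lp ℂ 2 (volume : Measure (Conf d)) →L[ℂ] Lp ℂ 2 (volume : Measure (Conf d)),
    ‖B‖ ≤ C ∧ ∀ ψ : 𝓢(Conf d, ℂ), T ψ = Lp.toTemperedDistribution (B (ψ.toLp 2 volume))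

/-- The kernels of `F_B V^ħ F_B^*` are concentrated on the graph of `φ`, at order `m`: for
every `N` they are bounded by `C_N ħ^{m - d} (1 + |Y - φ(X)| / √ħ)^{-N}`, uniformly in
`ħ ∈ (0, 1]`. The factor `ħ^{-d}` is that of a uniformly `L²`-bounded operator, as `F_B` is an
isometry. -/
def BargmannKernelDecay {d : ℕ} (m : ℝ) (φ : Phase d → Phase d)
    (V : ℝ → 𝓢(Conf d, ℂ) →L[ℂ] 𝓢'(Conf d, ℂ)) : Prop :=
  ∀ N : ℕ, ∃ C : ℝ, ∀ (ħ : ℝ) (hħ : 0 < ħ), ħ ≤ 1 → ∀ X Y : Phase d,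
    ‖bargmannKernel hħ (V ħ) X Y‖
      ≤ C * ħ ^ (m - d) * ((1 + phaseNorm (Y - φ X) / Real.sqrt ħ) ^ N)⁻¹

/-- The family `U^ħ : 𝓢 → 𝓢'`, `ħ ∈ (0, 1]`, is a semiclassical Fourier integral operator of order
`m` associated with `φ`: up to remainders of operator norm `O(ħ^{N'})` on `L²`, for every `N'`, its
Bargmann kernels are concentrated on the graph of `φ`. -/
def IsSemiclassicalFIO {d : ℕ} (m : ℝ) (φ : Phase d → Phase d)
    (U : ℝ → 𝓢(Conf d, ℂ) →L[ℂ] 𝓢'(Conf d, ℂ)) : Prop :=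
  ∀ N' : ℕ, ∃ V R : ℝ → 𝓢(Conf d, ℂ) →L[ℂ] 𝓢'(Conf d, ℂ),
    (∀ ħ ∈ Set.Ioc (0 : ℝ) 1, U ħ = V ħ + R ħ) ∧
    (∃ C : ℝ, ∀ ħ ∈ Set.Ioc (0 : ℝ) 1, IsL2BoundedBy (R ħ) (C * ħ ^ N')) ∧
    BargmannKernelDecay m φ V

end SemiclassicalFIO

end

open SemiclassicalFIO

/-! Conjugation by the dilation with factor `√ħ` replaces `φ` by `ħ^{-1/2} φ(ħ^{1/2} ·)`, `S` by
`ħ⁻¹ S(ħ^{1/2} ·)`, and `Θ` and the symbols by their composites with the dilation. The phase is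
homogeneous of degree two under this scaling, so the factor `1/ħ` disappears. Since `ħ ≤ 1`,
derivatives of order at least one of the scaled map, and those derivatives of `Θ` and of the symbols
that are bounded, stay bounded uniformly in `ħ`. It remains to treat `ħ = 1` for families with
uniform symbol bounds.

The operator is then a superposition, over a parameter `τ`, of operators with bounded kernels. It is
tested between Gaussian wave packets at `X = (q₁, p₁)` and `Y = (q₂, p₂)`. For `𝒥`, the parameter is
the frequency `p`. The identity `dS = P · dQ - p · dq` makes the gradient of the phase plus `p · y -
P(q₁) · x` of size `|y - q₁| + |x - Q(y)|` (`hasFDerivAt_centredLinear`, `tame_centredPhase`), and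
the packets together with `Im Θ` give Gaussian decay in these distances. A matrix element is
therefore a Fourier integral of a rapidly decreasing amplitude at the frequency `(p - p₁, P(q₁) -
p₂)`. Integration by parts bounds it by every negative power of `1 + |p - p₁| + |φ(q₁, p) - Y|`
(`packet_decay`). As `φ` is Lipschitz, this is an integrable function of `p` times `(1 + |Y -
φ(X)|)^{-N}` (`isGraphKernel_J`).

For `ℐ`, the volume-preserving substitution `φ(z) = (x - w, P)` is made, with `τ = (w, P)`. The
complex conjugate of the kernel at fixed `τ`, translated by `w`, is a kernel of the previous kind
for `φ⁻¹`, with `x` and `y` exchanged, frequency `P` and the constant matrix `Γ` (`conj_kernelI`).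
The field `Θ` survives only in the amplitude `exp(-(i/2) conj(Θ w · w))`, where `w` is a parameter.
Derivatives of the exponent see only derivatives of `Θ`, and the powers of `|w|` they produce are
absorbed by the Gaussian (`uniformSymbol_conjAmplitude`). Hence `Θ` may be unbounded in (i). In (ii)
it multiplies `x - Q(y)`, which varies with the variables of integration, and its boundedness is
used.

Undoing the scaling turns the decay of matrix elements into the estimate of the Bargmann kernels. As
`φ` is bilipschitz, the same decay bounds the row and column integrals, and Schur's test with the
Plancherel inequality for the wave packet transform gives the `L²` bound (`packet_schur`,
`HasGraphDecay.l2_bound`). The operator is obtained from the bounded pairing by density, and no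
remainder is needed in the definition of a semiclassical Fourier integral operator. -/

noncomputable section

namespace SemiclassicalFIO

/-! ### Families of symbols -/

section SymbolCalculus

variable {ι κ' V W E F G : Type*} [NormedAddCommGroup V] [NormedSpace ℝ V]
  [NormedAddCommGroup W] [NormedSpace ℝ W] [NormedAddCommGroup E] [NormedSpace ℝ E]
  [NormedAddCommGroup F] [NormedSpace ℝ F] [NormedAddCommGroup G] [NormedSpace ℝ G]

/-- A family of functions whose derivatives of order at least `m` are bounded, uniformly in the
index. -/
def UniformSymbol (m : ℕ) (f : ι → V → W) : Prop :=
  (∀ i, ContDiff ℝ ∞ (f i)) ∧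
    ∀ k : ℕ, m ≤ k → ∃ C : ℝ, ∀ i x, ‖iteratedFDeriv ℝ k (f i) x‖ ≤ C

/-- A family of smooth functions whose derivatives are bounded by `κ` times powers of the
weight `ρ`, uniformly in the index. -/
def Tame (ρ κ : ι → V → ℝ) (f : ι → V → W) : Prop :=
  (∀ i, ContDiff ℝ ∞ (f i)) ∧
    ∀ k : ℕ, ∃ (m : ℕ) (C : ℝ), ∀ i x, ‖iteratedFDeriv ℝ k (f i) x‖ ≤ C * ρ i x ^ m * κ i x

lemma IsSymbol.uniformSymbol {m : ℕ} {f : V → W} (hf : IsSymbol m f) :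
    UniformSymbol m (fun _ : ι => f) :=
  ⟨fun _ => hf.1, fun k hk => (hf.2 k hk).imp fun _ hC _ => hC⟩

lemma UniformSymbol.reindex {m : ℕ} {f : ι → V → W} (hf : UniformSymbol m f) (r : κ' → ι) :
    UniformSymbol m (fun j => f (r j)) :=
  ⟨fun _ => hf.1 _, fun k hk => (hf.2 k hk).imp fun _ hC _ => hC _⟩

lemma UniformSymbol.fderiv {m : ℕ} {f : ι → V → W} (hf : UniformSymbol (m + 1) f) :
    UniformSymbol m (fun i => _root_.fderiv ℝ (f i)) :=
  ⟨fun i => (hf.1 i).fderiv_right (by simp), fun k hk => (hf.2 (k + 1) (by omega)).imp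
    fun _ hC i x => by rw [norm_iteratedFDeriv_fderiv]; exact hC i x⟩

lemma UniformSymbol.of_fderiv {m : ℕ} {f : ι → V → W} (hf : ∀ i, Differentiable ℝ (f i))
    (h : UniformSymbol m (fun i => _root_.fderiv ℝ (f i))) : UniformSymbol (m + 1) f := by
  refine ⟨fun i => contDiff_infty_iff_fderiv.2 ⟨hf i, h.1 i⟩, fun k hk => ?_⟩
  obtain ⟨k, rfl⟩ : ∃ j, k = j + 1 := ⟨k - 1, by omega⟩
  obtain ⟨C, hC⟩ := h.2 k (by omega)
  exact ⟨C, fun i x => by rw [← norm_iteratedFDeriv_fderiv]; exact hC i x⟩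

lemma UniformSymbol.of_bound {f : ι → V → W} (hf : UniformSymbol 1 f) {C : ℝ}
    (h : ∀ i x, ‖f i x‖ ≤ C) : UniformSymbol 0 f := by
  refine ⟨hf.1, fun k _ => ?_⟩
  rcases Nat.eq_zero_or_pos k with rfl | hk
  · exact ⟨C, by simpa using h⟩
  · exact hf.2 k hk

lemma UniformSymbol.bound {f : ι → V → W} (hf : UniformSymbol 0 f) :
    ∃ C : ℝ, 0 ≤ C ∧ ∀ i x, ‖f i x‖ ≤ C := by
  obtain ⟨C, hC⟩ := hf.2 0 le_rfl
  exact ⟨max C 0, le_max_right _ _, fun i x => le_max_of_le_left (by simpa using hC i x)⟩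

lemma UniformSymbol.lipschitz {f : ι → V → W} (hf : UniformSymbol 1 f) :
    ∃ K : ℝ, 1 ≤ K ∧ ∀ i x y, ‖f i x - f i y‖ ≤ K * ‖x - y‖ := by
  obtain ⟨C, hC⟩ := hf.2 1 le_rfl
  refine ⟨max C 1, le_max_right _ _, fun i x y => ?_⟩
  refine Convex.norm_image_sub_le_of_norm_fderiv_le (𝕜 := ℝ) (s := Set.univ)
    (fun z _ => (hf.1 i).differentiable (by simp) z) (fun z _ => ?_) convex_univ trivial trivial
  refine le_max_of_le_left ((le_of_eq ?_).trans (hC i z))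
  rw [← norm_fderiv_iteratedFDeriv, ← norm_iteratedFDeriv_zero (𝕜 := ℝ) (f := _root_.fderiv ℝ (f i)),
    norm_iteratedFDeriv_fderiv, norm_fderiv_iteratedFDeriv]

/-- Affine maps with a common linear part. -/
lemma uniformSymbol_affine (A : V →L[ℝ] W) (b : ι → W) :
    UniformSymbol 1 (fun i x => A x + b i) := by
  refine UniformSymbol.of_fderiv (m := 0) (fun i => by fun_prop) ?_
  have h : (fun i => fderiv ℝ (fun x => A x + b i)) = fun _ : ι => fun _ : V => A := by
    ext i x : 2
    simp
  rw [h]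
  refine ⟨fun _ => contDiff_const, fun k _ => ⟨‖A‖, fun i x => ?_⟩⟩
  rcases Nat.eq_zero_or_pos k with rfl | hk
  · simp
  · rw [iteratedFDeriv_const_of_ne hk.ne']; simp

/-- Bounded symbols are tame for trivial weights, so the product and chain rules need proof only for
`Tame`. -/
lemma uniformSymbol_zero_iff {f : ι → V → W} :
    UniformSymbol 0 f ↔ Tame (fun _ _ => 1) (fun _ _ => 1) f := by
  refine ⟨fun h => ⟨h.1, fun k => ?_⟩, fun h => ⟨h.1, fun k _ => ?_⟩⟩
  · obtain ⟨C, hC⟩ := h.2 k (Nat.zero_le _)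
    exact ⟨0, C, by simpa using hC⟩
  · obtain ⟨m, C, hC⟩ := h.2 k
    exact ⟨C, by simpa using hC⟩

/-! ### Calculus of tame families: sums, products, composition, exponentials -/

namespace Tame

variable {ρ κ : ι → V → ℝ}

lemma mono {ρ' κ' : ι → V → ℝ} {f : ι → V → W} (hf : Tame ρ κ f) (hρ : ∀ i x, 0 ≤ ρ i x)
    (h : ∀ i x, ρ i x ≤ ρ' i x) (hκ : ∀ i x, 0 ≤ κ i x) (h' : ∀ i x, κ i x ≤ κ' i x) :
    Tame ρ' κ' f := by
  refine ⟨hf.1, fun k => ?_⟩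
  obtain ⟨m, C, hC⟩ := hf.2 k
  refine ⟨m, |C|, fun i x => (hC i x).trans ?_⟩
  have h1 := hρ i x
  have h2 := hκ i x
  have h3 := h i x
  have h4 := h' i x
  have h5 : 0 ≤ ρ' i x := h1.trans h3
  gcongr
  exact le_abs_self C

/-- Bounds with a nonnegative constant and a common exponent for all derivatives up to a given
order. -/
lemma uniform {f : ι → V → W} (hf : Tame ρ κ f) (hρ : ∀ i x, 1 ≤ ρ i x) (hκ : ∀ i x, 0 ≤ κ i x)
    (n : ℕ) : ∃ (m : ℕ) (C : ℝ), 0 ≤ C ∧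
      ∀ k ≤ n, ∀ i x, ‖iteratedFDeriv ℝ k (f i) x‖ ≤ C * ρ i x ^ m * κ i x := by
  choose m C hC using hf.2
  refine ⟨∑ k ∈ Finset.range (n + 1), m k, ∑ k ∈ Finset.range (n + 1), |C k|, by positivity,
    fun k hk i x => (hC k i x).trans ?_⟩
  have h1 := hρ i x
  have h2 := hκ i x
  have hk' : k ∈ Finset.range (n + 1) := Finset.mem_range_succ_iff.2 hk
  have h3 : C k ≤ ∑ k ∈ Finset.range (n + 1), |C k| :=
    (le_abs_self _).trans (Finset.single_le_sum (f := fun k => |C k|) (fun _ _ => abs_nonneg _) hk')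
  have h4 : m k ≤ ∑ k ∈ Finset.range (n + 1), m k :=
    Finset.single_le_sum (f := m) (fun _ _ => Nat.zero_le _) hk'
  have h5 : ρ i x ^ m k ≤ ρ i x ^ (∑ k ∈ Finset.range (n + 1), m k) := pow_le_pow_right₀ h1 h4
  have : 0 ≤ ∑ k ∈ Finset.range (n + 1), |C k| := by positivity
  gcongr

lemma congr {f g : ι → V → W} (hf : Tame ρ κ f) (h : ∀ i x, f i x = g i x) : Tame ρ κ g := by
  have : f = g := by ext i x; exact h i x
  exact this ▸ hf

lemma fderiv {f : ι → V → W} (hf : Tame ρ κ f) : Tame ρ κ (fun i => fderiv ℝ (f i)) :=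
  ⟨fun i => (hf.1 i).fderiv_right (by simp), fun k => (hf.2 (k + 1)).imp
    fun _ => .imp fun _ hC i x => by rw [norm_iteratedFDeriv_fderiv]; exact hC i x⟩

lemma add {f g : ι → V → W} (hf : Tame ρ κ f) (hg : Tame ρ κ g) (hρ : ∀ i x, 1 ≤ ρ i x)
    (hκ : ∀ i x, 0 ≤ κ i x) : Tame ρ κ (fun i x => f i x + g i x) := by
  refine ⟨fun i => (hf.1 i).add (hg.1 i), fun k => ?_⟩
  obtain ⟨m, C, hC0, hC⟩ := hf.uniform hρ hκ k
  obtain ⟨n, D, hD0, hD⟩ := hg.uniform hρ hκ k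
  refine ⟨m + n, C + D, fun i x => ?_⟩
  have h1 := hρ i x
  have h2 := hκ i x
  have h := iteratedFDeriv_add_apply (𝕜 := ℝ) (i := k) (x := x)
    ((hf.1 i).contDiffAt.of_le (mod_cast le_top)) ((hg.1 i).contDiffAt.of_le (mod_cast le_top))
  change ‖iteratedFDeriv ℝ k (f i + g i) x‖ ≤ _
  rw [h]
  refine (norm_add_le _ _).trans ((add_le_add (hC k le_rfl i x) (hD k le_rfl i x)).trans ?_)
  have h3 : ρ i x ^ m ≤ ρ i x ^ (m + n) := pow_le_pow_right₀ h1 (by omega)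
  have h4 : ρ i x ^ n ≤ ρ i x ^ (m + n) := pow_le_pow_right₀ h1 (by omega)
  calc _ ≤ C * ρ i x ^ (m + n) * κ i x + D * ρ i x ^ (m + n) * κ i x := by gcongr
    _ = _ := by ring

lemma zero : Tame ρ κ (fun (_ : ι) (_ : V) => (0 : W)) := by
  refine ⟨fun _ => contDiff_const, fun k => ⟨0, 0, fun i x => ?_⟩⟩
  simp [iteratedFDeriv_fun_zero]

lemma sum {α : Type*} {s : Finset α} {f : α → ι → V → W} (hρ : ∀ i x, 1 ≤ ρ i x)
    (hκ : ∀ i x, 0 ≤ κ i x) (hf : ∀ a ∈ s, Tame ρ κ (f a)) :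
    Tame ρ κ (fun i x => ∑ a ∈ s, f a i x) := by
  classical
  induction s using Finset.induction_on with
  | empty => simpa using zero
  | insert a s ha ih =>
    simp only [Finset.sum_insert ha]
    exact (hf a (by simp)).add (ih fun b hb => hf b (by simp [hb])) hρ hκ

/-- Leibniz rule. -/
lemma bilin {κ₁ κ₂ : ι → V → ℝ} {f : ι → V → E} {g : ι → V → F} (B : E →L[ℝ] F →L[ℝ] G)
    (hf : Tame ρ κ₁ f) (hg : Tame ρ κ₂ g) (hρ : ∀ i x, 1 ≤ ρ i x) (hκ₁ : ∀ i x, 0 ≤ κ₁ i x)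
    (hκ₂ : ∀ i x, 0 ≤ κ₂ i x) :
    Tame ρ (fun i x => κ₁ i x * κ₂ i x) (fun i x => B (f i x) (g i x)) := by
  refine ⟨fun i => (B.isBoundedBilinearMap.contDiff).comp₂ (hf.1 i) (hg.1 i), fun k => ?_⟩
  obtain ⟨m, C, hC0, hC⟩ := hf.uniform hρ hκ₁ k
  obtain ⟨n, D, hD0, hD⟩ := hg.uniform hρ hκ₂ k
  refine ⟨m + n, ‖B‖ * ∑ j ∈ Finset.range (k + 1), (k.choose j : ℝ) * C * D, fun i x => ?_⟩
  have h1 := hρ i x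
  have h2 := hκ₁ i x
  have h3 := hκ₂ i x
  refine (B.norm_iteratedFDeriv_le_of_bilinear (hf.1 i) (hg.1 i) x (mod_cast le_top)).trans ?_
  calc _ ≤ ‖B‖ * ∑ j ∈ Finset.range (k + 1), (k.choose j : ℝ) * (C * ρ i x ^ m * κ₁ i x) *
        (D * ρ i x ^ n * κ₂ i x) := by
        gcongr with j hj
        · exact hC j (Finset.mem_range_succ_iff.1 hj) i x
        · exact hD (k - j) (by omega) i x
    _ = _ := by
        simp only [mul_assoc, Finset.mul_sum, Finset.sum_mul]
        refine Finset.sum_congr rfl fun j _ => ?_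
        rw [pow_add]; ring

lemma bilin_one {f : ι → V → E} {g : ι → V → F} (B : E →L[ℝ] F →L[ℝ] G)
    (hf : Tame ρ (fun _ _ => 1) f) (hg : Tame ρ (fun _ _ => 1) g) (hρ : ∀ i x, 1 ≤ ρ i x) :
    Tame ρ (fun _ _ => 1) (fun i x => B (f i x) (g i x)) := by
  simpa using hf.bilin B hg hρ (by simp) (by simp)

lemma mul {κ₁ κ₂ : ι → V → ℝ} {f g : ι → V → ℂ}
    (hf : Tame ρ κ₁ f) (hg : Tame ρ κ₂ g) (hρ : ∀ i x, 1 ≤ ρ i x) (hκ₁ : ∀ i x, 0 ≤ κ₁ i x)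
    (hκ₂ : ∀ i x, 0 ≤ κ₂ i x) :
    Tame ρ (fun i x => κ₁ i x * κ₂ i x) (fun i x => f i x * g i x) :=
  hf.bilin (ContinuousLinearMap.mul ℝ ℂ) hg hρ hκ₁ hκ₂

lemma mul_one {f g : ι → V → ℂ}
    (hf : Tame ρ (fun _ _ => 1) f) (hg : Tame ρ (fun _ _ => 1) g) (hρ : ∀ i x, 1 ≤ ρ i x) :
    Tame ρ (fun _ _ => 1) (fun i x => f i x * g i x) :=
  hf.bilin_one (ContinuousLinearMap.mul ℝ ℂ) hg hρ

lemma clm {f : ι → V → E} (hf : Tame ρ κ f) (A : E →L[ℝ] F) (hρ : ∀ i x, 0 ≤ ρ i x)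
    (hκ : ∀ i x, 0 ≤ κ i x) : Tame ρ κ (fun i x => A (f i x)) := by
  refine ⟨fun i => A.contDiff.comp (hf.1 i), fun k => ?_⟩
  obtain ⟨m, C, hC⟩ := hf.2 k
  refine ⟨m, ‖A‖ * |C|, fun i x => ?_⟩
  have h2 := hκ i x
  have h3 := hρ i x
  refine (A.norm_iteratedFDeriv_comp_left (hf.1 i).contDiffAt (mod_cast le_top)).trans ?_
  calc _ ≤ ‖A‖ * (C * ρ i x ^ m * κ i x) := by gcongr; exact hC i x
    _ ≤ ‖A‖ * (|C| * ρ i x ^ m * κ i x) := by gcongr; exact le_abs_self C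
    _ = _ := by ring

/-- Only the function itself may grow, so the weight enters with exponent one at order zero and not
at all at higher orders. -/
lemma of_uniformSymbol {f : ι → V → W} (hf : UniformSymbol 1 f) {C : ℝ}
    (h : ∀ i x, ‖f i x‖ ≤ C * ρ i x) : Tame ρ (fun _ _ => 1) f := by
  refine ⟨hf.1, fun k => ?_⟩
  rcases Nat.eq_zero_or_pos k with rfl | hk
  · exact ⟨1, C, by simpa using h⟩
  · obtain ⟨C, hC⟩ := hf.2 k hk
    exact ⟨0, C, by simpa using hC⟩

lemma of_uniformSymbol_zero {f : ι → V → W} (hf : UniformSymbol 0 f) :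
    Tame ρ (fun _ _ => 1) f := by
  refine ⟨hf.1, fun k => ?_⟩
  obtain ⟨C, hC⟩ := hf.2 k (Nat.zero_le _)
  exact ⟨0, C, by simpa using hC⟩

/-- By Faà di Bruno's formula only derivatives of `g` of order at least one occur, so `g` itself may
be unbounded. -/
lemma comp {f : ι → V → W} (hf : Tame ρ κ f) (hρ : ∀ i x, 1 ≤ ρ i x) (hκ : ∀ i x, 0 ≤ κ i x)
    {g : ι → E → V} (hg : UniformSymbol 1 g) :
    Tame (fun i x => ρ i (g i x)) (fun i x => κ i (g i x)) (fun i x => f i (g i x)) := by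
  refine ⟨fun i => (hf.1 i).comp (hg.1 i), fun k => ?_⟩
  obtain ⟨m, C, hC0, hC⟩ := hf.uniform hρ hκ k
  -- The bound is taken at least one so that it lies below its `j`-th power, the form in which Faà
  -- di Bruno's estimate expects it.
  have hD : ∃ D : ℝ, 1 ≤ D ∧ ∀ j, 1 ≤ j → j ≤ k → ∀ i x, ‖iteratedFDeriv ℝ j (g i) x‖ ≤ D := by
    choose! D hD using hg.2
    refine ⟨1 + ∑ j ∈ Finset.range (k + 1), |D j|, by
      linarith [Finset.sum_nonneg fun j (_ : j ∈ Finset.range (k + 1)) => abs_nonneg (D j)],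
      fun j h1 h2 i x => (hD j h1 i x).trans ?_⟩
    have := Finset.single_le_sum (f := fun k => |D k|) (fun _ _ => abs_nonneg _)
      (Finset.mem_range_succ_iff.2 h2)
    linarith [le_abs_self (D j)]
  obtain ⟨D, hD1, hD⟩ := hD
  refine ⟨m, k.factorial * C * D ^ k, fun i x => ?_⟩
  refine (norm_iteratedFDeriv_comp_le (hf.1 i) (hg.1 i) (mod_cast le_top) x
    (C := C * ρ i (g i x) ^ m * κ i (g i x)) (D := D)
    (fun j hj => hC j hj i _) fun j h1 h2 => (hD j h1 h2 i x).trans ?_).trans (le_of_eq (by ring))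
  exact le_self_pow₀ hD1 (by omega)

/-- Exponentials of functions with tame derivative. -/
lemma exp {h : ι → V → ℂ} (hh : ∀ i, ContDiff ℝ ∞ (h i))
    (hD : Tame ρ (fun _ _ => 1) (fun i => _root_.fderiv ℝ (h i))) (hρ : ∀ i x, 1 ≤ ρ i x) :
    Tame ρ (fun i x => Real.exp (h i x).re) (fun i x => Complex.exp (h i x)) := by
  have hs : ∀ i, ContDiff ℝ ∞ (fun x => Complex.exp (h i x)) := fun i => (hh i).cexp
  -- All orders up to `n` are bounded together, because the Leibniz rule for `exp h • Dh` involves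
  -- every lower derivative of `exp h`.
  have key : ∀ n : ℕ, ∃ (m : ℕ) (C : ℝ), 0 ≤ C ∧ ∀ k ≤ n, ∀ i x,
      ‖iteratedFDeriv ℝ k (fun x => Complex.exp (h i x)) x‖
        ≤ C * ρ i x ^ m * Real.exp (h i x).re := by
    intro n
    induction n with
    | zero =>
      refine ⟨0, 1, zero_le_one, fun k hk i x => ?_⟩
      obtain rfl : k = 0 := by omega
      simp [Complex.norm_exp]
    | succ n ih =>
      obtain ⟨m, C, hC0, hC⟩ := ih
      obtain ⟨m', D, hD0, hD⟩ := hD.uniform hρ (by simp) n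
      refine ⟨m + m', C + ∑ j ∈ Finset.range (n + 1), (n.choose j : ℝ) * C * D,
        by positivity, fun k hk i x => ?_⟩
      have h1 := hρ i x
      rcases hk.lt_or_eq with hk | rfl
      · refine (hC k (by omega) i x).trans ?_
        have : ρ i x ^ m ≤ ρ i x ^ (m + m') := pow_le_pow_right₀ h1 (by omega)
        gcongr
        exact le_add_of_nonneg_right (by positivity)
      · rw [← norm_iteratedFDeriv_fderiv]
        have e : _root_.fderiv ℝ (fun x => Complex.exp (h i x))
            = fun x => Complex.exp (h i x) • _root_.fderiv ℝ (h i) x := by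
          ext x : 1
          exact ((((hh i).differentiable (by simp)) x).hasFDerivAt.cexp).fderiv
        rw [e]
        refine (norm_iteratedFDeriv_smul_le (hs i)
          ((hh i).fderiv_right (m := ∞) (by simp)) x (mod_cast le_top)).trans ?_
        calc _ ≤ ∑ j ∈ Finset.range (n + 1), (n.choose j : ℝ) *
              (C * ρ i x ^ m * Real.exp (h i x).re) * (D * ρ i x ^ m' * 1) := by
              gcongr with j hj
              · exact hC j (Finset.mem_range_succ_iff.1 hj) i x
              · exact hD (n - j) (by omega) i x
          _ = (∑ j ∈ Finset.range (n + 1), (n.choose j : ℝ) * C * D)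
                * ρ i x ^ (m + m') * Real.exp (h i x).re := by
              simp only [mul_assoc, Finset.sum_mul]
              refine Finset.sum_congr rfl fun j _ => ?_
              rw [pow_add]; ring
          _ ≤ _ := by
              gcongr
              exact le_add_of_nonneg_left hC0
  refine ⟨hs, fun k => ?_⟩
  obtain ⟨m, C, -, hC⟩ := key k
  exact ⟨m, C, hC k le_rfl⟩

end Tame

lemma UniformSymbol.comp {f : ι → V → W} (hf : UniformSymbol 0 f) {g : ι → E → V}
    (hg : UniformSymbol 1 g) : UniformSymbol 0 (fun i x => f i (g i x)) :=
  uniformSymbol_zero_iff.2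
    ((uniformSymbol_zero_iff.1 hf).comp (fun _ _ => le_rfl) (by simp) hg)

/-- The derivative `Df(g) ∘ Dg` is a product of bounded symbols, although neither `f` nor `g` need
be bounded. -/
lemma UniformSymbol.comp_one {f : ι → V → W} (hf : UniformSymbol 1 f) {g : ι → E → V}
    (hg : UniformSymbol 1 g) : UniformSymbol 1 (fun i x => f i (g i x)) := by
  have hfd : ∀ i, Differentiable ℝ (f i) := fun i => (hf.1 i).differentiable (by simp)
  have hgd : ∀ i, Differentiable ℝ (g i) := fun i => (hg.1 i).differentiable (by simp)
  refine UniformSymbol.of_fderiv (m := 0) (fun i => (hfd i).comp (hgd i)) ?_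
  have e : (fun i => _root_.fderiv ℝ (fun x => f i (g i x)))
      = fun i x => (ContinuousLinearMap.compL ℝ E V W) (_root_.fderiv ℝ (f i) (g i x))
        (_root_.fderiv ℝ (g i) x) := by
    ext i x : 2
    exact fderiv_comp x (hfd i _) (hgd i x)
  rw [e]
  exact uniformSymbol_zero_iff.2 (Tame.bilin_one _
    (uniformSymbol_zero_iff.1 (hf.fderiv.comp hg)) (uniformSymbol_zero_iff.1 hg.fderiv)
    fun _ _ => le_rfl)

lemma UniformSymbol.clm {m : ℕ} {f : ι → V → E} (hf : UniformSymbol m f) (A : E →L[ℝ] F) :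
    UniformSymbol m (fun i x => A (f i x)) := by
  refine ⟨fun i => A.contDiff.comp (hf.1 i), fun k hk => ?_⟩
  obtain ⟨C, hC⟩ := hf.2 k hk
  refine ⟨‖A‖ * C, fun i x => ?_⟩
  refine (A.norm_iteratedFDeriv_comp_left (hf.1 i).contDiffAt (mod_cast le_top)).trans ?_
  gcongr
  exact hC i x

lemma UniformSymbol.add {m : ℕ} {f g : ι → V → E} (hf : UniformSymbol m f)
    (hg : UniformSymbol m g) : UniformSymbol m (fun i x => f i x + g i x) := by
  refine ⟨fun i => (hf.1 i).add (hg.1 i), fun k hk => ?_⟩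
  obtain ⟨C, hC⟩ := hf.2 k hk
  obtain ⟨D, hD⟩ := hg.2 k hk
  refine ⟨C + D, fun i x => ?_⟩
  have h := iteratedFDeriv_add_apply (𝕜 := ℝ) (i := k) (x := x)
    ((hf.1 i).contDiffAt.of_le (mod_cast le_top)) ((hg.1 i).contDiffAt.of_le (mod_cast le_top))
  change ‖iteratedFDeriv ℝ k (f i + g i) x‖ ≤ _
  rw [h]
  exact (norm_add_le _ _).trans (add_le_add (hC i x) (hD i x))

lemma UniformSymbol.prodMk {f : ι → V → E} {g : ι → V → F} {m : ℕ} (hf : UniformSymbol m f)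
    (hg : UniformSymbol m g) : UniformSymbol m (fun i x => (f i x, g i x)) := by
  have := (hf.clm (ContinuousLinearMap.inl ℝ E F)).add (hg.clm (ContinuousLinearMap.inr ℝ E F))
  simpa using this

end SymbolCalculus

/-! ### Decay of Fourier integrals -/

section FourierDecay

variable {ι V : Type*} [NormedAddCommGroup V] [NormedSpace ℝ V] [FiniteDimensional ℝ V]
  [MeasurableSpace V] [BorelSpace V] {μ : Measure V} [μ.IsAddHaarMeasure]

/-- Each integration by parts in the direction `v₀` gains a factor `ℓ v₀`. The constant collects `2
^ n` from the general estimate for Fourier integrals and `(2π) ^ n` from the normalisation of its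
character. -/
lemma fourier_pow_bound {G : V → ℂ} (hG : ContDiff ℝ ∞ G)
    (n : ℕ)
    (hint : ∀ k ≤ n, Integrable (fun v => ‖iteratedFDeriv ℝ k G v‖) μ) (ℓ : V →L[ℝ] ℝ)
    {v₀ : V} (hv₀ : ‖v₀‖ ≤ 1) :
    |ℓ v₀| ^ n * ‖∫ v, Complex.exp (-(Complex.I * ℓ v)) * G v ∂μ‖
      ≤ (4 * Real.pi) ^ n *
        ∑ k ∈ Finset.range (n + 1), ∫ v, ‖iteratedFDeriv ℝ k G v‖ ∂μ := by
  have hπ := Real.pi_pos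
  -- The dual variable is a linear form rather than a vector, since the space of application is a
  -- product with the maximum norm and has no inner product.
  let L : V →L[ℝ] (V →L[ℝ] ℝ) →L[ℝ] ℝ := (ContinuousLinearMap.id ℝ (V →L[ℝ] ℝ)).flip
  have h := VectorFourier.pow_mul_norm_iteratedFDeriv_fourierIntegral_le L (μ := μ) (K := 0)
    (N := n) (f := G) (hG.of_le (mod_cast le_top)) (fun k n hk hn => by
      obtain rfl : k = 0 := by simpa using hk
      simpa using hint n (by exact_mod_cast hn)) (k := 0) (n := n) le_rfl le_rfl v₀ ((2 * Real.pi)⁻¹ • ℓ)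
  have e : VectorFourier.fourierIntegral Real.fourierChar μ L.toLinearMap₁₂ G
      ((2 * Real.pi)⁻¹ • ℓ) = ∫ v, Complex.exp (-(Complex.I * ℓ v)) * G v ∂μ := by
    rw [VectorFourier.fourierIntegral]
    refine integral_congr_ae (.of_forall fun v => ?_)
    simp only [Circle.smul_def, Real.fourierChar_apply, smul_eq_mul]
    congr 2
    have : L.toLinearMap₁₂ v ((2 * Real.pi)⁻¹ • ℓ) = (2 * Real.pi)⁻¹ * ℓ v := by simp [L]
    rw [this]
    push_cast
    field_simp
  rw [norm_iteratedFDeriv_zero, e] at h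
  have e2 : |L v₀ ((2 * Real.pi)⁻¹ • ℓ)| = (2 * Real.pi)⁻¹ * |ℓ v₀| := by
    have : L v₀ ((2 * Real.pi)⁻¹ • ℓ) = (2 * Real.pi)⁻¹ * ℓ v₀ := by simp [L]
    rw [this, abs_mul, abs_of_pos (by positivity)]
  rw [e2] at h
  have e3 : ∑ p ∈ Finset.range (0 + 1) ×ˢ Finset.range (n + 1),
      ∫ v, ‖v‖ ^ p.1 * ‖iteratedFDeriv ℝ p.2 G v‖ ∂μ
      = ∑ k ∈ Finset.range (n + 1), ∫ v, ‖iteratedFDeriv ℝ k G v‖ ∂μ := by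
    rw [Finset.sum_product]
    simp
  rw [e3] at h
  have hS : 0 ≤ ∑ k ∈ Finset.range (n + 1), ∫ v, ‖iteratedFDeriv ℝ k G v‖ ∂μ := by positivity
  set I := ‖∫ v, Complex.exp (-(Complex.I * ℓ v)) * G v ∂μ‖
  calc |ℓ v₀| ^ n * I = (2 * Real.pi) ^ n * (((2 * Real.pi)⁻¹ * |ℓ v₀|) ^ n * I) := by
        rw [← mul_assoc, ← mul_pow, mul_inv_cancel_left₀ (by positivity)]
    _ ≤ (2 * Real.pi) ^ n * (1 ^ n * 2 ^ n *
          ∑ k ∈ Finset.range (n + 1), ∫ v, ‖iteratedFDeriv ℝ k G v‖ ∂μ) := by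
        refine mul_le_mul_of_nonneg_left (h.trans ?_) (by positivity)
        simp only [pow_zero, mul_one, Nat.cast_zero, mul_zero, zero_add]
        gcongr
    _ = _ := by
        rw [one_pow, one_mul, ← mul_assoc, ← mul_pow]; ring_nf

/-- Nonstationary phase: Fourier integrals decay like the frequency to the power `-n` if `n`
derivatives of the amplitude are integrable. -/
lemma fourier_decay (n : ℕ) : ∃ C₀ : ℝ, 0 ≤ C₀ ∧ ∀ {G : V → ℂ} (_ : ContDiff ℝ ∞ G) {w : V → ℝ}
    (_ : Integrable w μ) {C : ℝ} (_ : ∀ k ≤ n, ∀ v, ‖iteratedFDeriv ℝ k G v‖ ≤ C * w v)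
    (ℓ : V →L[ℝ] ℝ),
      (1 + ‖ℓ‖) ^ n * ‖∫ v, Complex.exp (-(Complex.I * ℓ v)) * G v ∂μ‖
        ≤ C₀ * (C * ∫ v, w v ∂μ) := by
  have hπ := Real.pi_pos
  refine ⟨2 ^ n * (1 + 2 ^ n * ((4 * Real.pi) ^ n * (n + 1))), by positivity,
    fun {G} hG {w} hw {C} hC ℓ => ?_⟩
  have hk : ∀ k ≤ n, Integrable (fun v => ‖iteratedFDeriv ℝ k G v‖) μ := by
    intro k hkn
    refine (hw.const_mul C).mono'
      (hG.continuous_iteratedFDeriv (mod_cast le_top)).norm.aestronglyMeasurable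
      (.of_forall fun v => ?_)
    rw [norm_norm]
    exact hC k hkn v
  set J := C * ∫ v, w v ∂μ
  set I := ∫ v, Complex.exp (-(Complex.I * ℓ v)) * G v ∂μ
  have hb : ∀ k ≤ n, ∫ v, ‖iteratedFDeriv ℝ k G v‖ ∂μ ≤ J := by
    intro k hk'
    simp only [J, ← integral_const_mul]
    exact integral_mono (hk k hk') (hw.const_mul C) fun v => hC k hk' v
  have h0 : ‖I‖ ≤ J := by
    refine (norm_integral_le_integral_norm _).trans ((le_of_eq ?_).trans (hb 0 (Nat.zero_le _)))
    refine integral_congr_ae (.of_forall fun v => ?_)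
    simp [Complex.norm_exp]
  have h1 : ‖ℓ‖ ^ n * ‖I‖ ≤ 2 ^ n * ((4 * Real.pi) ^ n * ((n + 1) * J)) := by
    -- A vector of the unit ball on which `ℓ` attains at least half of its norm.
    have hex : ∃ v₀ : V, ‖v₀‖ ≤ 1 ∧ ‖ℓ‖ ≤ 2 * |ℓ v₀| := by
      rcases eq_or_ne ℓ 0 with rfl | h
      · exact ⟨0, by simp⟩
      · obtain ⟨x, hx, hx'⟩ := ℓ.exists_lt_apply_of_lt_opNorm
          (show ‖ℓ‖ / 2 < ‖ℓ‖ by linarith [norm_pos_iff.2 h])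
        exact ⟨x, hx.le, by rw [Real.norm_eq_abs] at hx'; linarith⟩
    obtain ⟨v₀, hv₀, hv⟩ := hex
    calc ‖ℓ‖ ^ n * ‖I‖ ≤ (2 * |ℓ v₀|) ^ n * ‖I‖ := by gcongr
      _ = 2 ^ n * (|ℓ v₀| ^ n * ‖I‖) := by rw [mul_pow, mul_assoc]
      _ ≤ 2 ^ n * ((4 * Real.pi) ^ n * ∑ k ∈ Finset.range (n + 1), J) := by
          refine mul_le_mul_of_nonneg_left ((fourier_pow_bound hG n hk ℓ
            hv₀).trans (mul_le_mul_of_nonneg_left (Finset.sum_le_sum fun k hk' => ?_)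
            (by positivity))) (by positivity)
          exact hb k (Finset.mem_range_succ_iff.1 hk')
      _ = _ := by simp
  calc (1 + ‖ℓ‖) ^ n * ‖I‖ ≤ 2 ^ n * (1 + ‖ℓ‖ ^ n) * ‖I‖ := by
        gcongr
        have : (1 + ‖ℓ‖) ^ n ≤ 2 ^ (n - 1) * (1 ^ n + ‖ℓ‖ ^ n) :=
          add_pow_le zero_le_one (norm_nonneg _) n
        refine this.trans ?_
        rw [one_pow]
        gcongr
        · norm_num
        · omega
    _ = 2 ^ n * (‖I‖ + ‖ℓ‖ ^ n * ‖I‖) := by ring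
    _ ≤ 2 ^ n * (J + 2 ^ n * ((4 * Real.pi) ^ n * ((n + 1) * J))) := by gcongr
    _ = _ := by ring

/-- The estimate is uniform in the index because the nonstationary phase constant is chosen before
the amplitude. -/
lemma Tame.fourier_decay {ρ κ : ι → V → ℝ} {G : ι → V → ℂ} (hG : Tame ρ κ G)
    (hρ : ∀ i v, 1 ≤ ρ i v) (hκ : ∀ i v, 0 ≤ κ i v)
    (hint : ∀ m i, Integrable (fun v => ρ i v ^ m * κ i v) μ) (n : ℕ) :
    ∃ (m : ℕ) (C : ℝ), 0 ≤ C ∧ ∀ i (ℓ : V →L[ℝ] ℝ),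
      (1 + ‖ℓ‖) ^ n * ‖∫ v, Complex.exp (-(Complex.I * ℓ v)) * G i v ∂μ‖
        ≤ C * ∫ v, ρ i v ^ m * κ i v ∂μ := by
  obtain ⟨m, C, hC0, hC⟩ := hG.uniform hρ hκ n
  obtain ⟨C₀, h₀, h⟩ := SemiclassicalFIO.fourier_decay (μ := μ) n
  refine ⟨m, C₀ * C, by positivity, fun i ℓ => ?_⟩
  rw [mul_assoc]
  exact h (hG.1 i) (hint m i) (fun k hk v => by rw [← mul_assoc]; exact hC k hk i v) ℓ

end FourierDecay

/-! ### Fourier integrals against Schwartz functions -/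

section SchwartzDecay

variable {ι : Type*} {d : ℕ}

lemma schwartz_decay (ψ : 𝓢(Conf d, ℂ)) (n N : ℕ) : ∃ C : ℝ, 0 ≤ C ∧ ∀ k ≤ n, ∀ x,
    ‖iteratedFDeriv ℝ k ψ x‖ ≤ C * ((1 + ‖x‖) ^ N)⁻¹ := by
  refine ⟨2 ^ N * ((Finset.Iic (N, n)).sup fun m => SchwartzMap.seminorm ℝ m.1 m.2) ψ,
    by positivity, fun k hk x => ?_⟩
  have := SchwartzMap.one_add_le_sup_seminorm_apply (𝕜 := ℝ) (m := (N, n)) (k := N) (n := k)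
    le_rfl hk ψ x
  rw [← div_eq_mul_inv, le_div_iff₀ (by positivity), mul_comm]
  exact this

/-- The power `m` of the weight is fixed before the decay rate `N`, which can afterwards be taken
large enough to beat the growth of that power. -/
lemma Tame.mul_schwartz_bound {ρ κ : ι → Conf d → ℝ} {F : ι → Conf d → ℂ} (hF : Tame ρ κ F)
    (hρ : ∀ i v, 1 ≤ ρ i v) (hκ : ∀ i v, 0 ≤ κ i v) (ψ : 𝓢(Conf d, ℂ)) (n : ℕ) :
    ∃ m : ℕ, ∀ N : ℕ, ∃ C : ℝ, 0 ≤ C ∧ ∀ k ≤ n, ∀ i y,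
      ‖iteratedFDeriv ℝ k (fun y => F i y * ψ y) y‖
        ≤ C * (ρ i y ^ m * κ i y * ((1 + ‖y‖) ^ N)⁻¹) := by
  obtain ⟨m, C, hC0, hC⟩ := hF.uniform hρ hκ n
  refine ⟨m, fun N => ?_⟩
  obtain ⟨D, hD0, hD⟩ := schwartz_decay ψ n N
  refine ⟨∑ k ∈ Finset.range (n + 1), ∑ j ∈ Finset.range (k + 1), (k.choose j : ℝ) * C * D,
    by positivity, fun k hk i y => ?_⟩
  have h1 := hρ i y
  have h2 := hκ i y
  refine (norm_iteratedFDeriv_mul_le (hF.1 i) (ψ.smooth ⊤) y (mod_cast le_top)).trans ?_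
  calc _ ≤ ∑ j ∈ Finset.range (k + 1), (k.choose j : ℝ) * (C * ρ i y ^ m * κ i y) *
        (D * ((1 + ‖y‖) ^ N)⁻¹) := by
        gcongr with j hj
        · exact hC j ((Finset.mem_range_succ_iff.1 hj).trans hk) i y
        · exact hD (k - j) (by omega) y
    _ = (∑ j ∈ Finset.range (k + 1), (k.choose j : ℝ) * C * D) *
          (ρ i y ^ m * κ i y * ((1 + ‖y‖) ^ N)⁻¹) := by
        simp only [Finset.sum_mul]
        exact Finset.sum_congr rfl fun j _ => by ring
    _ ≤ _ := by
        gcongr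
        exact Finset.single_le_sum
          (f := fun k => ∑ j ∈ Finset.range (k + 1), (k.choose j : ℝ) * C * D)
          (fun _ _ => by positivity) (Finset.mem_range_succ_iff.2 hk)

lemma integrable_one_add_norm_inv (E : Type*) [NormedAddCommGroup E] [NormedSpace ℝ E]
    [FiniteDimensional ℝ E] [MeasureSpace E] [BorelSpace E]
    [(volume : Measure E).IsAddHaarMeasure] {n : ℕ} (hn : Module.finrank ℝ E < n) :
    Integrable (fun x : E => ((1 + ‖x‖) ^ n)⁻¹) := by
  refine (integrable_one_add_norm (E := E) (r := n) (by exact_mod_cast hn)).congr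
    (.of_forall fun x => ?_)
  simp only [Real.rpow_neg (show 0 ≤ 1 + ‖x‖ by positivity), Real.rpow_natCast]

/-- Fourier integrals with a Schwartz function in the amplitude. -/
lemma Tame.fourier_decay_schwartz {ρ κ : ι → Conf d → ℝ} {F : ι → Conf d → ℂ} (hF : Tame ρ κ F)
    (hρ : ∀ i v, 1 ≤ ρ i v) (hκ : ∀ i v, 0 ≤ κ i v) {B : ι → ℝ}
    (hB : ∀ m : ℕ, ∃ (C : ℝ) (N : ℕ), ∀ i y, ρ i y ^ m * κ i y ≤ C * B i * (1 + ‖y‖) ^ N)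
    (ψ : 𝓢(Conf d, ℂ)) (n : ℕ) : ∃ C : ℝ, ∀ i (ℓ : Conf d →L[ℝ] ℝ),
      (1 + ‖ℓ‖) ^ n * ‖∫ y, Complex.exp (-(Complex.I * ℓ y)) * (F i y * ψ y)‖ ≤ C * B i := by
  obtain ⟨m, hm⟩ := hF.mul_schwartz_bound hρ hκ ψ n
  obtain ⟨C₁, N, hN⟩ := hB m
  -- Of the decay of `ψ`, the power `N` compensates the growth of the weight and `d + 1` makes the
  -- rest integrable.
  obtain ⟨C₂, hC₂, h2⟩ := hm (N + (d + 1))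
  obtain ⟨C₀, h₀, h⟩ := SemiclassicalFIO.fourier_decay (V := Conf d) (μ := volume) n
  have hI := integrable_one_add_norm_inv (Conf d) (n := d + 1) (by simp)
  refine ⟨C₀ * (C₂ * C₁ * ∫ y : Conf d, ((1 + ‖y‖) ^ (d + 1))⁻¹), fun i ℓ => ?_⟩
  refine (h ((hF.1 i).mul (ψ.smooth ⊤)) hI (C := C₂ * (C₁ * B i)) (fun k hk y => ?_) ℓ).trans
    (le_of_eq (by ring))
  refine (h2 k hk i y).trans ?_
  rw [mul_assoc C₂ (C₁ * B i)]
  refine mul_le_mul_of_nonneg_left ?_ hC₂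
  calc _ ≤ C₁ * B i * (1 + ‖y‖) ^ N * ((1 + ‖y‖) ^ (N + (d + 1)))⁻¹ := by
        exact mul_le_mul_of_nonneg_right (hN i y) (by positivity)
    _ = C₁ * B i * ((1 + ‖y‖) ^ (d + 1))⁻¹ := by
        rw [pow_add]; field_simp

end SchwartzDecay

/-! ### Gaussian weights -/

lemma exp_decay_nonneg (k : ℕ) {c : ℝ} (hc : 0 < c) :
    ∃ C : ℝ, 0 ≤ C ∧ ∀ t : ℝ, 0 ≤ t → (1 + t) ^ k * Real.exp (-(c * t ^ 2)) ≤ C := by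
  obtain ⟨C, hC⟩ := exp_decay k hc 0
  refine ⟨max C 0, le_max_right _ _, fun t ht => le_max_of_le_left ?_⟩
  simpa [sub_eq_add_neg] using hC t ht

/-- Polynomials are absorbed by Gaussians. -/
lemma gaussian_absorb (m : ℕ) {c : ℝ} (hc : 0 < c) :
    ∃ C : ℝ, 0 ≤ C ∧ ∀ r s t : ℝ, 0 ≤ r → 0 ≤ s → 0 ≤ t →
      (1 + r + s + t) ^ m * Real.exp (-(r ^ 2 / 2) - s ^ 2 / 2 - c / 2 * t ^ 2)
        ≤ C * (Real.exp (-(1 / 4 * r ^ 2)) * Real.exp (-(1 / 4 * s ^ 2))) := by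
  obtain ⟨C₁, h₁, hC₁⟩ := exp_decay_nonneg m (c := 1 / 4) (by norm_num)
  obtain ⟨C₂, h₂, hC₂⟩ := exp_decay_nonneg m (c := c / 2) (by positivity)
  refine ⟨C₁ * C₁ * C₂, by positivity, fun r s t hr hs ht => ?_⟩
  have h3 : 1 + r + s + t ≤ (1 + r) * (1 + s) * (1 + t) := by
    nlinarith [mul_nonneg hr hs, mul_nonneg hr ht, mul_nonneg hs ht,
      mul_nonneg (mul_nonneg hr hs) ht]
  calc _ ≤ ((1 + r) * (1 + s) * (1 + t)) ^ m
          * Real.exp (-(r ^ 2 / 2) - s ^ 2 / 2 - c / 2 * t ^ 2) := by gcongr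
    -- Half of the Gaussians in `r` and `s` and the whole of that in `t` absorb the polynomial; the
    -- other halves remain.
    _ = ((1 + r) ^ m * Real.exp (-(1 / 4 * r ^ 2))) * ((1 + s) ^ m * Real.exp (-(1 / 4 * s ^ 2)))
        * ((1 + t) ^ m * Real.exp (-(c / 2 * t ^ 2)))
        * (Real.exp (-(1 / 4 * r ^ 2)) * Real.exp (-(1 / 4 * s ^ 2))) := by
        have : Real.exp (-(r ^ 2 / 2) - s ^ 2 / 2 - c / 2 * t ^ 2)
            = Real.exp (-(1 / 4 * r ^ 2)) * Real.exp (-(1 / 4 * s ^ 2))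
              * Real.exp (-(c / 2 * t ^ 2))
              * (Real.exp (-(1 / 4 * r ^ 2)) * Real.exp (-(1 / 4 * s ^ 2))) := by
          simp only [← Real.exp_add]; ring_nf
        rw [this, mul_pow, mul_pow]; ring
    _ ≤ _ := by
        gcongr
        exacts [hC₁ r hr, hC₁ s hs, hC₂ t ht]

lemma integrable_gaussian {d : ℕ} {b : ℝ} (hb : 0 < b) (q : Conf d) :
    Integrable (fun x : Conf d => Real.exp (-(b * ‖x - q‖ ^ 2))) := by
  have h := (GaussianFourier.integrable_cexp_neg_mul_sq_norm_add (V := Conf d) (b := (b : ℂ))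
    (by simpa using hb) 0 0).norm
  have h' : Integrable (fun x : Conf d => Real.exp (-(b * ‖x‖ ^ 2))) := by
    refine h.congr (.of_forall fun x => ?_)
    simp only [Complex.norm_exp]
    congr 1
    simp [← Complex.ofReal_pow]
  exact h'.comp_sub_right q

/-! ### Complex phases with `d` frequency variables, at a frozen frequency -/

section Coordinates

variable {d : ℕ}

/-- A coordinate as a complex-valued linear map. -/
def coordCLM (j : Fin d) : Conf d →L[ℝ] ℂ :=
  Complex.ofRealCLM.comp (EuclideanSpace.proj j : Conf d →L[ℝ] ℝ)

lemma tame_quadForm {ι V : Type*} [NormedAddCommGroup V] [NormedSpace ℝ V] {ρ : ι → V → ℝ}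
    (hρ : ∀ i v, 1 ≤ ρ i v) {Θ : ι → V → Matrix (Fin d) (Fin d) ℂ}
    (hΘ : ∀ k l, Tame ρ (fun _ _ => 1) (fun i v => Θ i v k l)) {f : ι → V → Conf d}
    (hf : Tame ρ (fun _ _ => 1) f) :
    Tame ρ (fun _ _ => 1) (fun i v => quadForm (Θ i v) (f i v)) := by
  have h0 : ∀ i v, 0 ≤ ρ i v := fun i v => zero_le_one.trans (hρ i v)
  refine Tame.sum hρ (by simp) fun k _ => Tame.sum hρ (by simp) fun l _ => ?_
  exact ((hΘ k l).mul_one (hf.clm (coordCLM l) h0 (by simp)) hρ).mul_one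
    (hf.clm (coordCLM k) h0 (by simp)) hρ

lemma tame_inner {ι V : Type*} [NormedAddCommGroup V] [NormedSpace ℝ V] {ρ : ι → V → ℝ}
    (hρ : ∀ i v, 1 ≤ ρ i v) {f g : ι → V → Conf d}
    (hf : Tame ρ (fun _ _ => 1) f) (hg : Tame ρ (fun _ _ => 1) g) :
    Tame ρ (fun _ _ => 1) (fun i v => (inner ℝ (f i v) (g i v) : ℝ)) :=
  hf.bilin_one (innerSL ℝ) hg hρ

end Coordinates

section FrozenPhase

variable {ι : Type*} {d : ℕ}

/-- Families of phases `S(y) + P(y) · (x - Q(y)) + Θ(y)(x - Q(y)) · (x - Q(y)) / 2` with uniform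
symbol bounds, where `dS = P · dQ - p · dy`. -/
structure IsPhaseFamily (S : ι → Conf d → ℝ) (Q P : ι → Conf d → Conf d) (p : ι → Conf d)
    (Θ : ι → Conf d → Matrix (Fin d) (Fin d) ℂ) (c : ℝ) : Prop where
  symbol_Q : UniformSymbol 1 Q
  symbol_P : UniformSymbol 1 P
  symbol_Θ : ∀ k l, UniformSymbol 0 (fun i y => Θ i y k l)
  pos : 0 < c
  lower : ∀ i y v, c * ‖v‖ ^ 2 ≤ (quadForm (Θ i y) v).im
  differentiable : ∀ i, Differentiable ℝ (S i)
  fderiv_S : ∀ i y v, fderiv ℝ (S i) y v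
    = inner ℝ (P i y) (fderiv ℝ (Q i) y v) - inner ℝ (p i) v

/-- The value of the phase. -/
def frozenPhase (S : Conf d → ℝ) (Q P : Conf d → Conf d)
    (Θ : Conf d → Matrix (Fin d) (Fin d) ℂ) (y x : Conf d) : ℂ :=
  ((S y + inner ℝ (P y) (x - Q y) : ℝ) : ℂ) + (1 / 2) * quadForm (Θ y) (x - Q y)

variable {S : ι → Conf d → ℝ} {Q P : ι → Conf d → Conf d} {p : ι → Conf d}
  {Θ : ι → Conf d → Matrix (Fin d) (Fin d) ℂ} {c : ℝ}

lemma IsPhaseFamily.reindex (h : IsPhaseFamily S Q P p Θ c) {κ : Type*} (r : κ → ι) :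
    IsPhaseFamily (fun j => S (r j)) (fun j => Q (r j)) (fun j => P (r j)) (fun j => p (r j))
      (fun j => Θ (r j)) c where
  symbol_Q := h.symbol_Q.reindex r
  symbol_P := h.symbol_P.reindex r
  symbol_Θ k l := (h.symbol_Θ k l).reindex r
  pos := h.pos
  lower _ := h.lower _
  differentiable _ := h.differentiable _
  fderiv_S _ := h.fderiv_S _

lemma IsPhaseFamily.re_phase (h : IsPhaseFamily S Q P p Θ c) (i : ι) (y x : Conf d) :
    (Complex.I * frozenPhase (S i) (Q i) (P i) (Θ i) y x).re ≤ -(c / 2 * ‖x - Q i y‖ ^ 2) := by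
  have h1 := h.lower i y (x - Q i y)
  have : (Complex.I * frozenPhase (S i) (Q i) (P i) (Θ i) y x).re
      = -(1 / 2 * (quadForm (Θ i y) (x - Q i y)).im) := by
    simp only [frozenPhase, Complex.mul_re, Complex.I_re, zero_mul, Complex.I_im, one_mul,
      Complex.add_im, Complex.ofReal_im, Complex.mul_im]
    norm_num
  rw [this]
  linarith

/-- The phase, recentred at the frequencies `p` and `P(q)`. -/
def centredPhase (S : Conf d → ℝ) (Q P : Conf d → Conf d)
    (Θ : Conf d → Matrix (Fin d) (Fin d) ℂ) (p q : Conf d) (v : Conf d × Conf d) : ℂ :=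
  Complex.I * ((frozenPhase S Q P Θ v.1 v.2)
    + ((inner ℝ p v.1 - inner ℝ (P q) v.2 : ℝ) : ℂ))

/-- The recentring terms inside the phase are real and do not change the modulus of the exponential.
-/
lemma IsPhaseFamily.re_centredPhase (h : IsPhaseFamily S Q P p Θ c) (i : ι) (q : Conf d)
    (v : Conf d × Conf d) : (centredPhase (S i) (Q i) (P i) (Θ i) (p i) q v).re
      ≤ -(c / 2 * ‖v.2 - Q i v.1‖ ^ 2) := by
  refine (le_of_eq ?_).trans (h.re_phase i v.1 v.2)
  rw [centredPhase, mul_add, Complex.add_re, add_eq_left, Complex.re_mul_ofReal]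
  simp

/-- The weight measuring the distance to the critical set of the phase. -/
def phaseWeight (Q : Conf d → Conf d) (q : Conf d) (v : Conf d × Conf d) : ℝ :=
  1 + ‖v.1 - q‖ + ‖v.2 - Q v.1‖

lemma one_le_phaseWeight (Q : Conf d → Conf d) (q : Conf d) (v : Conf d × Conf d) :
    1 ≤ phaseWeight Q q v := by
  unfold phaseWeight
  linarith [norm_nonneg (v.1 - q), norm_nonneg (v.2 - Q v.1)]

lemma uniformSymbol_fst_sub (q : ι → Conf d) :
    UniformSymbol 1 (fun i (v : Conf d × Conf d) => v.1 - q i) := by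
  simpa [sub_eq_add_neg] using
    uniformSymbol_affine (ContinuousLinearMap.fst ℝ (Conf d) (Conf d)) (fun i => -q i)

lemma uniformSymbol_snd_sub (q : ι → Conf d) :
    UniformSymbol 1 (fun i (v : Conf d × Conf d) => v.2 - q i) := by
  simpa [sub_eq_add_neg] using
    uniformSymbol_affine (ContinuousLinearMap.snd ℝ (Conf d) (Conf d)) (fun i => -q i)

lemma uniformSymbol_fst :
    UniformSymbol 1 (fun (_ : ι) (v : Conf d × Conf d) => v.1) := by
  simpa using uniformSymbol_fst_sub (ι := ι) (d := d) 0

lemma uniformSymbol_snd_sub_comp {Q : ι → Conf d → Conf d} (hQ : UniformSymbol 1 Q) :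
    UniformSymbol 1 (fun i (v : Conf d × Conf d) => v.2 - Q i v.1) := by
  have h := ((hQ.comp_one uniformSymbol_fst).clm (-ContinuousLinearMap.id ℝ (Conf d))).add
    (uniformSymbol_snd_sub 0)
  simpa [add_comm, sub_eq_add_neg] using h

lemma IsPhaseFamily.tame_sub (h : IsPhaseFamily S Q P p Θ c) (q : ι → Conf d) :
    Tame (fun i => phaseWeight (Q i) (q i)) (fun _ _ => 1)
      (fun i (v : Conf d × Conf d) => v.2 - Q i v.1) := by
  refine Tame.of_uniformSymbol (C := 1) (uniformSymbol_snd_sub_comp h.symbol_Q) fun i v => ?_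
  simp only [phaseWeight]
  linarith [norm_nonneg (v.1 - q i)]

/-- `P` itself is unbounded, but its increment from `q` is controlled by `|y - q|`, a part of the
weight. This is why the phase is recentred at `P(q)`. -/
lemma IsPhaseFamily.tame_P_sub (h : IsPhaseFamily S Q P p Θ c) (q : ι → Conf d) :
    Tame (fun i => phaseWeight (Q i) (q i)) (fun _ _ => 1)
      (fun i (v : Conf d × Conf d) => P i v.1 - P i (q i)) := by
  obtain ⟨K, hK, hL⟩ := h.symbol_P.lipschitz
  have hs : UniformSymbol 1 (fun i (v : Conf d × Conf d) => P i v.1 - P i (q i)) := by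
    have := (h.symbol_P.comp_one uniformSymbol_fst).add
      (uniformSymbol_affine (0 : Conf d × Conf d →L[ℝ] Conf d) (fun i => -P i (q i)))
    simpa [sub_eq_add_neg] using this
  refine Tame.of_uniformSymbol (C := K) hs fun i v => (hL i _ _).trans ?_
  gcongr
  simp only [phaseWeight]
  linarith [norm_nonneg (v.2 - Q i v.1)]

/-- The part of the recentred phase that is linear in `x - Q(y)`. -/
def centredLinear (S : Conf d → ℝ) (Q P : Conf d → Conf d) (p q : Conf d)
    (v : Conf d × Conf d) : ℝ :=
  S v.1 + inner ℝ (P v.1) (v.2 - Q v.1) + (inner ℝ p v.1 - inner ℝ (P q) v.2)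

/-- The derivative of `centredLinear` in terms of `x - Q(y)`, `DP(y)` and `P(y) - P(q)`. -/
def centredLinearDeriv (w : Conf d) (A : Conf d →L[ℝ] Conf d) (r : Conf d) :
    Conf d × Conf d →L[ℝ] ℝ :=
  (((ContinuousLinearMap.compL ℝ (Conf d × Conf d) (Conf d) ℝ).flip
      (ContinuousLinearMap.fst ℝ (Conf d) (Conf d)))
    (ContinuousLinearMap.compL ℝ (Conf d) (Conf d) ℝ (innerSL ℝ w) A))
  + ((ContinuousLinearMap.compL ℝ (Conf d × Conf d) (Conf d) ℝ).flip
      (ContinuousLinearMap.snd ℝ (Conf d) (Conf d))) (innerSL ℝ r)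

/-- The action identity enters here. The term `P · dQ` of `dS` cancels against the derivative of `-P
· Q` at fixed `P`, and `-p · dy` against the recentring. There remain `dP · (x - Q)` and `(P(y) -
P(q)) · dx`, both small near the critical set, uniformly in `p` and `q`. -/
lemma IsPhaseFamily.hasFDerivAt_centredLinear (h : IsPhaseFamily S Q P p Θ c) (q : ι → Conf d)
    (i : ι) (v : Conf d × Conf d) :
    HasFDerivAt (centredLinear (S i) (Q i) (P i) (p i) (q i))
      (centredLinearDeriv (v.2 - Q i v.1) (fderiv ℝ (P i) v.1) (P i v.1 - P i (q i))) v := by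
  have hQd : Differentiable ℝ (Q i) := (h.symbol_Q.1 i).differentiable (by simp)
  have hPd : Differentiable ℝ (P i) := (h.symbol_P.1 i).differentiable (by simp)
  have h1 : HasFDerivAt (fun v : Conf d × Conf d => v.1)
    (ContinuousLinearMap.fst ℝ (Conf d) (Conf d)) v := hasFDerivAt_fst
  have h2 : HasFDerivAt (fun v : Conf d × Conf d => v.2)
    (ContinuousLinearMap.snd ℝ (Conf d) (Conf d)) v := hasFDerivAt_snd
  have hS' := ((h.differentiable i) v.1).hasFDerivAt.comp v h1
  have hP' := (hPd v.1).hasFDerivAt.comp v h1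
  have hQ' := h2.sub ((hQd v.1).hasFDerivAt.comp v h1)
  have hp' := (innerSL ℝ (p i)).hasFDerivAt.comp v h1
  have hPq' := (innerSL ℝ (P i (q i))).hasFDerivAt.comp v h2
  refine ((hS'.add (hP'.inner ℝ hQ')).add (hp'.sub hPq')).congr_fderiv ?_
  ext w
  all_goals
    simp [centredLinearDeriv, h.fderiv_S, inner_sub_right, real_inner_comm]
    try ring

lemma tame_centredLinearDeriv {V : Type*} [NormedAddCommGroup V] [NormedSpace ℝ V]
    {ρ : ι → V → ℝ} (hρ : ∀ i v, 1 ≤ ρ i v)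
    {w r : ι → V → Conf d} {A : ι → V → Conf d →L[ℝ] Conf d} (hw : Tame ρ (fun _ _ => 1) w)
    (hA : Tame ρ (fun _ _ => 1) A) (hr : Tame ρ (fun _ _ => 1) r) :
    Tame ρ (fun _ _ => 1) (fun i v => centredLinearDeriv (w i v) (A i v) (r i v)) := by
  have hρ0 : ∀ i v, 0 ≤ ρ i v := fun i v => zero_le_one.trans (hρ i v)
  refine Tame.add ?_ ?_ hρ (by simp)
  · exact ((hw.clm (innerSL ℝ) hρ0 (by simp)).bilin_one
      (ContinuousLinearMap.compL ℝ (Conf d) (Conf d) ℝ) hA hρ).clm _ hρ0 (by simp)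
  · exact (hr.clm (innerSL ℝ) hρ0 (by simp)).clm _ hρ0 (by simp)

lemma centredPhase_eq (S : Conf d → ℝ) (Q P : Conf d → Conf d)
    (Θ : Conf d → Matrix (Fin d) (Fin d) ℂ) (p q : Conf d) :
    centredPhase S Q P Θ p q = fun v =>
      ContinuousLinearMap.mul ℝ ℂ Complex.I (Complex.ofRealCLM (centredLinear S Q P p q v))
      + ContinuousLinearMap.mul ℝ ℂ (Complex.I / 2) (quadForm (Θ v.1) (v.2 - Q v.1)) := by
  ext v
  simp only [centredPhase, frozenPhase, centredLinear,
    ContinuousLinearMap.mul_apply', Complex.ofRealCLM_apply]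
  push_cast
  ring

/-- The derivative is tame even though `S`, `Q` and `P` are unbounded, and the bounds do not depend
on the frequencies. The quadratic term is differentiated in full, which uses the bounds on `Θ`
itself. -/
theorem IsPhaseFamily.tame_centredPhase (h : IsPhaseFamily S Q P p Θ c) (q : ι → Conf d) :
    (∀ i, ContDiff ℝ ∞ (centredPhase (S i) (Q i) (P i) (Θ i) (p i) (q i))) ∧
    Tame (fun i => phaseWeight (Q i) (q i)) (fun _ _ => 1)
      (fun i => fderiv ℝ (centredPhase (S i) (Q i) (P i) (Θ i) (p i) (q i))) := by
  have hρ : ∀ i v, 1 ≤ phaseWeight (Q i) (q i) v := fun i v => one_le_phaseWeight _ _ _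
  have hρ0 : ∀ i v, 0 ≤ phaseWeight (Q i) (q i) v := fun i v => zero_le_one.trans (hρ i v)
  have hw := h.tame_sub q
  have he : Tame (fun i => phaseWeight (Q i) (q i)) (fun _ _ => 1)
      (fun i => fderiv ℝ (centredLinear (S i) (Q i) (P i) (p i) (q i))) :=
    (tame_centredLinearDeriv hρ hw
      (Tame.of_uniformSymbol_zero (h.symbol_P.fderiv.comp uniformSymbol_fst))
      (h.tame_P_sub q)).congr fun i v => (h.hasFDerivAt_centredLinear q i v).fderiv.symm
  -- Only differentiability of `S` is given; smoothness follows from that of the derivative computed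
  -- above.
  have hes : ∀ i, ContDiff ℝ ∞ (centredLinear (S i) (Q i) (P i) (p i) (q i)) := fun i =>
    contDiff_infty_iff_fderiv.2
      ⟨fun v => (h.hasFDerivAt_centredLinear q i v).differentiableAt, he.1 i⟩
  have hq := (tame_quadForm hρ (fun k l => Tame.of_uniformSymbol_zero
      ((h.symbol_Θ k l).comp uniformSymbol_fst)) hw).clm
      (ContinuousLinearMap.mul ℝ ℂ (Complex.I / 2)) hρ0 (by simp)
  set T : ℝ →L[ℝ] ℂ := (ContinuousLinearMap.mul ℝ ℂ Complex.I).comp Complex.ofRealCLM with hT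
  have hs1 : ∀ i, ContDiff ℝ ∞ (fun v => T (centredLinear (S i) (Q i) (P i) (p i) (q i) v)) :=
    fun i => T.contDiff.comp (hes i)
  simp only [centredPhase_eq]
  refine ⟨fun i => (hs1 i).add (hq.1 i), ?_⟩
  have h1 : Tame (fun i => phaseWeight (Q i) (q i)) (fun _ _ => 1) (fun i =>
      fderiv ℝ (fun v => T (centredLinear (S i) (Q i) (P i) (p i) (q i) v))) := by
    refine (he.clm ((ContinuousLinearMap.compL ℝ (Conf d × Conf d) ℝ ℂ) T) hρ0
      (by simp)).congr fun i v => ?_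
    exact ((T.hasFDerivAt).comp v ((hes i).differentiable (by simp) v).hasFDerivAt).fderiv.symm
  refine (h1.add hq.fderiv hρ (by simp)).congr fun i v => ?_
  exact (((hs1 i).differentiable (by simp) v).hasFDerivAt.add
    ((hq.1 i).differentiable (by simp) v).hasFDerivAt).fderiv.symm

end FrozenPhase

/-! ### Matrix elements between wave packets at a frozen frequency -/

section CoreEstimates

variable {ι : Type*} {d : ℕ}

instance : (volume : Measure (Conf d × Conf d)).IsAddHaarMeasure :=
  Measure.prod.instIsAddHaarMeasure volume volume

/-- A Gaussian wave packet centred at `(q, p)`, without normalisation. -/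
def gaussWave (q p x : Conf d) : ℂ :=
  Complex.exp (Complex.I * ((inner ℝ p x : ℝ) : ℂ) - ((‖x - q‖ ^ 2 / 2 : ℝ) : ℂ))

lemma norm_gaussWave (q p x : Conf d) : ‖gaussWave q p x‖ = Real.exp (-(1 / 2 * ‖x - q‖ ^ 2)) := by
  rw [gaussWave, Complex.norm_exp, Complex.sub_re, Complex.ofReal_re, Complex.re_mul_ofReal]
  simp
  ring

lemma norm_gaussWave_le_one (q p x : Conf d) : ‖gaussWave q p x‖ ≤ 1 := by
  rw [norm_gaussWave, Real.exp_le_one_iff]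
  have : 0 ≤ ‖x - q‖ ^ 2 := by positivity
  linarith

lemma integral_gaussian_translate {b : ℝ} (q : Conf d) :
    ∫ x : Conf d, Real.exp (-(b * ‖x - q‖ ^ 2)) = ∫ x : Conf d, Real.exp (-(b * ‖x‖ ^ 2)) :=
  integral_sub_right_eq_self (fun x : Conf d => Real.exp (-(b * ‖x‖ ^ 2))) q

variable {S : ι → Conf d → ℝ} {Q P : ι → Conf d → Conf d} {p : ι → Conf d}
  {Θ : ι → Conf d → Matrix (Fin d) (Fin d) ℂ} {c : ℝ}

/-- The exponent of the amplitude in the matrix elements between wave packets. -/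
def packetExponent (S : Conf d → ℝ) (Q P : Conf d → Conf d)
    (Θ : Conf d → Matrix (Fin d) (Fin d) ℂ) (p q₁ q₂ : Conf d) (v : Conf d × Conf d) : ℂ :=
  centredPhase S Q P Θ p q₁ v + Complex.ofRealCLM
    ((-1 / 2 : ℝ) • (inner ℝ (v.1 - q₁) (v.1 - q₁) + inner ℝ (v.2 - q₂) (v.2 - q₂) : ℝ))

lemma IsPhaseFamily.re_packetExponent (h : IsPhaseFamily S Q P p Θ c) (i : ι) (q₁ q₂ : Conf d)
    (v : Conf d × Conf d) :
    (packetExponent (S i) (Q i) (P i) (Θ i) (p i) q₁ q₂ v).re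
      ≤ -(‖v.1 - q₁‖ ^ 2 / 2) - ‖v.2 - q₂‖ ^ 2 / 2 - c / 2 * ‖v.2 - Q i v.1‖ ^ 2 := by
  have h1 := h.re_centredPhase i q₁ v
  rw [packetExponent, Complex.add_re, Complex.ofRealCLM_apply, Complex.ofReal_re,
    real_inner_self_eq_norm_sq, real_inner_self_eq_norm_sq, smul_eq_mul]
  linarith

/-- This is the amplitude left after all linear oscillations have been removed. The weight contains
three distances, and the modulus is Gaussian in each of them, so powers of the weight cost nothing.
-/
lemma IsPhaseFamily.tame_packetExponent (h : IsPhaseFamily S Q P p Θ c) (q₁ q₂ : ι → Conf d) :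
    Tame (fun i v => 1 + ‖v.1 - q₁ i‖ + ‖v.2 - q₂ i‖ + ‖v.2 - Q i v.1‖)
      (fun i v => Real.exp (-(‖v.1 - q₁ i‖ ^ 2 / 2) - ‖v.2 - q₂ i‖ ^ 2 / 2
        - c / 2 * ‖v.2 - Q i v.1‖ ^ 2))
      (fun i v => Complex.exp (packetExponent (S i) (Q i) (P i) (Θ i) (p i) (q₁ i) (q₂ i) v)) := by
  set ρ : ι → Conf d × Conf d → ℝ :=
    fun i v => 1 + ‖v.1 - q₁ i‖ + ‖v.2 - q₂ i‖ + ‖v.2 - Q i v.1‖ with hρdef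
  have hρ : ∀ i v, 1 ≤ ρ i v := fun i v => by
    simp only [hρdef]
    linarith [norm_nonneg (v.1 - q₁ i), norm_nonneg (v.2 - q₂ i), norm_nonneg (v.2 - Q i v.1)]
  have hρ0 : ∀ i v, 0 ≤ ρ i v := fun i v => zero_le_one.trans (hρ i v)
  obtain ⟨hs, ht⟩ := h.tame_centredPhase q₁
  have h1 : Tame ρ (fun _ _ => 1) (fun i (v : Conf d × Conf d) => v.1 - q₁ i) :=
    Tame.of_uniformSymbol (C := 1) (uniformSymbol_fst_sub q₁) fun i v => by
      simp only [hρdef]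
      linarith [norm_nonneg (v.2 - q₂ i), norm_nonneg (v.2 - Q i v.1)]
  have h2 : Tame ρ (fun _ _ => 1) (fun i (v : Conf d × Conf d) => v.2 - q₂ i) :=
    Tame.of_uniformSymbol (C := 1) (uniformSymbol_snd_sub q₂) fun i v => by
      simp only [hρdef]
      linarith [norm_nonneg (v.1 - q₁ i), norm_nonneg (v.2 - Q i v.1)]
  have hg := (((tame_inner hρ h1 h1).add (tame_inner hρ h2 h2) hρ (by simp)).clm
    ((-1 / 2 : ℝ) • ContinuousLinearMap.id ℝ ℝ) hρ0 (by simp)).clm Complex.ofRealCLM hρ0 (by simp)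
  have ht' : Tame ρ (fun _ _ => 1) (fun i =>
      fderiv ℝ (centredPhase (S i) (Q i) (P i) (Θ i) (p i) (q₁ i))) :=
    ht.mono (fun i v => zero_le_one.trans (one_le_phaseWeight _ _ _)) (fun i v => by
      simp only [hρdef, phaseWeight]
      linarith [norm_nonneg (v.2 - q₂ i)]) (by simp) (fun _ _ => le_rfl)
  have hexp := Tame.exp (h := fun i => packetExponent (S i) (Q i) (P i) (Θ i) (p i) (q₁ i) (q₂ i))
    (fun i => (hs i).add (hg.1 i)) ?_ hρ
  · exact hexp.mono hρ0 (fun _ _ => le_rfl) (fun _ _ => (Real.exp_pos _).le) fun i v =>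
      Real.exp_le_exp.2 (h.re_packetExponent i _ _ v)
  · refine (ht'.add hg.fderiv hρ (by simp)).congr fun i v => ?_
    exact (((hs i).differentiable (by simp) v).hasFDerivAt.add
      ((hg.1 i).differentiable (by simp) v).hasFDerivAt).fderiv.symm

/-- Matrix elements between wave packets decay with the distance of the frequencies from `p` and
`P(q₁)`, and with the distance of `q₂` from `Q(q₁)`. -/
theorem IsPhaseFamily.packet_decay (h : IsPhaseFamily S Q P p Θ c)
    {b : ι → Conf d × Conf d → ℂ} (hb : UniformSymbol 0 b) (q₁ p₁ q₂ p₂ : ι → Conf d) (N : ℕ) :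
    ∃ C : ℝ, 0 ≤ C ∧ ∀ i,
      (1 + ‖p i - p₁ i‖ + ‖P i (q₁ i) - p₂ i‖ + ‖Q i (q₁ i) - q₂ i‖) ^ N *
      ‖∫ v : Conf d × Conf d, Complex.exp (Complex.I * frozenPhase (S i) (Q i) (P i) (Θ i) v.1 v.2)
        * b i v * (gaussWave (q₁ i) (p₁ i) v.1 * gaussWave (q₂ i) (-p₂ i) v.2)‖ ≤ C := by
  set ρ : ι → Conf d × Conf d → ℝ :=
    fun i v => 1 + ‖v.1 - q₁ i‖ + ‖v.2 - q₂ i‖ + ‖v.2 - Q i v.1‖ with hρdef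
  set κ : ι → Conf d × Conf d → ℝ := fun i v => Real.exp (-(‖v.1 - q₁ i‖ ^ 2 / 2)
    - ‖v.2 - q₂ i‖ ^ 2 / 2 - c / 2 * ‖v.2 - Q i v.1‖ ^ 2) with hκdef
  have hρ : ∀ i v, 1 ≤ ρ i v := fun i v => by
    simp only [hρdef]
    linarith [norm_nonneg (v.1 - q₁ i), norm_nonneg (v.2 - q₂ i), norm_nonneg (v.2 - Q i v.1)]
  have hρ0 : ∀ i v, 0 ≤ ρ i v := fun i v => zero_le_one.trans (hρ i v)
  have hκ : ∀ i v, 0 ≤ κ i v := fun i v => (Real.exp_pos _).le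
  set E : ι → Conf d × Conf d → ℂ := fun i v =>
    Complex.exp (packetExponent (S i) (Q i) (P i) (Θ i) (p i) (q₁ i) (q₂ i) v)
  have hG : Tame ρ κ (fun i v => E i v * b i v) := by
    simpa using (h.tame_packetExponent q₁ q₂).mul (Tame.of_uniformSymbol_zero hb) hρ hκ
      (fun _ _ => zero_le_one)
  set g : Conf d → ℝ := fun y => Real.exp (-(1 / 4 * ‖y‖ ^ 2))
  have hgi : ∀ q : Conf d, Integrable (fun y => g (y - q)) :=
    fun q => integrable_gaussian (by norm_num) q
  have hgg : ∀ i, Integrable (fun v : Conf d × Conf d => g (v.1 - q₁ i) * g (v.2 - q₂ i)) :=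
    fun i => (hgi (q₁ i)).mul_prod (hgi (q₂ i))
  have hbound : ∀ m, ∃ C, 0 ≤ C ∧ ∀ i v, ρ i v ^ m * κ i v
      ≤ C * (g (v.1 - q₁ i) * g (v.2 - q₂ i)) := by
    intro m
    obtain ⟨C, hC0, hC⟩ := gaussian_absorb m h.pos
    exact ⟨C, hC0, fun i v => hC _ _ _ (norm_nonneg _) (norm_nonneg _) (norm_nonneg _)⟩
  have hQc : ∀ i, Continuous (Q i) := fun i => (h.symbol_Q.1 i).continuous
  have hint : ∀ m i, Integrable (fun v => ρ i v ^ m * κ i v) := by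
    intro m i
    obtain ⟨C, hC0, hC⟩ := hbound m
    have := hQc i
    refine ((hgg i).const_mul C).mono' (Continuous.aestronglyMeasurable ?_) (.of_forall fun v => ?_)
    · simp only [hρdef, hκdef]
      fun_prop
    · rw [Real.norm_of_nonneg (mul_nonneg (pow_nonneg (hρ0 i v) _) (hκ i v))]
      exact hC i v
  obtain ⟨m, C, hC0, hC⟩ := hG.fourier_decay (μ := volume) hρ hκ hint N
  -- The additional power `N` of the weight will pay for the distance of `q₂` from `Q(q₁)`.
  obtain ⟨D, hD0, hD⟩ := hbound (m + N)
  obtain ⟨K, hK1, hK⟩ := h.symbol_Q.lipschitz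
  set M : ℝ := ∫ y : Conf d, Real.exp (-(1 / 4 * ‖y‖ ^ 2))
  refine ⟨(2 + K) ^ N * (C * (D * (M * M))), by positivity, fun i => ?_⟩
  -- The frequency left between the recentring of the phase and the plane waves of the packets: `p -
  -- p₁` in `y` and, with the opposite sign, `P(q₁) - p₂` in `x`.
  let ℓ : Conf d × Conf d →L[ℝ] ℝ :=
    (innerSL ℝ (p i - p₁ i)).comp (ContinuousLinearMap.fst ℝ (Conf d) (Conf d))
      - (innerSL ℝ (P i (q₁ i) - p₂ i)).comp (ContinuousLinearMap.snd ℝ (Conf d) (Conf d))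
  have hI : ∫ v : Conf d × Conf d,
      Complex.exp (Complex.I * frozenPhase (S i) (Q i) (P i) (Θ i) v.1 v.2)
        * b i v * (gaussWave (q₁ i) (p₁ i) v.1 * gaussWave (q₂ i) (-p₂ i) v.2)
      = ∫ v : Conf d × Conf d, Complex.exp (-(Complex.I * ℓ v)) * (E i v * b i v) := by
    refine integral_congr_ae (.of_forall fun v => ?_)
    simp only [E, gaussWave, mul_assoc]
    rw [mul_comm (b i v), ← mul_assoc, ← mul_assoc, ← mul_assoc]
    simp only [← Complex.exp_add]
    congr 2
    simp only [packetExponent, centredPhase, ℓ, real_inner_self_eq_norm_sq]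
    simp only [sub_apply, ContinuousLinearMap.comp_apply, ContinuousLinearMap.coe_fst', ContinuousLinearMap.coe_snd',
      innerSL_apply_apply, inner_sub_left, inner_neg_left, Complex.ofRealCLM_apply,
      smul_eq_mul]
    push_cast
    ring
  rw [hI]
  set I := ∫ v : Conf d × Conf d, Complex.exp (-(Complex.I * ℓ v)) * (E i v * b i v)
  have hI0 : 0 ≤ ‖I‖ := norm_nonneg _
  have hℓ1 : ‖p i - p₁ i‖ ≤ ‖ℓ‖ := by
    have := ℓ.le_opNorm (p i - p₁ i, 0)
    simp only [ℓ, sub_apply, ContinuousLinearMap.comp_apply,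
      ContinuousLinearMap.coe_fst', ContinuousLinearMap.coe_snd', innerSL_apply_apply,
      inner_zero_right, sub_zero, real_inner_self_eq_norm_sq, Prod.norm_mk, norm_zero,
      Real.norm_eq_abs, abs_pow, abs_norm] at this
    rw [max_eq_left (norm_nonneg _), pow_two] at this
    rcases (norm_nonneg (p i - p₁ i)).eq_or_lt with h0 | h0
    · rw [← h0]; exact norm_nonneg _
    · exact le_of_mul_le_mul_right this h0
  have hℓ2 : ‖P i (q₁ i) - p₂ i‖ ≤ ‖ℓ‖ := by
    have := ℓ.le_opNorm (0, P i (q₁ i) - p₂ i)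
    simp only [ℓ, sub_apply, ContinuousLinearMap.comp_apply,
      ContinuousLinearMap.coe_fst', ContinuousLinearMap.coe_snd', innerSL_apply_apply,
      inner_zero_right, zero_sub, real_inner_self_eq_norm_sq, Prod.norm_mk, norm_zero, norm_neg,
      Real.norm_eq_abs, abs_pow, abs_norm] at this
    rw [max_eq_right (norm_nonneg _), pow_two] at this
    rcases (norm_nonneg (P i (q₁ i) - p₂ i)).eq_or_lt with h0 | h0
    · rw [← h0]; exact norm_nonneg _
    · exact le_of_mul_le_mul_right this h0
  set A := 1 + ‖p i - p₁ i‖ + ‖P i (q₁ i) - p₂ i‖ + ‖Q i (q₁ i) - q₂ i‖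
  have hA0 : 0 ≤ A := by positivity
  -- The distance from `Q(q₁)` to `q₂` is not a frequency. It is estimated at each point `v = (y,
  -- x)` along the path `Q(q₁)`, `Q(y)`, `x`, `q₂` by the weight, hence under the integral sign.
  have hA : ∀ v, A ≤ (2 + K) * (1 + ‖ℓ‖) * ρ i v := by
    intro v
    have h3 : ‖Q i (q₁ i) - q₂ i‖ ≤ K * ρ i v := by
      have e : Q i (q₁ i) - q₂ i = (Q i (q₁ i) - Q i v.1) + (-(v.2 - Q i v.1)) + (v.2 - q₂ i) := by
        abel
      rw [e]
      refine (norm_add₃_le).trans ?_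
      have := hK i (q₁ i) v.1
      rw [norm_neg]
      rw [norm_sub_rev (q₁ i)] at this
      simp only [hρdef]
      nlinarith [norm_nonneg (v.2 - q₂ i), norm_nonneg (v.2 - Q i v.1)]
    have h4 := hρ i v
    have h5 := norm_nonneg ℓ
    have h6 : A ≤ 1 + 2 * ‖ℓ‖ + K * ρ i v := by simp only [A]; linarith
    have h7 : ‖ℓ‖ ≤ ‖ℓ‖ * ρ i v := le_mul_of_one_le_right h5 h4
    have h8 : 0 ≤ K * ‖ℓ‖ * ρ i v := by positivity
    nlinarith
  have hℓp : 0 < (1 + ‖ℓ‖) ^ N := by positivity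
  calc A ^ N * ‖I‖ = (A / (1 + ‖ℓ‖)) ^ N * ((1 + ‖ℓ‖) ^ N * ‖I‖) := by
        rw [div_pow]; field_simp
    _ ≤ (A / (1 + ‖ℓ‖)) ^ N * (C * ∫ v, ρ i v ^ m * κ i v) := by
        exact mul_le_mul_of_nonneg_left (hC i ℓ) (by positivity)
    _ = C * ∫ v, (A / (1 + ‖ℓ‖)) ^ N * (ρ i v ^ m * κ i v) := by
        rw [integral_const_mul]; ring
    _ ≤ C * ∫ v : Conf d × Conf d,
          (2 + K) ^ N * (D * (g (v.1 - q₁ i) * g (v.2 - q₂ i))) := by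
        refine mul_le_mul_of_nonneg_left (integral_mono ((hint m i).const_mul _)
          (((hgg i).const_mul _).const_mul _) fun v => ?_) hC0
        have h9 : A / (1 + ‖ℓ‖) ≤ (2 + K) * ρ i v := by
          rw [div_le_iff₀ (by positivity)]
          exact (hA v).trans (le_of_eq (by ring))
        have h10 := hρ0 i v
        have h11 := hκ i v
        calc _ ≤ ((2 + K) * ρ i v) ^ N * (ρ i v ^ m * κ i v) := by gcongr
          _ = (2 + K) ^ N * (ρ i v ^ (m + N) * κ i v) := by rw [mul_pow, pow_add]; ring
          _ ≤ _ := by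
              exact mul_le_mul_of_nonneg_left (hD i v) (by positivity)
    _ = _ := by
        rw [integral_const_mul, integral_const_mul]
        have := integral_prod_mul (μ := (volume : Measure (Conf d)))
          (ν := (volume : Measure (Conf d))) (fun y => g (y - q₁ i)) (fun y => g (y - q₂ i))
        rw [show (volume : Measure (Conf d × Conf d)) = volume.prod volume from rfl, this,
          integral_gaussian_translate, integral_gaussian_translate]
        ring

/-- At fixed `x`, the integral over `y` against a Schwartz function decays in the frequency. -/
theorem IsPhaseFamily.schwartz_decay (h : IsPhaseFamily S Q P p Θ c)
    {b : ι → Conf d × Conf d → ℂ} (hb : UniformSymbol 0 b) (x : ι → Conf d) (ψ : 𝓢(Conf d, ℂ))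
    (n : ℕ) : ∃ C : ℝ, ∀ i, (1 + ‖p i‖) ^ n *
      ‖∫ y : Conf d, Complex.exp (Complex.I * frozenPhase (S i) (Q i) (P i) (Θ i) y (x i))
        * b i (y, x i) * ψ y‖ ≤ C := by
  -- The recentring point may be zero since `ψ` localises `y` there. At fixed `x` the term `P(0) ·
  -- x` only contributes a constant of modulus one, and `p` becomes the Fourier variable.
  obtain ⟨hs, ht⟩ := h.tame_centredPhase (fun _ => 0)
  have hρ : ∀ i v, 1 ≤ phaseWeight (Q i) 0 v := fun i v => one_le_phaseWeight _ _ _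
  have hE := Tame.exp hs ht hρ
  have hE' := hE.mul (Tame.of_uniformSymbol_zero hb) hρ (fun _ _ => (Real.exp_pos _).le)
    (fun _ _ => zero_le_one)
  have hslice : UniformSymbol 1 (fun i (y : Conf d) => (y, x i)) := by
    simpa using uniformSymbol_affine (ContinuousLinearMap.inl ℝ (Conf d) (Conf d))
      (fun i => (0, x i))
  have hF := hE'.comp hρ (fun i v => by positivity) hslice
  have hB : ∀ m : ℕ, ∃ (C : ℝ) (N : ℕ), ∀ i y, phaseWeight (Q i) 0 (y, x i) ^ m *
      (Real.exp (centredPhase (S i) (Q i) (P i) (Θ i) (p i) 0 (y, x i)).re * 1)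
        ≤ C * (fun _ : ι => (1 : ℝ)) i * (1 + ‖y‖) ^ N := by
    intro m
    obtain ⟨C, hC0, hC⟩ := exp_decay_nonneg m (c := c / 2) (by linarith [h.pos])
    refine ⟨C, m, fun i y => ?_⟩
    have h1 : phaseWeight (Q i) 0 (y, x i) ≤ (1 + ‖y‖) * (1 + ‖x i - Q i y‖) := by
      simp only [phaseWeight, sub_zero]
      nlinarith [mul_nonneg (norm_nonneg y) (norm_nonneg (x i - Q i y))]
    have h0 : 0 ≤ phaseWeight (Q i) 0 (y, x i) := zero_le_one.trans (hρ i _)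
    calc _ ≤ ((1 + ‖y‖) * (1 + ‖x i - Q i y‖)) ^ m
          * Real.exp (-(c / 2 * ‖x i - Q i y‖ ^ 2)) := by
          rw [mul_one]
          gcongr
          exact h.re_centredPhase i 0 (y, x i)
      _ = (1 + ‖y‖) ^ m * ((1 + ‖x i - Q i y‖) ^ m
          * Real.exp (-(c / 2 * ‖x i - Q i y‖ ^ 2))) := by rw [mul_pow]; ring
      _ ≤ (1 + ‖y‖) ^ m * C := by
          gcongr
          exact hC _ (norm_nonneg _)
      _ = _ := by ring
  obtain ⟨C, hC⟩ := hF.fourier_decay_schwartz (fun i y => hρ i _) (fun i y => by positivity) hB ψ n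
  refine ⟨C * 1, fun i => ?_⟩
  have h2 := hC i (innerSL ℝ (p i))
  rw [innerSL_apply_norm] at h2
  refine (le_of_eq ?_).trans h2
  congr 1
  have e : ∀ y, Complex.exp (-(Complex.I * ((innerSL ℝ (p i) y : ℝ) : ℂ))) *
      (Complex.exp (centredPhase (S i) (Q i) (P i) (Θ i) (p i) 0 (y, x i)) * b i (y, x i) * ψ y)
      = Complex.exp (-(Complex.I * ((inner ℝ (P i 0) (x i) : ℝ) : ℂ))) *
      (Complex.exp (Complex.I * frozenPhase (S i) (Q i) (P i) (Θ i) y (x i))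
        * b i (y, x i) * ψ y) := by
    intro y
    simp only [← mul_assoc, ← Complex.exp_add]
    congr 3
    simp only [centredPhase, innerSL_apply_apply]
    push_cast
    ring
  simp only [e]
  rw [integral_const_mul, norm_mul, Complex.norm_exp]
  simp

end CoreEstimates

/-! ### Windowed Fourier transforms -/

section Windowed

variable {d : ℕ}

lemma quadForm_smul (Γ : Matrix (Fin d) (Fin d) ℂ) (t : ℝ) (v : Conf d) :
    quadForm Γ (t • v) = (t : ℂ) ^ 2 * quadForm Γ v := by
  simp only [quadForm, Finset.mul_sum, PiLp.smul_apply, smul_eq_mul, Complex.ofReal_mul]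
  exact Finset.sum_congr rfl fun i _ => Finset.sum_congr rfl fun j _ => by ring

lemma quadForm_conj (Γ : Matrix (Fin d) (Fin d) ℂ) (v : Conf d) :
    quadForm (Γ.map conj) v = conj (quadForm Γ v) := by
  simp [quadForm]

lemma continuous_quadForm (Γ : Matrix (Fin d) (Fin d) ℂ) : Continuous (quadForm Γ) := by
  unfold quadForm
  fun_prop

lemma quadForm_im_pos {Γ : Matrix (Fin d) (Fin d) ℂ} (hΓ : Γ ∈ siegel d) {v : Conf d}
    (hv : v ≠ 0) : 0 < (quadForm Γ v).im := by
  have h := hΓ.2.dotProduct_mulVec_pos (x := fun i => v i) (by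
    contrapose! hv
    ext i
    exact congrFun hv i)
  refine h.trans_eq ?_
  simp only [quadForm, dotProduct, Matrix.mulVec, Matrix.map_apply, Complex.im_sum,
    Finset.mul_sum, Pi.star_apply, star_trivial]
  refine Finset.sum_congr rfl fun i _ => Finset.sum_congr rfl fun j _ => ?_
  rw [Complex.im_mul_ofReal, Complex.im_mul_ofReal]
  ring

/-- Compactness of the unit sphere and homogeneity. The sphere is empty for `d = 0`, which is
treated separately. -/
lemma siegel_lower {Γ : Matrix (Fin d) (Fin d) ℂ} (hΓ : Γ ∈ siegel d) :
    ∃ c > (0 : ℝ), ∀ v : Conf d, c * ‖v‖ ^ 2 ≤ (quadForm Γ v).im := by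
  rcases (Metric.sphere (0 : Conf d) 1).eq_empty_or_nonempty with he | hne
  · refine ⟨1, one_pos, fun v => ?_⟩
    have : v = 0 := by
      by_contra hv
      have : (‖v‖⁻¹ • v) ∈ Metric.sphere (0 : Conf d) 1 := by
        simp [norm_smul, inv_mul_cancel₀ (norm_ne_zero_iff.2 hv)]
      simp [he] at this
    simp [this, quadForm]
  · obtain ⟨u, hu, hmin⟩ := (isCompact_sphere (0 : Conf d) 1).exists_isMinOn hne
      ((Complex.continuous_im.comp (continuous_quadForm Γ)).continuousOn)
    have hu0 : u ≠ 0 := by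
      rintro rfl
      simp at hu
    refine ⟨_, quadForm_im_pos hΓ hu0, fun v => ?_⟩
    rcases eq_or_ne v 0 with rfl | hv
    · simp [quadForm]
    have hn : 0 < ‖v‖ := norm_pos_iff.2 hv
    have h1 : (‖v‖⁻¹ • v) ∈ Metric.sphere (0 : Conf d) 1 := by
      simp [norm_smul, inv_mul_cancel₀ hn.ne']
    have h2 : (quadForm Γ u).im ≤ (quadForm Γ (‖v‖⁻¹ • v)).im := hmin h1
    have h3 : (quadForm Γ v).im = ‖v‖ ^ 2 * (quadForm Γ (‖v‖⁻¹ • v)).im := by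
      rw [quadForm_smul, ← Complex.ofReal_pow, Complex.im_ofReal_mul]
      field_simp
    rw [h3, mul_comm]
    gcongr

/-- The Gaussian window `exp (-(i/2) Γ̄ v · v)`. -/
def window (Γ : Matrix (Fin d) (Fin d) ℂ) (v : Conf d) : ℂ :=
  Complex.exp (-(Complex.I / 2) * quadForm (Γ.map conj) v)

lemma window_re (Γ : Matrix (Fin d) (Fin d) ℂ) (v : Conf d) :
    (-(Complex.I / 2) * quadForm (Γ.map conj) v).re = -(1 / 2 * (quadForm Γ v).im) := by
  rw [quadForm_conj]
  simp [Complex.mul_re]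

/-- The standard Gaussian is the window of `i` times the identity. The same estimates thus serve the
wave packet transform and the inner integral of `ℐ`. -/
lemma window_im_one (v : Conf d) :
    window (Complex.I • (1 : Matrix (Fin d) (Fin d) ℂ)) v = gaussWave 0 0 v := by
  have : quadForm ((Complex.I • (1 : Matrix (Fin d) (Fin d) ℂ)).map conj) v
      = -Complex.I * ((‖v‖ ^ 2 : ℝ) : ℂ) := by
    rw [quadForm_conj]
    simp only [quadForm, Matrix.smul_apply, Matrix.one_apply, smul_eq_mul, mul_ite, mul_one,
      mul_zero, ite_mul, zero_mul, Finset.sum_ite_eq, Finset.mem_univ, if_true]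
    rw [EuclideanSpace.real_norm_sq_eq]
    simp only [map_sum, map_mul, Complex.conj_I, Complex.conj_ofReal, Complex.ofReal_sum,
      Finset.mul_sum]
    exact Finset.sum_congr rfl fun i _ => by push_cast; ring
  rw [window, this, gaussWave]
  congr 1
  simp only [inner_zero_left, Complex.ofReal_zero, mul_zero, zero_sub, sub_zero]
  push_cast
  linear_combination (-(1 / 2) * (‖v‖ : ℂ) ^ 2 : ℂ) * (-Complex.I_sq)

lemma smul_one_mem_siegel : Complex.I • (1 : Matrix (Fin d) (Fin d) ℂ) ∈ siegel d := by
  refine ⟨?_, ?_⟩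
  · rw [Matrix.IsSymm, Matrix.transpose_smul, Matrix.transpose_one]
  · have : (Complex.I • (1 : Matrix (Fin d) (Fin d) ℂ)).map Complex.im = 1 := by
      ext i j
      simp only [Matrix.map_apply, Matrix.smul_apply, Matrix.one_apply]
      split_ifs <;> simp
    rw [this]
    exact Matrix.PosDef.one

lemma tame_window {ι : Type*} {Γ : Matrix (Fin d) (Fin d) ℂ} {c : ℝ}
    (hc : ∀ v : Conf d, c * ‖v‖ ^ 2 ≤ (quadForm Γ v).im) (q : ι → Conf d) :
    Tame (fun i y => 1 + ‖y - q i‖) (fun i y => Real.exp (-(c / 2 * ‖y - q i‖ ^ 2)))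
      (fun i y => window Γ (y - q i)) := by
  set ρ : ι → Conf d → ℝ := fun i y => 1 + ‖y - q i‖ with hρdef
  have hρ : ∀ i y, 1 ≤ ρ i y := fun i y => by simp [hρdef]
  have hρ0 : ∀ i y, 0 ≤ ρ i y := fun i y => zero_le_one.trans (hρ i y)
  have h1 : Tame ρ (fun _ _ => 1) (fun i (y : Conf d) => y - q i) := by
    refine Tame.of_uniformSymbol (C := 1) ?_ fun i y => by simp [hρdef]
    simpa [sub_eq_add_neg] using uniformSymbol_affine (ContinuousLinearMap.id ℝ (Conf d))
      (fun i => -q i)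
  have h2 : Tame ρ (fun _ _ => 1)
      (fun i y => -(Complex.I / 2) * quadForm (Γ.map conj) (y - q i)) := by
    refine (tame_quadForm hρ (Θ := fun _ _ => Γ.map conj) (fun k l => ?_) h1).clm
      (ContinuousLinearMap.mul ℝ ℂ (-(Complex.I / 2))) hρ0 (by simp)
    refine Tame.of_uniformSymbol_zero (UniformSymbol.of_bound (C := ‖(Γ.map conj) k l‖) ?_
      fun _ _ => le_rfl)
    simpa using uniformSymbol_affine (0 : Conf d →L[ℝ] ℂ) (fun _ : ι => (Γ.map conj) k l)
  refine (Tame.exp h2.1 h2.fderiv hρ).mono hρ0 (fun _ _ => le_rfl)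
    (fun _ _ => (Real.exp_pos _).le) fun i y => ?_
  rw [window_re, Real.exp_le_exp]
  linarith [hc (y - q i)]

/-- The Fourier transform of `ψ`, windowed around `q` by the Gaussian given by `Γ`. -/
def windowedFourier (Γ : Matrix (Fin d) (Fin d) ℂ) (ψ : 𝓢(Conf d, ℂ)) (X : Phase d) : ℂ :=
  ∫ y, Complex.exp (-(Complex.I * ((inner ℝ X.2 y : ℝ) : ℂ))) * (window Γ (y - X.1) * ψ y)

lemma norm_window_le_one {Γ : Matrix (Fin d) (Fin d) ℂ} (hΓ : Γ ∈ siegel d) (v : Conf d) :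
    ‖window Γ v‖ ≤ 1 := by
  obtain ⟨c, hc, hlow⟩ := siegel_lower hΓ
  rw [window, Complex.norm_exp, window_re, Real.exp_le_one_iff]
  have : 0 ≤ c * ‖v‖ ^ 2 := by positivity
  linarith [hlow v]

lemma continuous_window (Γ : Matrix (Fin d) (Fin d) ℂ) : Continuous (window Γ) := by
  have := continuous_quadForm (Γ.map conj)
  unfold window
  fun_prop

lemma continuous_windowedFourier {Γ : Matrix (Fin d) (Fin d) ℂ} (hΓ : Γ ∈ siegel d)
    (ψ : 𝓢(Conf d, ℂ)) : Continuous (windowedFourier Γ ψ) := by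
  have hw := continuous_window Γ
  have hψ := ψ.continuous
  refine continuous_of_dominated (bound := fun y => ‖ψ y‖) (fun X => ?_) (fun X => ?_)
    ψ.integrable.norm (.of_forall fun y => ?_)
  · exact Continuous.aestronglyMeasurable (by fun_prop)
  · refine .of_forall fun y => ?_
    rw [norm_mul, norm_mul, Complex.norm_exp]
    simp only [Complex.neg_re, Complex.re_mul_ofReal, Complex.I_re, zero_mul, neg_zero,
      Real.exp_zero, one_mul]
    exact mul_le_of_le_one_left (norm_nonneg _) (norm_window_le_one hΓ _)
  · fun_prop

/-- Integration by parts gives the decay in the frequency. Decay in the position comes from the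
overlap of the window with `ψ`, each localised near a different point. -/
theorem windowedFourier_decay {Γ : Matrix (Fin d) (Fin d) ℂ} (hΓ : Γ ∈ siegel d)
    (ψ : 𝓢(Conf d, ℂ)) (N : ℕ) : ∃ C : ℝ, ∀ X : Phase d,
      ‖windowedFourier Γ ψ X‖ ≤ C * (((1 + ‖X.1‖) ^ N)⁻¹ * ((1 + ‖X.2‖) ^ N)⁻¹) := by
  obtain ⟨c, hc, hlow⟩ := siegel_lower hΓ
  have ht := tame_window hlow (fun X : Phase d => X.1)
  obtain ⟨C, hC⟩ := ht.fourier_decay_schwartz (fun i y => by simp) (fun i y => by positivity)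
    (B := fun X => ((1 + ‖X.1‖) ^ N)⁻¹) (fun m => by
      obtain ⟨C, hC0, hC⟩ := exp_decay_nonneg (m + N) (c := c / 2) (by positivity)
      refine ⟨C, N, fun X y => ?_⟩
      -- Peetre's inequality shares the decay in `q` between the Gaussian and the Schwartz function.
      have h1 : 1 + ‖X.1‖ ≤ (1 + ‖y - X.1‖) * (1 + ‖y‖) := by
        have : ‖X.1‖ ≤ ‖y‖ + ‖y - X.1‖ := by
          have := norm_sub_le y (y - X.1)
          simpa using this
        nlinarith [mul_nonneg (norm_nonneg (y - X.1)) (norm_nonneg y)]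
      have h2 := hC ‖y - X.1‖ (norm_nonneg _)
      rw [mul_assoc, mul_comm (((1 + ‖X.1‖) ^ N)⁻¹), ← div_eq_mul_inv, ← mul_div_assoc,
        le_div_iff₀ (by positivity)]
      calc _ ≤ (1 + ‖y - X.1‖) ^ m * Real.exp (-(c / 2 * ‖y - X.1‖ ^ 2))
            * ((1 + ‖y - X.1‖) * (1 + ‖y‖)) ^ N := by gcongr
        _ = (1 + ‖y - X.1‖) ^ (m + N) * Real.exp (-(c / 2 * ‖y - X.1‖ ^ 2))
            * (1 + ‖y‖) ^ N := by rw [mul_pow, pow_add]; ring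
        _ ≤ _ := by gcongr) ψ N
  refine ⟨C, fun X => ?_⟩
  have h := hC X (innerSL ℝ X.2)
  rw [innerSL_apply_norm] at h
  rw [← mul_assoc, ← div_eq_mul_inv, le_div_iff₀ (by positivity), mul_comm]
  exact h

lemma integrable_windowedFourier {Γ : Matrix (Fin d) (Fin d) ℂ} (hΓ : Γ ∈ siegel d)
    (ψ : 𝓢(Conf d, ℂ)) : Integrable (windowedFourier Γ ψ) := by
  obtain ⟨C, hC⟩ := windowedFourier_decay hΓ ψ (d + 1)
  have hI := integrable_one_add_norm_inv (Conf d) (n := d + 1) (by simp)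
  exact ((hI.mul_prod hI).const_mul C).mono'
    (continuous_windowedFourier hΓ ψ).aestronglyMeasurable (.of_forall hC)

end Windowed

/-! ### The wave packet transform -/

section PacketTransform

variable {d : ℕ}

/-- The unnormalised Fourier-Bargmann transform. -/
def packetTransform (ψ : 𝓢(Conf d, ℂ)) (X : Phase d) : ℂ :=
  ∫ y, gaussWave X.1 (-X.2) y * ψ y

lemma gaussWave_eq (q p y : Conf d) :
    gaussWave q p y = Complex.exp (Complex.I * ((inner ℝ p y : ℝ) : ℂ)) * gaussWave q 0 y := by
  rw [gaussWave, gaussWave, ← Complex.exp_add]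
  simp [sub_eq_add_neg]

lemma packetTransform_eq (ψ : 𝓢(Conf d, ℂ)) :
    packetTransform ψ = windowedFourier (Complex.I • (1 : Matrix (Fin d) (Fin d) ℂ)) ψ := by
  ext X
  refine integral_congr_ae (.of_forall fun y => ?_)
  simp only [window_im_one]
  rw [gaussWave_eq, mul_assoc, inner_neg_left]
  simp [gaussWave]

lemma continuous_packetTransform (ψ : 𝓢(Conf d, ℂ)) : Continuous (packetTransform ψ) :=
  packetTransform_eq ψ ▸ continuous_windowedFourier smul_one_mem_siegel ψ

lemma integrable_packetTransform (ψ : 𝓢(Conf d, ℂ)) : Integrable (packetTransform ψ) :=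
  packetTransform_eq ψ ▸ integrable_windowedFourier smul_one_mem_siegel ψ

/-- The product of `ψ` with a Gaussian centred at `q`. -/
def localized (q : Conf d) (ψ : 𝓢(Conf d, ℂ)) : 𝓢(Conf d, ℂ) :=
  SchwartzMap.smulLeftCLM ℂ (coherentState one_pos (q, (0 : Conf d))) ψ

/-- The normalising constant of coherent states. -/
def coherentConst (d : ℕ) : ℂ := (((Real.pi * 1) ^ (-((d : ℝ) / 4)) : ℝ) : ℂ)

lemma coherentConst_ne_zero : coherentConst d ≠ 0 := by
  have := Real.pi_pos
  exact Complex.ofReal_ne_zero.2 (by positivity)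

lemma localized_apply (q y : Conf d) (ψ : 𝓢(Conf d, ℂ)) :
    localized q ψ y = coherentConst d * (gaussWave q 0 y * ψ y) := by
  rw [localized, SchwartzMap.smulLeftCLM_apply_apply (SchwartzMap.hasTemperateGrowth _),
    smul_eq_mul, ← mul_assoc]
  congr 1
  change coherentConst d * Complex.exp (coherentExponent 1 (q, 0) y) = _
  simp [coherentExponent, gaussWave]

open FourierTransform in
-- At fixed position the wave packet transform is a Fourier transform. Inversion and Plancherel thus
-- follow from the Fourier case slice by slice, with a final integration over the position.
lemma fourier_localized (q w : Conf d) (ψ : 𝓢(Conf d, ℂ)) :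
    (𝓕 (localized q ψ)) w
      = coherentConst d * packetTransform ψ (q, (2 * Real.pi) • w) := by
  rw [SchwartzMap.fourier_coe, Real.fourier_eq', packetTransform, ← integral_const_mul]
  refine integral_congr_ae (.of_forall fun y => ?_)
  simp only [localized_apply, smul_eq_mul]
  rw [gaussWave_eq q (-_)]
  have : Complex.exp (((-2 * Real.pi * inner ℝ y w : ℝ) : ℂ) * Complex.I)
      = Complex.exp (Complex.I * ((inner ℝ (-((2 * Real.pi) • w)) y : ℝ) : ℂ)) := by
    congr 1
    rw [inner_neg_left, inner_smul_left, real_inner_comm]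
    simp
    ring
  rw [this]
  ring

lemma integral_comp_two_pi_smul {F : Type*} [NormedAddCommGroup F] [NormedSpace ℝ F]
    (f : Conf d → F) :
    ∫ w, f ((2 * Real.pi) • w) = ((2 * Real.pi) ^ d)⁻¹ • ∫ p, f p := by
  have := Real.pi_pos
  rw [Measure.integral_comp_smul, finrank_euclideanSpace, Fintype.card_fin,
    abs_of_pos (by positivity)]

lemma norm_gaussWave_sq (q p y : Conf d) :
    ‖gaussWave q p y‖ ^ 2 = Real.exp (-(1 * ‖y - q‖ ^ 2)) := by
  rw [norm_gaussWave, ← Real.exp_nat_mul]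
  congr 1
  push_cast
  ring

lemma integral_gaussian_pos : 0 < ∫ y : Conf d, Real.exp (-(1 * ‖y‖ ^ 2)) := by
  have h : Integrable (fun y : Conf d => Real.exp (-(1 * ‖y‖ ^ 2))) := by
    simpa using integrable_gaussian (d := d) one_pos 0
  refine (integral_pos_iff_support_of_nonneg (fun y => (Real.exp_pos _).le) h).2 ?_
  rw [show Function.support (fun y : Conf d => Real.exp (-(1 * ‖y‖ ^ 2))) = Set.univ from
    Set.eq_univ_of_forall fun y => (Real.exp_pos _).ne']
  exact Measure.measure_univ_pos.2 (NeZero.ne _)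

open FourierTransform in
-- Fourier inversion recovers `ψ` times one Gaussian; the packets used for synthesis contribute the
-- second, so the square appears.
lemma packetTransform_inversion_slice (ψ : 𝓢(Conf d, ℂ)) (q y : Conf d) :
    ∫ p, packetTransform ψ (q, p) * gaussWave q p y
      = (2 * Real.pi) ^ d * (((‖gaussWave q 0 y‖ ^ 2 : ℝ) : ℂ) * ψ y) := by
  have hπ := Real.pi_pos
  have h1 : 𝓕⁻ (𝓕 (localized q ψ)) y = localized q ψ y := by
    rw [FourierTransform.fourierInv_fourier_eq]
  rw [SchwartzMap.fourierInv_coe, Real.fourierInv_eq', localized_apply] at h1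
  have h2 : ∀ w : Conf d, Complex.exp (((2 * Real.pi * inner ℝ w y : ℝ) : ℂ) * Complex.I)
      • (𝓕 (localized q ψ)) w = (fun p => coherentConst d *
        (packetTransform ψ (q, p) * Complex.exp (Complex.I * ((inner ℝ p y : ℝ) : ℂ))))
          ((2 * Real.pi) • w) := by
    intro w
    simp only [fourier_localized, smul_eq_mul, inner_smul_left]
    simp only [conj_trivial, mul_comm Complex.I]
    ring
  simp only [h2] at h1
  rw [integral_comp_two_pi_smul (fun p => coherentConst d * (packetTransform ψ (q, p)
    * Complex.exp (Complex.I * ((inner ℝ p y : ℝ) : ℂ)))), integral_const_mul,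
    ← mul_smul_comm] at h1
  have h3 := mul_left_cancel₀ coherentConst_ne_zero h1
  have h4 : ∫ p, packetTransform ψ (q, p) * gaussWave q p y
      = gaussWave q 0 y * ∫ p, packetTransform ψ (q, p)
        * Complex.exp (Complex.I * ((inner ℝ p y : ℝ) : ℂ)) := by
    rw [← integral_const_mul]
    refine integral_congr_ae (.of_forall fun p => ?_)
    simp only []
    rw [gaussWave_eq q p]
    ring
  have h5 : gaussWave q 0 y * gaussWave q 0 y = ((‖gaussWave q 0 y‖ ^ 2 : ℝ) : ℂ) := by
    rw [norm_gaussWave_sq, gaussWave, ← Complex.exp_add, Complex.ofReal_exp]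
    congr 1
    simp
    ring
  rw [h4, ← h5]
  rw [inv_smul_eq_iff₀ (by positivity)] at h3
  rw [h3, Complex.real_smul]
  push_cast
  ring

/-- Reconstruction of a Schwartz function from its wave packet transform. -/
theorem packetTransform_inversion (d : ℕ) : ∃ c : ℝ, 0 < c ∧ ∀ (ψ : 𝓢(Conf d, ℂ)) (y : Conf d),
    ψ y = c * ∫ X : Phase d, packetTransform ψ X * gaussWave X.1 X.2 y := by
  have hπ := Real.pi_pos
  have hG := integral_gaussian_pos (d := d)
  set G := ∫ y : Conf d, Real.exp (-(1 * ‖y‖ ^ 2))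
  -- The factor `(2π) ^ d` comes from each slice, and `G` from the integral over `q` of the squared
  -- Gaussian.
  refine ⟨((2 * Real.pi) ^ d * G)⁻¹, by positivity, fun ψ y => ?_⟩
  have hI : Integrable (fun X : Phase d => packetTransform ψ X * gaussWave X.1 X.2 y)
      (volume.prod volume) := by
    refine Integrable.mul_of_top_left (integrable_packetTransform ψ) ?_
    refine memLp_top_of_bound (Continuous.aestronglyMeasurable ?_) 1
      (.of_forall fun X => norm_gaussWave_le_one _ _ _)
    unfold gaussWave
    fun_prop
  rw [show (volume : Measure (Phase d)) = volume.prod volume from rfl, integral_prod _ hI]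
  simp only [packetTransform_inversion_slice]
  rw [integral_const_mul, integral_mul_const, integral_complex_ofReal]
  have : ∫ q : Conf d, ‖gaussWave q 0 y‖ ^ 2 = G := by
    simp only [norm_gaussWave_sq, norm_sub_rev y]
    exact integral_gaussian_translate y
  rw [this]
  push_cast
  have h1 : (G : ℂ) ≠ 0 := Complex.ofReal_ne_zero.2 hG.ne'
  have h2 : (Real.pi : ℂ) ≠ 0 := Complex.ofReal_ne_zero.2 hπ.ne'
  field_simp

open FourierTransform in
lemma packetTransform_plancherel_slice (ψ : 𝓢(Conf d, ℂ)) (q : Conf d) :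
    ∫ p, ‖packetTransform ψ (q, p)‖ ^ 2
      = (2 * Real.pi) ^ d * ∫ y, ‖gaussWave q 0 y‖ ^ 2 * ‖ψ y‖ ^ 2 := by
  have hπ := Real.pi_pos
  have h := SchwartzMap.integral_norm_sq_fourier (localized q ψ)
  simp only [fourier_localized, localized_apply, norm_mul, mul_pow, integral_const_mul] at h
  have h0 : ‖coherentConst d‖ ^ 2 ≠ 0 := pow_ne_zero _ (norm_ne_zero_iff.2 coherentConst_ne_zero)
  have h1 := mul_left_cancel₀ h0 h
  rw [integral_comp_two_pi_smul (fun p => ‖packetTransform ψ (q, p)‖ ^ 2), smul_eq_mul,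
    inv_mul_eq_iff_eq_mul₀ (by positivity)] at h1
  exact h1

lemma integrable_packetTransform_slice (ψ : 𝓢(Conf d, ℂ)) (q : Conf d) :
    Integrable (fun p => ‖packetTransform ψ (q, p)‖ ^ 2) := by
  obtain ⟨C, hC⟩ := windowedFourier_decay (smul_one_mem_siegel (d := d)) ψ (d + 1)
  rw [← packetTransform_eq] at hC
  have hI := integrable_one_add_norm_inv (Conf d) (n := d + 1) (by simp)
  have hc := continuous_packetTransform ψ
  refine (hI.const_mul (|C| ^ 2)).mono' (Continuous.aestronglyMeasurable (by fun_prop))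
    (.of_forall fun p => ?_)
  rw [norm_pow, norm_norm]
  have ht : ((1 + ‖p‖) ^ (d + 1))⁻¹ ≤ 1 := inv_le_one_of_one_le₀ (one_le_pow₀ (by simp))
  have ht' : ((1 + ‖q‖) ^ (d + 1))⁻¹ ≤ 1 := inv_le_one_of_one_le₀ (one_le_pow₀ (by simp))
  have h0 : 0 ≤ ((1 + ‖p‖) ^ (d + 1))⁻¹ := by positivity
  have h0' : 0 ≤ ((1 + ‖q‖) ^ (d + 1))⁻¹ := by positivity
  have h1 : ‖packetTransform ψ (q, p)‖ ≤ |C| * ((1 + ‖p‖) ^ (d + 1))⁻¹ := by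
    refine (hC (q, p)).trans ?_
    calc _ ≤ |C| * (1 * ((1 + ‖p‖) ^ (d + 1))⁻¹) := by
          gcongr
          exact le_abs_self C
      _ = _ := by ring
  calc ‖packetTransform ψ (q, p)‖ ^ 2 ≤ (|C| * ((1 + ‖p‖) ^ (d + 1))⁻¹) ^ 2 := by gcongr
    _ = |C| ^ 2 * (((1 + ‖p‖) ^ (d + 1))⁻¹ * ((1 + ‖p‖) ^ (d + 1))⁻¹) := by ring
    _ ≤ |C| ^ 2 * (((1 + ‖p‖) ^ (d + 1))⁻¹ * 1) := by gcongr
    _ = _ := by ring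

lemma schwartz_integrable_sq (ψ : 𝓢(Conf d, ℂ)) : Integrable (fun y => ‖ψ y‖ ^ 2) :=
  (ψ.memLp 2 volume).integrable_norm_pow (by norm_num)

/-- The wave packet transform is bounded on `L²`. -/
theorem packetTransform_plancherel (d : ℕ) : ∃ C : ℝ, 0 ≤ C ∧ ∀ ψ : 𝓢(Conf d, ℂ),
    ∫⁻ X : Phase d, ‖packetTransform ψ X‖ₑ ^ 2 ≤ ENNReal.ofReal (C * ∫ y, ‖ψ y‖ ^ 2) := by
  have hπ := Real.pi_pos
  have hG := integral_gaussian_pos (d := d)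
  set G := ∫ y : Conf d, Real.exp (-(1 * ‖y‖ ^ 2)) with hGdef
  refine ⟨(2 * Real.pi) ^ d * G, by positivity, fun ψ => ?_⟩
  have hc := continuous_packetTransform ψ
  have hsl : ∀ q : Conf d, Integrable (fun y => ‖gaussWave q 0 y‖ ^ 2 * ‖ψ y‖ ^ 2) := by
    intro q
    refine (schwartz_integrable_sq ψ).mono' (Continuous.aestronglyMeasurable ?_)
      (.of_forall fun y => ?_)
    · have := ψ.continuous
      unfold gaussWave
      fun_prop
    · rw [norm_mul, norm_pow, norm_pow, norm_norm, norm_norm]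
      exact mul_le_of_le_one_left (by positivity)
        (pow_le_one₀ (norm_nonneg _) (norm_gaussWave_le_one _ _ _))
  have henorm : ∀ z : ℂ, ‖z‖ₑ ^ 2 = ENNReal.ofReal (‖z‖ ^ 2) := fun z => by
    rw [← ofReal_norm, ENNReal.ofReal_pow (norm_nonneg _)]
  have hmeas : Measurable (Function.uncurry fun (q y : Conf d) =>
      ENNReal.ofReal (‖gaussWave q 0 y‖ ^ 2 * ‖ψ y‖ ^ 2)) := by
    refine (ENNReal.continuous_ofReal.comp ?_).measurable
    have := ψ.continuous
    unfold gaussWave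
    fun_prop
  rw [show (volume : Measure (Phase d)) = volume.prod volume from rfl,
    lintegral_prod _ (by fun_prop)]
  calc ∫⁻ q, ∫⁻ p, ‖packetTransform ψ (q, p)‖ₑ ^ 2
      = ∫⁻ q, ENNReal.ofReal ((2 * Real.pi) ^ d) *
          ∫⁻ y, ENNReal.ofReal (‖gaussWave q 0 y‖ ^ 2 * ‖ψ y‖ ^ 2) := by
        refine lintegral_congr fun q => ?_
        simp only [henorm]
        rw [← ofReal_integral_eq_lintegral_ofReal (integrable_packetTransform_slice ψ q)
          (.of_forall fun _ => by positivity), packetTransform_plancherel_slice,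
          ENNReal.ofReal_mul (by positivity), ofReal_integral_eq_lintegral_ofReal (hsl q)
          (.of_forall fun _ => by positivity)]
    _ = ENNReal.ofReal ((2 * Real.pi) ^ d) *
          ∫⁻ y, ∫⁻ q, ENNReal.ofReal (‖gaussWave q 0 y‖ ^ 2 * ‖ψ y‖ ^ 2) := by
        rw [lintegral_const_mul _ (by exact Measurable.lintegral_prod_right' hmeas),
          lintegral_lintegral_swap hmeas.aemeasurable]
    _ = ENNReal.ofReal ((2 * Real.pi) ^ d) *
          ∫⁻ y, ENNReal.ofReal (G * ‖ψ y‖ ^ 2) := by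
        congr 1
        refine lintegral_congr fun y => ?_
        have hi : Integrable (fun q : Conf d => Real.exp (-(1 * ‖q - y‖ ^ 2))) :=
          integrable_gaussian one_pos y
        have : ∀ q, ‖gaussWave q 0 y‖ ^ 2 * ‖ψ y‖ ^ 2
            = Real.exp (-(1 * ‖q - y‖ ^ 2)) * ‖ψ y‖ ^ 2 := fun q => by
          rw [norm_gaussWave_sq, norm_sub_rev]
        simp only [this]
        rw [← ofReal_integral_eq_lintegral_ofReal (hi.mul_const _)
          (.of_forall fun _ => by positivity), integral_mul_const, integral_gaussian_translate]
    _ ≤ _ := by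
        rw [← ofReal_integral_eq_lintegral_ofReal ((schwartz_integrable_sq ψ).const_mul G)
          (.of_forall fun _ => by positivity), integral_const_mul,
          ← ENNReal.ofReal_mul (by positivity), mul_assoc]

end PacketTransform

/-! ### Schur's test in the wave packet representation -/

section Schur

open scoped ENNReal

/-- Cauchy–Schwarz on the product space after splitting `k` into two square roots, one attached to
each function. -/
lemma schur_test {α β : Type*} [MeasurableSpace α] [MeasurableSpace β] {μ : Measure α}
    {ν : Measure β} [SFinite μ] [SFinite ν] {k : α × β → ℝ≥0∞} (hk : Measurable k)
    {f : α → ℝ≥0∞} {g : β → ℝ≥0∞} (hf : Measurable f) (hg : Measurable g) {A : ℝ≥0∞}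
    (hrow : ∀ a, ∫⁻ b, k (a, b) ∂ν ≤ A) (hcol : ∀ b, ∫⁻ a, k (a, b) ∂μ ≤ A) :
    ∫⁻ z, k z * (f z.1 * g z.2) ∂μ.prod ν
      ≤ A * ((∫⁻ a, f a ^ 2 ∂μ) ^ (1 / 2 : ℝ) * (∫⁻ b, g b ^ 2 ∂ν) ^ (1 / 2 : ℝ)) := by
  have hsq : ∀ s t : ℝ≥0∞, (s ^ (1 / 2 : ℝ) * t) ^ (2 : ℝ) = s * t ^ 2 := fun s t => by
    rw [ENNReal.mul_rpow_of_nonneg _ _ (by norm_num), ← ENNReal.rpow_mul]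
    norm_num
  have hhalf : ∀ s : ℝ≥0∞, s ^ (1 / 2 : ℝ) * s ^ (1 / 2 : ℝ) = s := fun s => by
    rw [← ENNReal.rpow_add_of_nonneg _ _ (by norm_num) (by norm_num)]
    norm_num
  have h := ENNReal.lintegral_mul_le_Lp_mul_Lq (μ.prod ν) Real.HolderConjugate.two_two
    (f := fun z => k z ^ (1 / 2 : ℝ) * f z.1) (g := fun z => k z ^ (1 / 2 : ℝ) * g z.2)
    (by fun_prop) (by fun_prop)
  simp only [hsq, Pi.mul_apply] at h
  have h1 : ∫⁻ z, k z * f z.1 ^ 2 ∂μ.prod ν ≤ A * ∫⁻ a, f a ^ 2 ∂μ := by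
    rw [lintegral_prod _ (by fun_prop), ← lintegral_const_mul _ (by fun_prop)]
    refine lintegral_mono fun a => ?_
    simp only []
    rw [lintegral_mul_const _ (by fun_prop)]
    gcongr
    exact hrow a
  have h2 : ∫⁻ z, k z * g z.2 ^ 2 ∂μ.prod ν ≤ A * ∫⁻ b, g b ^ 2 ∂ν := by
    rw [lintegral_prod_symm _ (by fun_prop), ← lintegral_const_mul _ (by fun_prop)]
    refine lintegral_mono fun b => ?_
    simp only []
    rw [lintegral_mul_const _ (by fun_prop)]
    gcongr
    exact hcol b
  calc ∫⁻ z, k z * (f z.1 * g z.2) ∂μ.prod ν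
      = ∫⁻ z, k z ^ (1 / 2 : ℝ) * f z.1 * (k z ^ (1 / 2 : ℝ) * g z.2) ∂μ.prod ν := by
        refine lintegral_congr fun z => ?_
        rw [mul_mul_mul_comm, hhalf]
    _ ≤ (A * ∫⁻ a, f a ^ 2 ∂μ) ^ (1 / 2 : ℝ) * (A * ∫⁻ b, g b ^ 2 ∂ν) ^ (1 / 2 : ℝ) := by
        refine h.trans ?_
        gcongr
    _ = _ := by
        rw [ENNReal.mul_rpow_of_nonneg _ _ (by norm_num),
          ENNReal.mul_rpow_of_nonneg _ _ (by norm_num), mul_mul_mul_comm, hhalf]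

end Schur

/-! ### Expansion of pairings in wave packets -/

section PacketExpansion

open scoped ENNReal

variable {d : ℕ}

/-- Reversal of the frequency. -/
def reflect (Y : Phase d) : Phase d := (Y.1, -Y.2)

lemma measurePreserving_reflect :
    MeasurePreserving (reflect (d := d)) (volume : Measure (Phase d)) volume :=
  (MeasurePreserving.id volume).prod (Measure.measurePreserving_neg volume)

lemma measurableEmbedding_reflect : MeasurableEmbedding (reflect (d := d)) :=
  ((MeasurableEquiv.refl (Conf d)).prodCongr (MeasurableEquiv.neg (Conf d))).measurableEmbedding

lemma continuous_reflect : Continuous (reflect (d := d)) := by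
  unfold reflect
  fun_prop

/-- The matrix element of a kernel between two wave packets. -/
def packetElement (k : Conf d × Conf d → ℂ) (Z : Phase d × Phase d) : ℂ :=
  ∫ v : Conf d × Conf d, k v * (gaussWave Z.1.1 Z.1.2 v.1 * gaussWave Z.2.1 (-Z.2.2) v.2)

/-- Both functions are reconstructed from their packets and the integrals interchanged; the
Gaussians dominate in `v` and the transforms in `Z`. The pairing is bilinear, so `χ` is expanded in
packets of reversed frequency. In this way the matrix element contains the conjugate of the packet
at `Y`. -/
theorem packet_expansion (d : ℕ) : ∃ c : ℝ≥0∞, c ≠ ⊤ ∧ ∀ (k : Conf d × Conf d → ℂ)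
    (_ : Measurable k) (B : ℝ) (_ : ∀ v, ‖k v‖ ≤ B) (ψ χ : 𝓢(Conf d, ℂ)),
    ‖∫ v : Conf d × Conf d, k v * (ψ v.1 * χ v.2)‖ₑ ≤ c * ∫⁻ Z : Phase d × Phase d,
      ‖packetElement k Z‖ₑ * (‖packetTransform ψ Z.1‖ₑ * ‖packetTransform χ (reflect Z.2)‖ₑ) := by
  obtain ⟨c, hc, hinv⟩ := packetTransform_inversion d
  refine ⟨‖((c * c : ℝ) : ℂ)‖ₑ, enorm_ne_top, fun k hk B hB ψ χ => ?_⟩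
  have hVψ := continuous_packetTransform ψ
  have hVχ := continuous_packetTransform χ
  have hr := continuous_reflect (d := d)
  have hinv' : ∀ x, χ x = c * ∫ Y : Phase d,
      packetTransform χ (reflect Y) * gaussWave Y.1 (-Y.2) x := fun x => by
    rw [hinv χ x]
    congr 1
    exact (measurePreserving_reflect.integral_comp measurableEmbedding_reflect
      (fun Y => packetTransform χ Y * gaussWave Y.1 Y.2 x)).symm
  let F : (Phase d × Phase d) × (Conf d × Conf d) → ℂ := fun t =>
    k t.2 * ((packetTransform ψ t.1.1 * gaussWave t.1.1.1 t.1.1.2 t.2.1)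
      * (packetTransform χ (reflect t.1.2) * gaussWave t.1.2.1 (-t.1.2.2) t.2.2))
  have hFm : Measurable F := by
    refine (hk.comp measurable_snd).mul (Continuous.measurable ?_)
    unfold gaussWave
    fun_prop
  have hB0 : 0 ≤ B := (norm_nonneg _).trans (hB 0)
  set g : Conf d → ℝ := fun y => Real.exp (-(1 / 2 * ‖y‖ ^ 2))
  have hgi : ∀ q : Conf d, Integrable (fun y => g (y - q)) :=
    fun q => integrable_gaussian (by norm_num) q
  set G := ∫ y, g y
  have hFn : ∀ Z v, ‖F (Z, v)‖ ≤ B * (‖packetTransform ψ Z.1‖ * ‖packetTransform χ (reflect Z.2)‖)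
      * (g (v.1 - Z.1.1) * g (v.2 - Z.2.1)) := fun Z v => by
    simp only [F, norm_mul, norm_gaussWave]
    calc _ ≤ B * _ := mul_le_mul_of_nonneg_right (hB v) (by positivity)
      _ = _ := by ring
  have hFi : ∀ Z, Integrable (fun v => F (Z, v)) := fun Z =>
    (((hgi Z.1.1).mul_prod (hgi Z.2.1)).const_mul _).mono'
      (hFm.comp measurable_prodMk_left).aestronglyMeasurable (.of_forall (hFn Z))
  have hVI : Integrable (fun Z : Phase d × Phase d =>
      ‖packetTransform ψ Z.1‖ * ‖packetTransform χ (reflect Z.2)‖) :=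
    (integrable_packetTransform ψ).norm.mul_prod
      (measurePreserving_reflect.integrable_comp_of_integrable
        (integrable_packetTransform χ)).norm
  have hF : Integrable F (volume.prod volume) := by
    rw [integrable_prod_iff hFm.aestronglyMeasurable]
    refine ⟨.of_forall hFi, (hVI.const_mul (B * (G * G))).mono' ?_ (.of_forall fun Z => ?_)⟩
    · exact (hFm.norm.stronglyMeasurable.integral_prod_right').aestronglyMeasurable
    · rw [Real.norm_of_nonneg (by positivity)]
      refine (integral_mono (hFi Z).norm (((hgi Z.1.1).mul_prod (hgi Z.2.1)).const_mul _)
        (hFn Z)).trans (le_of_eq ?_)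
      rw [integral_const_mul, show (volume : Measure (Conf d × Conf d)) = volume.prod volume from rfl,
        integral_prod_mul (fun y => g (y - Z.1.1)) (fun y => g (y - Z.2.1)),
        integral_gaussian_translate, integral_gaussian_translate]
      simp only [G, g]
      ring
  have h1 : ∫ v : Conf d × Conf d, k v * (ψ v.1 * χ v.2)
      = ((c * c : ℝ) : ℂ) * ∫ v, ∫ Z, F (Z, v) := by
    rw [← integral_const_mul]
    refine integral_congr_ae (.of_forall fun v => ?_)
    simp only [F]
    rw [integral_const_mul, show (volume : Measure (Phase d × Phase d)) = volume.prod volume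
      from rfl, integral_prod_mul (fun X : Phase d => packetTransform ψ X * gaussWave X.1 X.2 v.1)
      (fun Y : Phase d => packetTransform χ (reflect Y) * gaussWave Y.1 (-Y.2) v.2), hinv ψ v.1,
      hinv' v.2]
    push_cast
    ring
  have h2 : ∀ Z, ∫ v, F (Z, v) = packetElement k Z *
      (packetTransform ψ Z.1 * packetTransform χ (reflect Z.2)) := by
    intro Z
    rw [packetElement, ← integral_mul_const]
    refine integral_congr_ae (.of_forall fun v => ?_)
    simp only [F]
    ring
  rw [h1, enorm_mul, ← integral_integral_swap (f := fun Z v => F (Z, v)) hF]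
  gcongr
  refine (enorm_integral_le_lintegral_enorm _).trans (le_of_eq ?_)
  simp only [h2, enorm_mul]

/-- The `L²` norm of a Schwartz function. -/
def l2norm (ψ : 𝓢(Conf d, ℂ)) : ℝ := Real.sqrt (∫ y, ‖ψ y‖ ^ 2)

/-- The kernels are paired with `ψ` and `χ` before the integration in `τ`, which need not converge
absolutely on the kernels themselves. Only the majorant `M` of the matrix elements has to be
integrable in `τ`, and Schur's test is applied to its integral. -/
theorem packet_schur (d : ℕ) : ∃ c : ℝ, 0 ≤ c ∧ ∀ {T : Type} [MeasurableSpace T] (μ : Measure T)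
    [SFinite μ] (k : T → Conf d × Conf d → ℂ) (_ : ∀ τ, Measurable (k τ)) (B : ℝ)
    (_ : ∀ τ v, ‖k τ v‖ ≤ B) (M : T × (Phase d × Phase d) → ℝ≥0∞) (_ : Measurable M)
    (_ : ∀ τ Z, ‖packetElement (k τ) Z‖ₑ ≤ M (τ, Z)) (A : ℝ) (_ : 0 ≤ A)
    (_ : ∀ X, ∫⁻ Y, (∫⁻ τ, M (τ, X, Y) ∂μ) ≤ ENNReal.ofReal A)
    (_ : ∀ Y, ∫⁻ X, (∫⁻ τ, M (τ, X, Y) ∂μ) ≤ ENNReal.ofReal A) (ψ χ : 𝓢(Conf d, ℂ)),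
    ‖∫ τ, (∫ v : Conf d × Conf d, k τ v * (ψ v.1 * χ v.2)) ∂μ‖
      ≤ c * A * (l2norm ψ * l2norm χ) := by
  obtain ⟨c, hc, hexp⟩ := packet_expansion d
  obtain ⟨D, hD0, hD⟩ := packetTransform_plancherel d
  refine ⟨c.toReal * D, by positivity,
    fun {T} _ μ _ k hk B hB M hM hkM A hA hrow hcol ψ χ => ?_⟩
  have hVψ := (continuous_packetTransform ψ).measurable
  have hVχ := (continuous_packetTransform χ).measurable
  have hr := (continuous_reflect (d := d)).measurable
  have hsq : ∀ ψ : 𝓢(Conf d, ℂ), (∫⁻ X, ‖packetTransform ψ X‖ₑ ^ 2) ^ (1 / 2 : ℝ)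
      ≤ ENNReal.ofReal (Real.sqrt D * l2norm ψ) := fun ψ => by
    have h0 : 0 ≤ ∫ y, ‖ψ y‖ ^ 2 := by positivity
    rw [l2norm, ← Real.sqrt_mul hD0, Real.sqrt_eq_rpow,
      ← ENNReal.ofReal_rpow_of_nonneg (by positivity) (by norm_num)]
    exact ENNReal.rpow_le_rpow (hD ψ) (by norm_num)
  have hmain : ‖∫ τ, (∫ v : Conf d × Conf d, k τ v * (ψ v.1 * χ v.2)) ∂μ‖ₑ
      ≤ c * (ENNReal.ofReal A * (ENNReal.ofReal (Real.sqrt D * l2norm ψ)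
        * ENNReal.ofReal (Real.sqrt D * l2norm χ))) := by
    calc _ ≤ ∫⁻ τ, ‖∫ v : Conf d × Conf d, k τ v * (ψ v.1 * χ v.2)‖ₑ ∂μ :=
          enorm_integral_le_lintegral_enorm _
      _ ≤ ∫⁻ τ, (c * ∫⁻ Z : Phase d × Phase d, M (τ, Z) *
            (‖packetTransform ψ Z.1‖ₑ * ‖packetTransform χ (reflect Z.2)‖ₑ)) ∂μ := by
          refine lintegral_mono fun τ => (hexp (k τ) (hk τ) B (hB τ) ψ χ).trans ?_
          gcongr with Z
          exact hkM τ Z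
      _ = c * ∫⁻ Z : Phase d × Phase d, (∫⁻ τ, M (τ, Z) ∂μ) *
            (‖packetTransform ψ Z.1‖ₑ * ‖packetTransform χ (reflect Z.2)‖ₑ) := by
          rw [lintegral_const_mul' _ _ hc, lintegral_lintegral_swap
            (Measurable.aemeasurable (by simp only [Function.uncurry_def]; fun_prop))]
          congr 1
          refine lintegral_congr fun Z => ?_
          rw [lintegral_mul_const _ (by fun_prop)]
      _ ≤ c * (ENNReal.ofReal A * ((∫⁻ X, ‖packetTransform ψ X‖ₑ ^ 2) ^ (1 / 2 : ℝ)
            * (∫⁻ Y : Phase d, ‖packetTransform χ (reflect Y)‖ₑ ^ 2) ^ (1 / 2 : ℝ))) := by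
          gcongr
          exact schur_test (k := fun Z => ∫⁻ τ, M (τ, Z) ∂μ) hM.lintegral_prod_left'
            (f := fun X => ‖packetTransform ψ X‖ₑ)
            (g := fun Y => ‖packetTransform χ (reflect Y)‖ₑ) (by fun_prop) (by fun_prop) hrow hcol
      _ ≤ _ := by
          rw [measurePreserving_reflect.lintegral_comp_emb measurableEmbedding_reflect
            (fun Y => ‖packetTransform χ Y‖ₑ ^ 2)]
          gcongr
          · exact hsq ψ
          · exact hsq χ
  rw [← ENNReal.ofReal_toReal hc, ← ENNReal.ofReal_mul (by unfold l2norm; positivity),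
    ← ENNReal.ofReal_mul hA, ← ENNReal.ofReal_mul (by positivity), ← ofReal_norm,
    ENNReal.ofReal_le_ofReal_iff (by unfold l2norm; positivity)] at hmain
  refine hmain.trans (le_of_eq ?_)
  have := Real.mul_self_sqrt hD0
  linear_combination (c.toReal * A * (l2norm ψ * l2norm χ)) * this

end PacketExpansion

/-! ### Families of canonical transformations -/

section Symplectic

variable {d : ℕ}

/-- The symplectic form as a continuous bilinear map. -/
def sympCLM (d : ℕ) : Phase d →L[ℝ] Phase d →L[ℝ] ℝ :=
  (innerSL ℝ).bilinearComp (.snd ℝ _ _) (.fst ℝ _ _)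
    - (innerSL ℝ).bilinearComp (.fst ℝ _ _) (.snd ℝ _ _)

lemma sympCLM_apply (X X' : Phase d) : sympCLM d X X' = sympForm X X' := rfl

lemma sympForm_expand (w : Phase d) :
    w = ∑ j, (sympForm (0, EuclideanSpace.basisFun (Fin d) ℝ j) w
          • ((EuclideanSpace.basisFun (Fin d) ℝ j, 0) : Phase d)
        - sympForm (EuclideanSpace.basisFun (Fin d) ℝ j, 0) w
          • ((0, EuclideanSpace.basisFun (Fin d) ℝ j) : Phase d)) := by
  have h := fun v : Conf d => (EuclideanSpace.basisFun (Fin d) ℝ).sum_repr' v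
  refine Prod.ext ?_ ?_
  · rw [Prod.fst_sum]
    simpa [sympForm] using (h w.1).symm
  · rw [Prod.snd_sum]
    simpa [sympForm] using (h w.2).symm

/-- The symplectic adjoint, which inverts symplectic maps. -/
def sympAdjoint (d : ℕ) : (Phase d →L[ℝ] Phase d) →L[ℝ] (Phase d →L[ℝ] Phase d) :=
  ∑ j, (((ContinuousLinearMap.smulRightL ℝ (Phase d) (Phase d)).flip
          (EuclideanSpace.basisFun (Fin d) ℝ j, 0)).comp ((sympCLM d).comp
          (ContinuousLinearMap.apply ℝ (Phase d) (0, EuclideanSpace.basisFun (Fin d) ℝ j)))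
    - ((ContinuousLinearMap.smulRightL ℝ (Phase d) (Phase d)).flip
          (0, EuclideanSpace.basisFun (Fin d) ℝ j)).comp ((sympCLM d).comp
          (ContinuousLinearMap.apply ℝ (Phase d) (EuclideanSpace.basisFun (Fin d) ℝ j, 0))))

/-- From `σ(A a, u) = σ(a, B u)` the symplectic coordinates of `B u` are read off linearly in `A`.
The inverse of a symplectic map is thus a linear function of it, with no determinant to divide by.
-/
lemma sympAdjoint_eq_of_rightInverse {A B : Phase d →L[ℝ] Phase d}
    (hA : ∀ u v, sympForm (A u) (A v) = sympForm u v) (hAB : ∀ u, A (B u) = u) :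
    sympAdjoint d A = B := by
  refine ContinuousLinearMap.ext fun u => ?_
  have h : ∀ a, sympForm (A a) u = sympForm a (B u) := fun a => by rw [← hA a (B u), hAB]
  conv_rhs => rw [sympForm_expand (B u)]
  simp [sympAdjoint, sympCLM_apply, h, sub_eq_add_neg, Finset.sum_add_distrib, Prod.ext_iff,
    Prod.fst_sum, Prod.snd_sum]

/-- Determinants are taken in `Aᵀ Ω A = Ω`, where `Ω` is invertible by nondegeneracy of the form. -/
lemma abs_det_eq_one_of_symplectic {A : Phase d →L[ℝ] Phase d}
    (hA : ∀ u v, sympForm (A u) (A v) = sympForm u v) : |A.det| = 1 := by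
  classical
  let B : LinearMap.BilinForm ℝ (Phase d) :=
    (ContinuousLinearMap.coeLM ℝ).comp (sympCLM d : Phase d →ₗ[ℝ] Phase d →L[ℝ] ℝ)
  have hB : ∀ u v, B u v = sympForm u v := fun u v => rfl
  let b := Module.finBasis ℝ (Phase d)
  have hnd : B.Nondegenerate := by
    have h0 : ∀ w : Phase d, (∀ u, sympForm u w = 0) → w = 0 := fun w hw => by
      rw [sympForm_expand w]
      simp [hw]
    refine ⟨fun w hw => h0 w fun u => ?_, fun w hw => h0 w fun u => by simpa [hB] using hw u⟩
    have := hw u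
    rw [hB] at this
    simp only [sympForm, real_inner_comm] at this ⊢
    linarith
  have hdet := (LinearMap.BilinForm.nondegenerate_iff_det_ne_zero b).1 hnd
  have hcomp : B.comp (A : Phase d →ₗ[ℝ] Phase d) A = B :=
    LinearMap.ext fun u => LinearMap.ext fun v => hA u v
  have h := LinearMap.BilinForm.toMatrix_comp b b B (A : Phase d →ₗ[ℝ] Phase d) A
  rw [hcomp] at h
  have h2 := congrArg Matrix.det h
  rw [Matrix.det_mul, Matrix.det_mul, Matrix.det_transpose, LinearMap.det_toMatrix] at h2
  have h3 : A.det * A.det = 1 := by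
    have : (A.det * A.det) * (LinearMap.BilinForm.toMatrix b B).det
        = 1 * (LinearMap.BilinForm.toMatrix b B).det := by
      rw [one_mul]
      conv_rhs => rw [h2]
      simp only [ContinuousLinearMap.det]
      ring
    exact mul_right_cancel₀ hdet this
  rw [← abs_mul_abs_self] at h3
  nlinarith [abs_nonneg A.det]

end Symplectic

/-! ### Inverses and volume preservation of canonical transformations -/

section CanonicalFamily

variable {d : ℕ} {ι : Type*}

lemma fderiv_apply_fderiv_symm {φ : Phase d ≃ Phase d} (h1 : Differentiable ℝ φ)
    (h2 : Differentiable ℝ φ.symm) (Z u : Phase d) :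
    fderiv ℝ φ (φ.symm Z) (fderiv ℝ φ.symm Z u) = u := by
  have h := (h1 (φ.symm Z)).hasFDerivAt.comp Z (h2 Z).hasFDerivAt
  have h3 : (φ ∘ φ.symm : Phase d → Phase d) = id := by ext1 z; simp
  rw [h3] at h
  exact DFunLike.congr_fun (h.unique (hasFDerivAt_id Z)) u

/-- The derivative of `φ⁻¹` is the symplectic adjoint of `Dφ ∘ φ⁻¹`. Its derivatives of order `n`
involve only those of `φ⁻¹` of order at most `n`, so the bounds follow by induction. -/
lemma IsCanonical.isSymbol_symm {φ : Phase d ≃ Phase d} (hφ : IsCanonical φ) :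
    IsSymbol 1 φ.symm := by
  have hs : UniformSymbol 1 (fun _ : Unit => (φ : Phase d → Phase d)) := hφ.symbol.uniformSymbol
  have hd : Differentiable ℝ φ.symm := hφ.smooth_symm.differentiable (by simp)
  have key : ∀ Z, fderiv ℝ φ.symm Z = sympAdjoint d (fderiv ℝ φ (φ.symm Z)) := fun Z =>
    (sympAdjoint_eq_of_rightInverse (hφ.symplectic _) 
      (fderiv_apply_fderiv_symm (hφ.symbol.1.differentiable (by simp)) hd Z)).symm
  obtain ⟨C, hC⟩ := hs.2 1 le_rfl
  have hD : UniformSymbol 0 (fun _ : Unit => fderiv ℝ φ) := UniformSymbol.fderiv (m := 0) hs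
  suffices h : ∀ n : ℕ, ∃ C : ℝ, ∀ k, 1 ≤ k → k ≤ n → ∀ Z, ‖iteratedFDeriv ℝ k φ.symm Z‖ ≤ C by
    refine ⟨hφ.smooth_symm, fun k hk => ?_⟩
    obtain ⟨C, hC⟩ := h k
    exact ⟨C, hC k hk le_rfl⟩
  intro n
  induction n with
  | zero => exact ⟨0, fun k h1 h2 => by omega⟩
  | succ n ih =>
    obtain ⟨C, hC⟩ := ih
    choose! D hD' using hD.2
    set E : ℝ := ∑ j ∈ Finset.range (n + 1), |D j|
    have hE : ∀ j ≤ n, ∀ x, ‖iteratedFDeriv ℝ j (fderiv ℝ φ) x‖ ≤ E := fun j hj x =>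
      ((hD' j (Nat.zero_le _) () x).trans (le_abs_self _)).trans
        (Finset.single_le_sum (f := fun j => |D j|) (fun _ _ => abs_nonneg _)
          (Finset.mem_range.2 (by omega)))
    have hE0 : 0 ≤ E := by positivity
    refine ⟨max C (‖sympAdjoint d‖ * (n.factorial * E * (max C 1) ^ n)), fun k h1 h2 Z => ?_⟩
    rcases Nat.lt_or_ge n k with h3 | h3
    · obtain rfl : k = n + 1 := by omega
      refine le_max_of_le_right ?_
      rw [← norm_iteratedFDeriv_fderiv]
      have e : fderiv ℝ φ.symm = sympAdjoint d ∘ fun Z => fderiv ℝ φ (φ.symm Z) := funext key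
      have hc : ContDiff ℝ ∞ (fun Z => fderiv ℝ φ (φ.symm Z)) := (hD.1 ()).comp hφ.smooth_symm
      rw [e]
      refine ((sympAdjoint d).norm_iteratedFDeriv_comp_left hc.contDiffAt
        (mod_cast le_top)).trans ?_
      gcongr
      -- Taking the maximum with `1` keeps the inductive bound below its powers.
      refine norm_iteratedFDeriv_comp_le (n := n) (N := ∞) (hD.1 ()) hφ.smooth_symm (mod_cast le_top) Z
        (fun i hi => hE i hi _) (fun i hi1 hi2 => ?_)
      refine ((hC i hi1 hi2 Z).trans (le_max_left C 1)).trans ?_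
      exact le_self_pow₀ (le_max_right _ _) (by omega)
    · exact le_max_of_le_left (hC k h1 h3 Z)

/-- Families of canonical transformations with uniform symbol bounds. -/
structure IsCanonicalFamily (φ : ι → Phase d ≃ Phase d) : Prop where
  symbol : UniformSymbol 1 (fun i => (φ i : Phase d → Phase d))
  symbol_symm : UniformSymbol 1 (fun i => ((φ i).symm : Phase d → Phase d))
  symplectic : ∀ i z u v, sympForm (fderiv ℝ (φ i) z u) (fderiv ℝ (φ i) z v) = sympForm u v

variable {φ : ι → Phase d ≃ Phase d}

lemma IsCanonicalFamily.symm (h : IsCanonicalFamily φ) :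
    IsCanonicalFamily (fun i => (φ i).symm) where
  symbol := h.symbol_symm
  symbol_symm := h.symbol
  symplectic i z u v := by
    have e := fderiv_apply_fderiv_symm ((h.symbol.1 i).differentiable (by simp))
      ((h.symbol_symm.1 i).differentiable (by simp)) z
    rw [← h.symplectic i ((φ i).symm z), e, e]

lemma IsCanonicalFamily.measurableEmbedding (h : IsCanonicalFamily φ) (i : ι) :
    MeasurableEmbedding (φ i) :=
  Homeomorph.measurableEmbedding
    ⟨φ i, (h.symbol.1 i).continuous, (h.symbol_symm.1 i).continuous⟩

lemma IsCanonicalFamily.measurePreserving (h : IsCanonicalFamily φ) (i : ι) :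
    MeasurePreserving (φ i) (volume : Measure (Phase d)) volume := by
  refine ⟨(h.measurableEmbedding i).measurable, ?_⟩
  have := map_withDensity_abs_det_fderiv_eq_addHaar (volume : Measure (Phase d))
    (s := Set.univ) (f := φ i) (f' := fderiv ℝ (φ i)) MeasurableSet.univ.nullMeasurableSet
    (fun x _ => ((h.symbol.1 i).differentiable (by simp) x).hasFDerivAt.hasFDerivWithinAt)
    (φ i).injective.injOn
  simpa [abs_det_eq_one_of_symplectic (h.symplectic i _)] using this

/-- Pulling `P · dQ - p · dq` back by `φ⁻¹` exchanges the roles of the two terms, which explains the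
sign. -/
lemma IsAction.symm {φ : Phase d ≃ Phase d} (h1 : Differentiable ℝ φ)
    (h2 : Differentiable ℝ φ.symm) {S : Phase d → ℝ} (hS : IsAction φ S) :
    IsAction φ.symm (fun Z => -S (φ.symm Z)) := by
  refine ⟨(hS.1.comp h2).neg, fun Z u => ?_⟩
  have h := ((hS.1 (φ.symm Z)).hasFDerivAt.comp Z (h2 Z).hasFDerivAt).neg
  have h' : HasFDerivAt (fun Z => -S (φ.symm Z)) _ Z := h
  rw [h'.fderiv]
  simp only [neg_apply, ContinuousLinearMap.comp_apply]
  rw [hS.2, fderiv_apply_fderiv_symm h1 h2, Equiv.apply_symm_apply]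
  ring

end CanonicalFamily

/-! ### Superpositions of kernels concentrated on the graph of a canonical transformation -/

section Graph

open scoped ENNReal

variable {d : ℕ} {ι : Type*} {φ : ι → Phase d ≃ Phase d}

lemma lintegral_graph_weight (E : Type*) [NormedAddCommGroup E] [NormedSpace ℝ E]
    [FiniteDimensional ℝ E] [MeasureSpace E] [BorelSpace E]
    [(volume : Measure E).IsAddHaarMeasure] {n : ℕ} (hn : Module.finrank ℝ E < n) (x : E) :
    ∫⁻ y : E, ENNReal.ofReal ((1 + ‖y - x‖) ^ n)⁻¹
      = ENNReal.ofReal (∫ y : E, ((1 + ‖y‖) ^ n)⁻¹) := by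
  rw [lintegral_sub_right_eq_self (fun y : E => ENNReal.ofReal ((1 + ‖y‖) ^ n)⁻¹) x,
    ← ofReal_integral_eq_lintegral_ofReal (integrable_one_add_norm_inv E hn)
      (.of_forall fun y => by positivity)]

/-- Row integrals are translates of a fixed integral in dimension `2d`. For the columns, the
Lipschitz bound for `φ⁻¹` replaces `|Y - φ(X)|` by `|X - φ⁻¹(Y)|`. -/
lemma IsCanonicalFamily.lintegral_weight (h : IsCanonicalFamily φ) : ∃ A : ℝ, 0 ≤ A ∧
    (∀ i X, ∫⁻ Y : Phase d, ENNReal.ofReal ((1 + ‖Y - φ i X‖) ^ (2 * d + 1))⁻¹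
      ≤ ENNReal.ofReal A) ∧
    ∀ i Y, ∫⁻ X : Phase d, ENNReal.ofReal ((1 + ‖Y - φ i X‖) ^ (2 * d + 1))⁻¹
      ≤ ENNReal.ofReal A := by
  obtain ⟨K, hK1, hK⟩ := h.symbol_symm.lipschitz
  have hn : Module.finrank ℝ (Phase d) < 2 * d + 1 := by simp; omega
  have hI0 : 0 ≤ ∫ y : Phase d, ((1 + ‖y‖) ^ (2 * d + 1))⁻¹ :=
    integral_nonneg fun y => by positivity
  have hKn : 1 ≤ K ^ (2 * d + 1) := one_le_pow₀ hK1
  refine ⟨K ^ (2 * d + 1) * ∫ y : Phase d, ((1 + ‖y‖) ^ (2 * d + 1))⁻¹, by positivity,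
    fun i X => ?_, fun i Y => ?_⟩
  · rw [lintegral_graph_weight _ hn]
    exact ENNReal.ofReal_le_ofReal (le_mul_of_one_le_left hI0 hKn)
  · have hle : ∀ X, ((1 + ‖Y - φ i X‖) ^ (2 * d + 1))⁻¹
        ≤ K ^ (2 * d + 1) * ((1 + ‖X - (φ i).symm Y‖) ^ (2 * d + 1))⁻¹ := fun X => by
      have h1 := hK i (φ i X) Y
      simp only [Equiv.symm_apply_apply] at h1
      rw [norm_sub_rev (φ i X)] at h1
      have h2 : 1 + ‖X - (φ i).symm Y‖ ≤ K * (1 + ‖Y - φ i X‖) := by linarith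
      rw [← div_eq_mul_inv, ← one_div, div_le_div_iff₀ (by positivity) (by positivity), one_mul,
        ← mul_pow]
      gcongr
    calc _ ≤ ∫⁻ X : Phase d, ENNReal.ofReal (K ^ (2 * d + 1))
          * ENNReal.ofReal ((1 + ‖X - (φ i).symm Y‖) ^ (2 * d + 1))⁻¹ := by
          refine lintegral_mono fun X => ?_
          rw [← ENNReal.ofReal_mul (by positivity)]
          exact ENNReal.ofReal_le_ofReal (hle X)
      _ = _ := by
          rw [lintegral_const_mul' _ _ ENNReal.ofReal_ne_top, lintegral_graph_weight _ hn,
            ENNReal.ofReal_mul (by positivity)]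

/-- The kernels `k i τ` have matrix elements between wave packets which are concentrated on the
graph of `φ i`, with bounds whose integrals in `τ` are uniform. -/
structure HasGraphDecay {T : Type} [MeasurableSpace T] (μ : Measure T)
    (φ : ι → Phase d ≃ Phase d) (k : ι → T → Conf d × Conf d → ℂ) : Prop where
  measurable : ∀ i τ, Measurable (k i τ)
  bounded : ∃ B : ℝ, ∀ i τ v, ‖k i τ v‖ ≤ B
  decay : ∀ N : ℕ, ∃ m : T × (Phase d × Phase d) → ℝ, Measurable m ∧ (∀ t, 0 ≤ m t) ∧
    (∃ A : ℝ, 0 ≤ A ∧ ∀ X Y, ∫⁻ τ, ENNReal.ofReal (m (τ, X, Y)) ∂μ ≤ ENNReal.ofReal A) ∧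
    ∀ i τ X Y, ‖packetElement (k i τ) (X, Y)‖ ≤ m (τ, X, Y) * ((1 + ‖Y - φ i X‖) ^ N)⁻¹

variable {T : Type} [MeasurableSpace T] {μ : Measure T} {k : ι → T → Conf d × Conf d → ℂ}

theorem HasGraphDecay.packetElement_decay (hk : HasGraphDecay μ φ k) (N : ℕ) : ∃ C : ℝ, 0 ≤ C ∧
    ∀ i X Y, ‖∫ τ, packetElement (k i τ) (X, Y) ∂μ‖ ≤ C * ((1 + ‖Y - φ i X‖) ^ N)⁻¹ := by
  obtain ⟨m, hm, hm0, ⟨A, hA0, hA⟩, hkm⟩ := hk.decay N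
  refine ⟨A, hA0, fun i X Y => ?_⟩
  rw [← ENNReal.ofReal_le_ofReal_iff (by positivity), ofReal_norm]
  refine (enorm_integral_le_lintegral_enorm _).trans ?_
  calc _ ≤ ∫⁻ τ, ENNReal.ofReal (m (τ, X, Y))
        * ENNReal.ofReal ((1 + ‖Y - φ i X‖) ^ N)⁻¹ ∂μ := by
        refine lintegral_mono fun τ => ?_
        rw [← ofReal_norm, ← ENNReal.ofReal_mul (hm0 _)]
        exact ENNReal.ofReal_le_ofReal (hkm i τ X Y)
    _ ≤ _ := by
        rw [lintegral_mul_const' _ _ ENNReal.ofReal_ne_top, ENNReal.ofReal_mul hA0]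
        gcongr
        exact hA X Y

/-- Schur's test with the power `2d + 1`, which is integrable on phase space in either variable. -/
theorem HasGraphDecay.l2_bound [SFinite μ] (hφ : IsCanonicalFamily φ)
    (hk : HasGraphDecay μ φ k) : ∃ C : ℝ, 0 ≤ C ∧ ∀ i (ψ χ : 𝓢(Conf d, ℂ)),
      ‖∫ τ, (∫ v : Conf d × Conf d, k i τ v * (ψ v.1 * χ v.2)) ∂μ‖
        ≤ C * (l2norm ψ * l2norm χ) := by
  obtain ⟨c, hc0, hc⟩ := packet_schur d
  obtain ⟨A, hA0, hA1, hA2⟩ := hφ.lintegral_weight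
  obtain ⟨B, hB⟩ := hk.bounded
  obtain ⟨m, hm, hm0, ⟨D, hD0, hD⟩, hkm⟩ := hk.decay (2 * d + 1)
  refine ⟨c * (D * A), by positivity, fun i ψ χ => ?_⟩
  have hφc : Continuous (φ i) := (hφ.symbol.1 i).continuous
  have hw : ∀ X Y, ∫⁻ τ, ENNReal.ofReal (m (τ, X, Y))
        * ENNReal.ofReal ((1 + ‖Y - φ i X‖) ^ (2 * d + 1))⁻¹ ∂μ
      ≤ ENNReal.ofReal D * ENNReal.ofReal ((1 + ‖Y - φ i X‖) ^ (2 * d + 1))⁻¹ := fun X Y => by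
    rw [lintegral_mul_const' _ _ ENNReal.ofReal_ne_top]
    gcongr
    exact hD X Y
  refine hc μ (k i) (hk.measurable i) B (hB i) (fun t => ENNReal.ofReal (m t)
      * ENNReal.ofReal ((1 + ‖t.2.2 - φ i t.2.1‖) ^ (2 * d + 1))⁻¹) ?_ (fun τ Z => ?_) (D * A)
    (by positivity) (fun X => ?_) (fun Y => ?_) ψ χ
  · exact hm.ennreal_ofReal.mul (Measurable.ennreal_ofReal (by fun_prop))
  · rw [← ofReal_norm, ← ENNReal.ofReal_mul (hm0 _)]
    exact ENNReal.ofReal_le_ofReal (hkm i τ Z.1 Z.2)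
  · refine (lintegral_mono fun Y => hw X Y).trans ?_
    rw [lintegral_const_mul' _ _ ENNReal.ofReal_ne_top, ENNReal.ofReal_mul hD0]
    gcongr
    exact hA1 i X
  · refine (lintegral_mono fun X => hw X Y).trans ?_
    rw [lintegral_const_mul' _ _ ENNReal.ofReal_ne_top, ENNReal.ofReal_mul hD0]
    gcongr
    exact hA2 i Y

end Graph

/-! ### Operators defined by iterated integrals -/

section GraphKernel

variable {d : ℕ} {ι : Type*} {T : Type} [MeasurableSpace T]

/-- Kernels concentrated on the graph of `φ i` which define an operator on Schwartz functions by
integrating first in `y` and then in the parameter `τ`. -/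
structure IsGraphKernel (μ : Measure T) (φ : ι → Phase d ≃ Phase d)
    (k : ι → T → Conf d × Conf d → ℂ) : Prop extends HasGraphDecay μ φ k where
  measurable_uncurry : ∀ i, Measurable (fun t : T × (Conf d × Conf d) => k i t.1 t.2)
  integrable : ∀ i (ψ : 𝓢(Conf d, ℂ)) x, Integrable (fun τ => ∫ y, k i τ (y, x) * ψ y) μ
  integral_le : ∀ i (ψ : 𝓢(Conf d, ℂ)), ∃ C : ℝ, ∀ x, ∫ τ, ‖∫ y, k i τ (y, x) * ψ y‖ ∂μ ≤ C

variable {μ : Measure T} {φ : ι → Phase d ≃ Phase d} {k : ι → T → Conf d × Conf d → ℂ}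

lemma IsGraphKernel.integrable_fst (hk : IsGraphKernel μ φ k) (i : ι) (τ : T) (x : Conf d)
    (ψ : 𝓢(Conf d, ℂ)) : Integrable (fun y => k i τ (y, x) * ψ y) := by
  obtain ⟨B, hB⟩ := hk.bounded
  exact ψ.integrable.bdd_mul ((hk.measurable i τ).comp
    measurable_prodMk_right).aestronglyMeasurable (c := B) (.of_forall fun y => hB i τ _)

lemma IsGraphKernel.integrable_prod [SFinite μ] (hk : IsGraphKernel μ φ k) (i : ι)
    (ψ χ : 𝓢(Conf d, ℂ)) : Integrable (fun t : Conf d × T =>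
      χ t.1 * ∫ y, k i t.2 (y, t.1) * ψ y) (volume.prod μ) := by
  have hm : StronglyMeasurable (fun t : Conf d × T => χ t.1 * ∫ y, k i t.2 (y, t.1) * ψ y) := by
    refine (χ.continuous.comp_stronglyMeasurable measurable_fst.stronglyMeasurable).mul ?_
    refine StronglyMeasurable.integral_prod_right'
      (f := fun r : (Conf d × T) × Conf d => k i r.1.2 (r.2, r.1.1) * ψ r.2) ?_
    exact (((hk.measurable_uncurry i).comp (by fun_prop :
      Measurable fun r : (Conf d × T) × Conf d => (r.1.2, (r.2, r.1.1)))).mul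
      (ψ.continuous.measurable.comp measurable_snd)).stronglyMeasurable
  obtain ⟨C, hC⟩ := hk.integral_le i ψ
  rw [integrable_prod_iff hm.aestronglyMeasurable]
  refine ⟨.of_forall fun x => (hk.integrable i ψ x).const_mul (χ x),
    (χ.integrable.norm.mul_const C).mono' hm.norm.integral_prod_right'.aestronglyMeasurable
      (.of_forall fun x => ?_)⟩
  simp only [norm_mul]
  rw [integral_const_mul, norm_mul, norm_norm,
    Real.norm_of_nonneg (integral_nonneg fun _ => norm_nonneg _)]
  gcongr
  exact hC x

lemma IsGraphKernel.integrable_pairing [SFinite μ] (hk : IsGraphKernel μ φ k) (i : ι) (ψ χ : 𝓢(Conf d, ℂ)) :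
    Integrable (fun x => χ x * ∫ τ, (∫ y, k i τ (y, x) * ψ y) ∂μ) :=
  (hk.integrable_prod i ψ χ).integral_prod_left.congr
    (.of_forall fun x => integral_const_mul (χ x) _)

/-- The interchange is justified in two stages: `x` with `τ` after the integration in `y`, then `x`
with `y` at fixed `τ`. Absolute convergence in all variables at once is not claimed. -/
lemma IsGraphKernel.pairing_eq [SFinite μ] (hk : IsGraphKernel μ φ k) (i : ι) (ψ χ : 𝓢(Conf d, ℂ)) :
    ∫ x, χ x * ∫ τ, (∫ y, k i τ (y, x) * ψ y) ∂μ
      = ∫ τ, (∫ v : Conf d × Conf d, k i τ v * (ψ v.1 * χ v.2)) ∂μ := by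
  obtain ⟨B, hB⟩ := hk.bounded
  have h1 : ∀ x, χ x * ∫ τ, (∫ y, k i τ (y, x) * ψ y) ∂μ
      = ∫ τ, (χ x * ∫ y, k i τ (y, x) * ψ y) ∂μ := fun x => (integral_const_mul _ _).symm
  simp only [h1]
  rw [integral_integral_swap (f := fun x τ => χ x * ∫ y, k i τ (y, x) * ψ y)
    (hk.integrable_prod i ψ χ)]
  refine integral_congr_ae (.of_forall fun τ => ?_)
  have hi : Integrable (fun v : Conf d × Conf d => k i τ v * (ψ v.1 * χ v.2)) :=
    (ψ.integrable.mul_prod χ.integrable).bdd_mul (hk.measurable i τ).aestronglyMeasurable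
      (c := B) (.of_forall fun v => hB i τ v)
  simp only []
  rw [show (volume : Measure (Conf d × Conf d)) = volume.prod volume from rfl] at hi ⊢
  rw [integral_prod_symm _ hi]
  refine integral_congr_ae (.of_forall fun x => ?_)
  simp only []
  rw [← integral_const_mul]
  refine integral_congr_ae (.of_forall fun y => ?_)
  simp only []
  ring

end GraphKernel

/-! ### Restriction of canonical transformations to a fixed frequency -/

section SlicedFamily

variable {d : ℕ} {ι : Type*} {φ : ι → Phase d ≃ Phase d} {S : ι → Phase d → ℝ}
  {Θ : ι → Phase d → Matrix (Fin d) (Fin d) ℂ} {c : ℝ}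

lemma uniformSymbol_slice (p : ι → Conf d) :
    UniformSymbol 1 (fun i (y : Conf d) => ((y, p i) : Phase d)) := by
  simpa using uniformSymbol_affine (ContinuousLinearMap.inl ℝ (Conf d) (Conf d))
    (fun i => ((0, p i) : Phase d))

/-- On a slice of constant `p`, the one-form `P · dQ - p · dq` restricts to what a phase family
requires. The frequency joins the index, so all later constants are uniform in it. -/
lemma IsCanonicalFamily.isPhaseFamily (hφ : IsCanonicalFamily φ)
    (hS : ∀ i, IsAction (φ i) (S i)) (hΘ : ∀ k l, UniformSymbol 0 (fun i z => Θ i z k l))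
    (hc : 0 < c) (hlow : ∀ i z v, c * ‖v‖ ^ 2 ≤ (quadForm (Θ i z) v).im) :
    IsPhaseFamily (fun j : ι × Conf d => fun y => S j.1 (y, j.2))
      (fun j y => (φ j.1 (y, j.2)).1) (fun j y => (φ j.1 (y, j.2)).2) (fun j => j.2)
      (fun j y => Θ j.1 (y, j.2)) c := by
  have hs : UniformSymbol 1 (fun (j : ι × Conf d) (y : Conf d) => φ j.1 (y, j.2)) :=
    (hφ.symbol.reindex Prod.fst).comp_one (uniformSymbol_slice Prod.snd)
  have hsl : ∀ (j : ι × Conf d) y, HasFDerivAt (fun y : Conf d => ((y, j.2) : Phase d))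
      (ContinuousLinearMap.inl ℝ (Conf d) (Conf d)) y := fun j y =>
    (hasFDerivAt_prodMk_left y j.2)
  refine ⟨hs.clm (ContinuousLinearMap.fst ℝ _ _), hs.clm (ContinuousLinearMap.snd ℝ _ _),
    fun k l => ((hΘ k l).reindex Prod.fst).comp (uniformSymbol_slice Prod.snd), hc,
    fun j y v => hlow _ _ _, fun j => ?_, fun j y v => ?_⟩
  · exact (hS j.1).1.comp fun y => (hsl j y).differentiableAt
  · have h1 := ((hS j.1).1 (y, j.2)).hasFDerivAt.comp y (hsl j y)
    have h2 := (((hφ.symbol.1 j.1).differentiable (by simp) (y, j.2)).hasFDerivAt.comp y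
      (hsl j y)).fst
    have h1' : HasFDerivAt (fun y => S j.1 (y, j.2)) _ y := h1
    have h2' : HasFDerivAt (fun y => (φ j.1 (y, j.2)).1) _ y := h2
    rw [h1'.fderiv, h2'.fderiv]
    simp [(hS j.1).2]

end SlicedFamily

/-! ### Operators with `d` frequency variables -/

section OperatorJ

variable {d : ℕ} {ι : Type*} {φ : ι → Phase d ≃ Phase d} {S : ι → Phase d → ℝ}
  {Θ : ι → Phase d → Matrix (Fin d) (Fin d) ℂ} {u : ι → Conf d × Conf d × Conf d → ℂ} {c : ℝ}

/-- The Schwartz kernel, at a frozen frequency, of an operator with `d` frequency variables. -/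
def kernelJ (φ : Phase d → Phase d) (S : Phase d → ℝ) (Θ : Phase d → Matrix (Fin d) (Fin d) ℂ)
    (u : Conf d × Conf d × Conf d → ℂ) (p : Conf d) (v : Conf d × Conf d) : ℂ :=
  Complex.exp (Complex.I * phaseJ φ S Θ p v.2 v.1) * u (v.2, v.1, p)

lemma uniformSymbol_swap_slice (p : ι → Conf d) :
    UniformSymbol 1 (fun i (v : Conf d × Conf d) => ((v.2, v.1, p i) : Conf d × Conf d × Conf d)) :=
  by
  simpa using uniformSymbol_affine ((ContinuousLinearMap.snd ℝ (Conf d) (Conf d)).prod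
    ((ContinuousLinearMap.fst ℝ (Conf d) (Conf d)).prod 0))
    (fun i => ((0, 0, p i) : Conf d × Conf d × Conf d))

/-- The frequency `p` is the parameter. Packet decay localises it near that of the incoming packet,
which makes the matrix elements integrable in `p` and keeps `φ(q₁, p)` near `φ(X)`. -/
theorem isGraphKernel_J (hφ : IsCanonicalFamily φ)
    (hS : ∀ i, IsAction (φ i) (S i)) (hΘ : ∀ k l, UniformSymbol 0 (fun i z => Θ i z k l))
    (hc : 0 < c) (hlow : ∀ i z v, c * ‖v‖ ^ 2 ≤ (quadForm (Θ i z) v).im)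
    (hu : UniformSymbol 0 u) :
    IsGraphKernel volume φ (fun i => kernelJ (φ i) (S i) (Θ i) (u i)) := by
  have hF := hφ.isPhaseFamily hS hΘ hc hlow
  have hb : UniformSymbol 0 (fun (j : ι × Conf d) (v : Conf d × Conf d) =>
      u j.1 (v.2, v.1, j.2)) :=
    (hu.reindex Prod.fst).comp (uniformSymbol_swap_slice Prod.snd)
  have hcont : ∀ i, Continuous (fun t : Conf d × (Conf d × Conf d) =>
      kernelJ (φ i) (S i) (Θ i) (u i) t.1 t.2) := fun i => by
    have h1 := (hφ.symbol.1 i).continuous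
    have h2 := (hS i).1.continuous
    have h3 := fun k l => ((hΘ k l).1 i).continuous
    have h4 := (hu.1 i).continuous
    unfold kernelJ phaseJ quadForm
    fun_prop
  obtain ⟨B, hB0, hB⟩ := hu.bound
  refine ⟨⟨fun i τ => ((hcont i).comp (by fun_prop :
    Continuous fun v : Conf d × Conf d => (τ, v))).measurable, ⟨B, fun i p v => ?_⟩, fun N => ?_⟩,
    fun i => (hcont i).measurable, fun i ψ => ?_, fun i ψ => ?_⟩
  · have h1 : (Complex.I * phaseJ (φ i) (S i) (Θ i) p v.2 v.1).re ≤ 0 :=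
      (hF.re_phase (i, p) v.1 v.2).trans (by have := hF.pos; simp; positivity)
    rw [kernelJ, norm_mul, Complex.norm_exp]
    exact (mul_le_of_le_one_left (norm_nonneg _) (Real.exp_le_one_iff.2 h1)).trans (hB i _)
  · obtain ⟨K, hK1, hK⟩ := hφ.symbol.lipschitz
    -- The power `d + 1` is spent on integrability in `p`, the power `N` on the distance to the
    -- graph.
    obtain ⟨C, hC0, hC⟩ := (hF.reindex (κ := (ι × Conf d) × (Phase d × Phase d))
      Prod.fst).packet_decay (hb.reindex Prod.fst) (fun j => j.2.1.1) (fun j => j.2.1.2)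
      (fun j => j.2.2.1) (fun j => j.2.2.2) ((d + 1) + N)
    have hn : Module.finrank ℝ (Conf d) < d + 1 := by simp
    refine ⟨fun t => C * K ^ N * ((1 + ‖t.1 - t.2.1.2‖) ^ (d + 1))⁻¹, by fun_prop,
      fun t => by positivity, ⟨C * K ^ N * ∫ y : Conf d, ((1 + ‖y‖) ^ (d + 1))⁻¹, ?_,
        fun X Y => ?_⟩, fun i p X Y => ?_⟩
    · have : 0 ≤ ∫ y : Conf d, ((1 + ‖y‖) ^ (d + 1))⁻¹ :=
        integral_nonneg fun y => by positivity
      positivity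
    · have h0 : 0 ≤ C * K ^ N := by positivity
      simp only [ENNReal.ofReal_mul h0]
      rw [lintegral_const_mul' _ _ ENNReal.ofReal_ne_top, lintegral_graph_weight _ hn]
    · have h1 := hC ((i, p), (X, Y))
      simp only [] at h1
      set a := ‖p - X.2‖
      set W := 1 + a + ‖(φ i (X.1, p)).2 - Y.2‖ + ‖(φ i (X.1, p)).1 - Y.1‖
      have hW0 : 0 < W := by positivity
      have h2 : 1 + a ≤ W := by
        simp only [W]
        linarith [norm_nonneg ((φ i (X.1, p)).2 - Y.2), norm_nonneg ((φ i (X.1, p)).1 - Y.1)]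
      -- The path from `Y` to `φ(X)` passes through `φ(q₁, p)`; its second part is at most `K` times
      -- `|p - p₁|`.
      have h3 : 1 + ‖Y - φ i X‖ ≤ K * W := by
        have e1 : ‖Y - φ i X‖ ≤ ‖Y - φ i (X.1, p)‖ + ‖φ i (X.1, p) - φ i X‖ :=
          norm_sub_le_norm_sub_add_norm_sub _ _ _
        have e2 : ‖φ i (X.1, p) - φ i X‖ ≤ K * a := by
          refine (hK i _ _).trans_eq ?_
          simp [Prod.norm_def, a]
        have e3 : ‖Y - φ i (X.1, p)‖ ≤ ‖(φ i (X.1, p)).2 - Y.2‖ + ‖(φ i (X.1, p)).1 - Y.1‖ := by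
          rw [Prod.norm_def, Prod.fst_sub, Prod.snd_sub, norm_sub_rev Y.1, norm_sub_rev Y.2]
          exact max_le (le_add_of_nonneg_left (norm_nonneg _))
            (le_add_of_nonneg_right (norm_nonneg _))
        simp only [W]
        nlinarith [norm_nonneg ((φ i (X.1, p)).2 - Y.2), norm_nonneg ((φ i (X.1, p)).1 - Y.1)]
      have h4 : ‖packetElement (kernelJ (φ i) (S i) (Θ i) (u i) p) (X, Y)‖
          ≤ C * (W ^ (d + 1 + N))⁻¹ := by
        rw [← div_eq_mul_inv, le_div_iff₀ (by positivity), mul_comm]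
        exact h1
      refine h4.trans ?_
      have h5 : (W ^ (d + 1 + N))⁻¹
          ≤ ((1 + a) ^ (d + 1))⁻¹ * (K ^ N * ((1 + ‖Y - φ i X‖) ^ N)⁻¹) := by
        rw [pow_add, mul_inv]
        gcongr
        rw [← div_eq_mul_inv, ← one_div, div_le_div_iff₀ (by positivity) (by positivity), one_mul,
          ← mul_pow]
        gcongr
      calc _ ≤ C * _ := mul_le_mul_of_nonneg_left h5 hC0
        _ = _ := by ring
  -- Both remaining conditions follow from the decay in `p` of the integral over `y`, uniform in
  -- `x`.
  all_goals
    obtain ⟨C, hC⟩ := (hF.reindex (κ := (ι × Conf d) × Conf d) Prod.fst).schwartz_decay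
      (hb.reindex Prod.fst) Prod.snd ψ (d + 1)
    have hI := integrable_one_add_norm_inv (Conf d) (n := d + 1) (by simp)
    have hle : ∀ x p, ‖∫ y, kernelJ (φ i) (S i) (Θ i) (u i) p (y, x) * ψ y‖
        ≤ C * ((1 + ‖p‖) ^ (d + 1))⁻¹ := fun x p => by
      rw [← div_eq_mul_inv, le_div_iff₀ (by positivity), mul_comm]
      exact hC ((i, p), x)
    have hint : ∀ x, Integrable (fun p => ∫ y, kernelJ (φ i) (S i) (Θ i) (u i) p (y, x) * ψ y) :=
      fun x => by
        refine (hI.const_mul C).mono' (StronglyMeasurable.integral_prod_right'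
          (f := fun r : Conf d × Conf d => kernelJ (φ i) (S i) (Θ i) (u i) r.1 (r.2, x) * ψ r.2)
          ?_).aestronglyMeasurable (.of_forall fun p => hle x p)
        exact (((hcont i).comp (by fun_prop :
          Continuous fun r : Conf d × Conf d => (r.1, (r.2, x)))).mul
          (ψ.continuous.comp continuous_snd)).stronglyMeasurable
  · exact hint
  · exact ⟨∫ p : Conf d, C * ((1 + ‖p‖) ^ (d + 1))⁻¹,
      fun x => integral_mono (hint x).norm (hI.const_mul C) (hle x)⟩

end OperatorJ

/-! ### Operators with `2d` frequency variables -/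

section OperatorI

variable {d : ℕ} {ι : Type*} {φ : ι → Phase d ≃ Phase d} {S : ι → Phase d → ℝ}
  {Θ : ι → Phase d → Matrix (Fin d) (Fin d) ℂ} {Γ : Matrix (Fin d) (Fin d) ℂ}
  {a : ι → Conf d × Phase d → ℂ} {c : ℝ}

/-- This isolates the dependence on `y`: the inner integral is a windowed Fourier transform of `ψ`
times a factor independent of `y`, of modulus at most one when `Im Θ` is nonnegative. -/
lemma exp_phaseI (φ : Phase d → Phase d) (S : Phase d → ℝ)
    (Θ : Phase d → Matrix (Fin d) (Fin d) ℂ) (Γ : Matrix (Fin d) (Fin d) ℂ)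
    (z : Phase d) (x y : Conf d) : Complex.exp (Complex.I * phaseI φ S Θ Γ z x y)
      = Complex.exp (Complex.I
          * (((S z + inner ℝ (φ z).2 (x - (φ z).1) + inner ℝ z.2 z.1 : ℝ) : ℂ)
            + 1 / 2 * quadForm (Θ z) (x - (φ z).1)))
        * (Complex.exp (-(Complex.I * ((inner ℝ z.2 y : ℝ) : ℂ))) * window Γ (y - z.1)) := by
  rw [window, ← Complex.exp_add, ← Complex.exp_add, phaseI, inner_sub_right z.2]
  congr 1
  push_cast
  ring

lemma norm_exp_quad (r : ℝ) (q : ℂ) :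
    ‖Complex.exp (Complex.I * ((r : ℂ) + 1 / 2 * q))‖ = Real.exp (-(1 / 2 * q.im)) := by
  rw [Complex.norm_exp]
  congr 1
  simp only [Complex.mul_re, Complex.I_re, zero_mul, Complex.I_im, one_mul, Complex.add_im,
    Complex.ofReal_im, Complex.mul_im]
  norm_num

lemma norm_exp_phaseI_le {φ : Phase d → Phase d} {S : Phase d → ℝ}
    {Θ : Phase d → Matrix (Fin d) (Fin d) ℂ} {Γ : Matrix (Fin d) (Fin d) ℂ} (hc : 0 < c)
    (hlow : ∀ z v, c * ‖v‖ ^ 2 ≤ (quadForm (Θ z) v).im) (hΓ : Γ ∈ siegel d) (z : Phase d)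
    (x y : Conf d) : ‖Complex.exp (Complex.I * phaseI φ S Θ Γ z x y)‖ ≤ 1 := by
  have h1 : 0 ≤ (quadForm (Θ z) (x - (φ z).1)).im := le_trans (by positivity) (hlow z _)
  have h2 : ‖Complex.exp (-(Complex.I * ((inner ℝ z.2 y : ℝ) : ℂ)))‖ = 1 := by
    rw [Complex.norm_exp]
    simp
  rw [exp_phaseI, norm_mul, norm_exp_quad, norm_mul, h2, one_mul]
  exact mul_le_one₀ (Real.exp_le_one_iff.2 (by linarith)) (norm_nonneg _)
    (norm_window_le_one hΓ _)

/-- The inner integral of the operator with `2d` frequency variables, for `ħ = 1`. -/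
def innerI (φ : Phase d → Phase d) (S : Phase d → ℝ)
    (Θ : Phase d → Matrix (Fin d) (Fin d) ℂ) (Γ : Matrix (Fin d) (Fin d) ℂ)
    (a : Conf d × Phase d → ℂ) (ψ : 𝓢(Conf d, ℂ)) (x : Conf d) (z : Phase d) : ℂ :=
  ∫ y, Complex.exp (Complex.I * phaseI φ S Θ Γ z x y) * a (x, z) * ψ y

lemma norm_innerI_le {φ : Phase d → Phase d} {S : Phase d → ℝ}
    {Θ : Phase d → Matrix (Fin d) (Fin d) ℂ} {a : Conf d × Phase d → ℂ} (hc : 0 < c)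
    (hlow : ∀ z v, c * ‖v‖ ^ 2 ≤ (quadForm (Θ z) v).im) {A : ℝ} (hA : ∀ t, ‖a t‖ ≤ A)
    (ψ : 𝓢(Conf d, ℂ)) (x : Conf d) (z : Phase d) :
    ‖innerI φ S Θ Γ a ψ x z‖ ≤ A * ‖windowedFourier Γ ψ z‖ := by
  have h1 : 0 ≤ (quadForm (Θ z) (x - (φ z).1)).im := le_trans (by positivity) (hlow z _)
  have e : innerI φ S Θ Γ a ψ x z = a (x, z) * (Complex.exp (Complex.I
          * (((S z + inner ℝ (φ z).2 (x - (φ z).1) + inner ℝ z.2 z.1 : ℝ) : ℂ)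
            + 1 / 2 * quadForm (Θ z) (x - (φ z).1))) * windowedFourier Γ ψ z) := by
    rw [innerI, windowedFourier, ← integral_const_mul, ← integral_const_mul]
    refine integral_congr_ae (.of_forall fun y => ?_)
    simp only [exp_phaseI]
    ring
  rw [e, norm_mul, norm_mul, norm_exp_quad]
  have hA0 : 0 ≤ A := (norm_nonneg _).trans (hA (x, z))
  gcongr
  · exact hA _
  · exact mul_le_of_le_one_left (norm_nonneg _) (Real.exp_le_one_iff.2 (by linarith))

lemma continuous_phaseI {φ : Phase d → Phase d} (hφ : Continuous φ) {S : Phase d → ℝ}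
    (hS : Continuous S) {Θ : Phase d → Matrix (Fin d) (Fin d) ℂ}
    (hΘ : ∀ k l, Continuous fun z => Θ z k l) (Γ : Matrix (Fin d) (Fin d) ℂ) :
    Continuous (fun t : Phase d × Conf d × Conf d => phaseI φ S Θ Γ t.1 t.2.1 t.2.2) := by
  unfold phaseI quadForm
  fun_prop

/-- The Schwartz kernel of an operator with `2d` frequency variables, at the frequency `z` such that
`φ z = (x - w, P)`. -/
def kernelI (φ : Phase d ≃ Phase d) (S : Phase d → ℝ) (Θ : Phase d → Matrix (Fin d) (Fin d) ℂ)
    (Γ : Matrix (Fin d) (Fin d) ℂ) (a : Conf d × Phase d → ℂ) (τ : Phase d)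
    (v : Conf d × Conf d) : ℂ :=
  Complex.exp (Complex.I * phaseI φ S Θ Γ (φ.symm (v.2 - τ.1, τ.2)) v.2 v.1)
    * a (v.2, φ.symm (v.2 - τ.1, τ.2))

/-- The amplitude of the conjugate of `kernelI`, after translation of `x` by `w`. -/
def conjAmplitude (φ : Phase d ≃ Phase d) (Θ : Phase d → Matrix (Fin d) (Fin d) ℂ)
    (a : Conf d × Phase d → ℂ) (τ : Phase d) (v : Conf d × Conf d) : ℂ :=
  Complex.exp (-(Complex.I / 2) * conj (quadForm (Θ (φ.symm (v.1, τ.2))) τ.1))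
    * conj (a (v.1 + τ.1, φ.symm (v.1, τ.2)))

/-- After `x` is translated by `w`, the frequency `z = φ⁻¹(x, P)` no longer depends on `w`.
Conjugation turns `-S - p · (q - y)` and `-Γ̄` into a frozen phase of `φ⁻¹` with action `-S ∘ φ⁻¹`,
frequency `P` and matrix `Γ`, at which `x` and `y` have exchanged roles. The term in `Θ` becomes
part of the amplitude. -/
lemma conj_kernelI (φ : Phase d ≃ Phase d) (S : Phase d → ℝ)
    (Θ : Phase d → Matrix (Fin d) (Fin d) ℂ) (Γ : Matrix (Fin d) (Fin d) ℂ)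
    (a : Conf d × Phase d → ℂ) (τ : Phase d) (x y : Conf d) :
    conj (kernelI φ S Θ Γ a τ (y, x + τ.1))
      = Complex.exp (-(Complex.I * ((inner ℝ τ.2 τ.1 : ℝ) : ℂ)))
        * (Complex.exp (Complex.I * frozenPhase (fun y => -S (φ.symm (y, τ.2)))
          (fun y => (φ.symm (y, τ.2)).1) (fun y => (φ.symm (y, τ.2)).2) (fun _ => Γ) x y)
          * conjAmplitude φ Θ a τ (x, y)) := by
  simp only [kernelI, conjAmplitude, frozenPhase, phaseI, map_mul, ← Complex.exp_conj,
    add_sub_cancel_right, Equiv.apply_symm_apply, add_sub_cancel_left, quadForm_conj]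
  rw [← mul_assoc, ← mul_assoc, ← Complex.exp_add, ← Complex.exp_add]
  congr 2
  simp only [map_add, map_mul, map_sub, Complex.conj_I, Complex.conj_ofReal, Complex.conj_conj,
    map_div₀, map_one, map_ofNat]
  push_cast
  ring

lemma conj_gaussWave (q p x : Conf d) : conj (gaussWave q p x) = gaussWave q (-p) x := by
  simp only [gaussWave, ← Complex.exp_conj, map_sub, map_mul, Complex.conj_I,
    Complex.conj_ofReal, inner_neg_left]
  push_cast
  congr 1
  ring

lemma gaussWave_add (q p x w : Conf d) : gaussWave q p (x + w)
    = Complex.exp (Complex.I * ((inner ℝ p w : ℝ) : ℂ)) * gaussWave (q - w) p x := by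
  rw [gaussWave, gaussWave, ← Complex.exp_add, inner_add_right, sub_sub_eq_add_sub]
  congr 1
  push_cast
  ring

/-- Conjugation, exchange of the variables and translation by `w` cost only phase factors. The
packet at `Y`, moved by `w`, becomes the incoming one. -/
lemma norm_packetElement_kernelI (φ : Phase d ≃ Phase d) (S : Phase d → ℝ)
    (Θ : Phase d → Matrix (Fin d) (Fin d) ℂ) (Γ : Matrix (Fin d) (Fin d) ℂ)
    (a : Conf d × Phase d → ℂ) (τ X Y : Phase d) :
    ‖packetElement (kernelI φ S Θ Γ a τ) (X, Y)‖
      = ‖∫ v : Conf d × Conf d, Complex.exp (Complex.I *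
          frozenPhase (fun y => -S (φ.symm (y, τ.2)))
          (fun y => (φ.symm (y, τ.2)).1) (fun y => (φ.symm (y, τ.2)).2) (fun _ => Γ) v.1 v.2)
          * conjAmplitude φ Θ a τ v
          * (gaussWave (Y.1 - τ.1) Y.2 v.1 * gaussWave X.1 (-X.2) v.2)‖ := by
  let f : Conf d × Conf d → ℂ := fun v =>
    conj (kernelI φ S Θ Γ a τ v * (gaussWave X.1 X.2 v.1 * gaussWave Y.1 (-Y.2) v.2))
  have h1 : ‖packetElement (kernelI φ S Θ Γ a τ) (X, Y)‖ = ‖∫ v, f v‖ := by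
    rw [← Complex.norm_conj (packetElement _ _), packetElement, ← integral_conj]
  have h2 : ∫ v : Conf d × Conf d, f (v.swap + (0, τ.1)) = ∫ v, f v :=
    ((Measure.measurePreserving_swap (μ := (volume : Measure (Conf d)))
      (ν := (volume : Measure (Conf d)))).integral_comp
      (MeasurableEquiv.prodComm : Conf d × Conf d ≃ᵐ Conf d × Conf d).measurableEmbedding
      (fun v => f (v + (0, τ.1)))).trans (integral_add_right_eq_self f _)
  have hn : ∀ r : ℝ, ‖Complex.exp (Complex.I * (r : ℂ))‖ = 1 := fun r => by
    rw [Complex.norm_exp]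
    simp
  have hn' : ∀ r : ℝ, ‖Complex.exp (-(Complex.I * (r : ℂ)))‖ = 1 := fun r => by
    rw [Complex.norm_exp]
    simp
  rw [h1, ← h2, ← one_mul ‖∫ v : Conf d × Conf d, _ * _ * _‖, ← hn' (inner ℝ τ.2 τ.1),
    ← mul_one ‖Complex.exp (-_)‖, ← hn (inner ℝ Y.2 τ.1), ← norm_mul, ← norm_mul,
    ← integral_const_mul]
  congr 2
  ext1 v
  have e : v.swap + (0, τ.1) = (v.2, v.1 + τ.1) := by simp [Prod.ext_iff]
  simp only [f, e, map_mul, conj_kernelI, conj_gaussWave, neg_neg, gaussWave_add]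
  ring

/-- In the quadratic form the vector `w` is a parameter, so bounds on derivatives of `Θ` of order at
least one suffice, together with the lower bound of `Im Θ`. The Gaussian prefactor records the decay
in `w` that is left over. -/
lemma uniformSymbol_conjAmplitude (hφ : IsCanonicalFamily φ)
    (hΘ : ∀ k l, UniformSymbol 1 (fun i z => Θ i z k l)) (hc : 0 < c)
    (hlow : ∀ i z v, c * ‖v‖ ^ 2 ≤ (quadForm (Θ i z) v).im) (ha : UniformSymbol 0 a) :
    UniformSymbol 0 (fun (j : ι × Phase d) (v : Conf d × Conf d) =>
      ((Real.exp (c / 4 * ‖j.2.1‖ ^ 2) : ℝ) : ℂ) * conjAmplitude (φ j.1) (Θ j.1) (a j.1) j.2 v) := by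
  set g : ι × Phase d → Conf d × Conf d → Phase d := fun j v => (φ j.1).symm (v.1, j.2.2)
  have hsl : UniformSymbol 1 (fun (j : ι × Phase d) (v : Conf d × Conf d) =>
      ((v.1, j.2.2) : Phase d)) := by
    simpa using uniformSymbol_affine ((ContinuousLinearMap.inl ℝ (Conf d) (Conf d)).comp
      (ContinuousLinearMap.fst ℝ (Conf d) (Conf d)))
      (fun j : ι × Phase d => ((0, j.2.2) : Phase d))
  have hg : UniformSymbol 1 g := (hφ.symbol_symm.reindex Prod.fst).comp_one hsl
  have hga : UniformSymbol 1 (fun (j : ι × Phase d) (v : Conf d × Conf d) =>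
      ((v.1 + j.2.1, g j v) : Conf d × Phase d)) :=
    (uniformSymbol_affine (ContinuousLinearMap.fst ℝ (Conf d) (Conf d))
      (fun j : ι × Phase d => j.2.1)).prodMk hg
  have ha' : UniformSymbol 0 (fun (j : ι × Phase d) (v : Conf d × Conf d) =>
      conj (a j.1 (v.1 + j.2.1, g j v))) :=
    ((ha.reindex Prod.fst).comp hga).clm (Complex.conjCLE : ℂ →L[ℝ] ℂ)
  set ρ : ι × Phase d → Conf d × Conf d → ℝ := fun j _ => 1 + ‖j.2.1‖ with hρdef
  have hρ : ∀ j v, 1 ≤ ρ j v := fun j v => by simp [hρdef]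
  have hρ0 : ∀ j v, 0 ≤ ρ j v := fun j v => zero_le_one.trans (hρ j v)
  set h : ι × Phase d → Conf d × Conf d → ℂ := fun j v =>
    -(Complex.I / 2) * conj (quadForm (Θ j.1 (g j v)) j.2.1) with hdef
  have hT : ∀ k l, UniformSymbol 1 (fun (j : ι × Phase d) (v : Conf d × Conf d) =>
      Θ j.1 (g j v) k l) := fun k l => ((hΘ k l).reindex Prod.fst).comp_one hg
  have hcoord : ∀ k, Tame ρ (fun _ _ => 1) (fun (j : ι × Phase d) (_ : Conf d × Conf d) =>
      ((j.2.1 k : ℝ) : ℂ)) := fun k => by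
    refine Tame.of_uniformSymbol (C := 1) (by
      simpa using uniformSymbol_affine (0 : Conf d × Conf d →L[ℝ] ℂ)
        (fun j : ι × Phase d => ((j.2.1 k : ℝ) : ℂ))) fun j v => ?_
    rw [Complex.norm_real, one_mul]
    exact (PiLp.norm_apply_le j.2.1 k).trans (by simp [hρdef])
  let A : ℂ →L[ℝ] ℂ := (ContinuousLinearMap.mul ℝ ℂ (-(Complex.I / 2))).comp
    (Complex.conjCLE : ℂ →L[ℝ] ℂ)
  have hq : ∀ j, ContDiff ℝ ∞ (fun v => quadForm (Θ j.1 (g j v)) j.2.1) := fun j => by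
    exact ContDiff.sum fun k _ => ContDiff.sum fun l _ =>
      (((hT k l).1 j).mul contDiff_const).mul contDiff_const
  have hh : ∀ j, ContDiff ℝ ∞ (h j) := fun j => A.contDiff.comp (hq j)
  let L : ℂ →L[ℝ] (Conf d × Conf d →L[ℝ] ℂ) →L[ℝ] (Conf d × Conf d →L[ℝ] ℂ) :=
    (ContinuousLinearMap.compL ℝ (Conf d × Conf d) ℂ ℂ).comp (ContinuousLinearMap.mul ℝ ℂ)
  -- The derivative falls on `Θ` only, at the price of two factors `w`, controlled by the weight `1
  -- + |w|`.
  have hqD : Tame ρ (fun _ _ => 1) (fun (j : ι × Phase d) (v : Conf d × Conf d) =>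
      ∑ k, ∑ l, L (((j.2.1 l : ℝ) : ℂ) * ((j.2.1 k : ℝ) : ℂ))
        (fderiv ℝ (fun v => Θ j.1 (g j v) k l) v)) := by
    refine Tame.sum hρ (by simp) fun k _ => Tame.sum hρ (by simp) fun l _ => ?_
    exact ((hcoord l).mul_one (hcoord k) hρ).bilin_one L
      (Tame.of_uniformSymbol_zero (hT k l).fderiv) hρ
  have hD : Tame ρ (fun _ _ => 1) (fun j => fderiv ℝ (h j)) := by
    refine (hqD.clm (ContinuousLinearMap.compL ℝ (Conf d × Conf d) ℂ ℂ A) hρ0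
      (by simp)).congr fun j v => ?_
    have h1 : HasFDerivAt (fun v => quadForm (Θ j.1 (g j v)) j.2.1)
        (∑ k, ∑ l, L (((j.2.1 l : ℝ) : ℂ) * ((j.2.1 k : ℝ) : ℂ))
          (fderiv ℝ (fun v => Θ j.1 (g j v) k l) v)) v := by
      unfold quadForm
      refine HasFDerivAt.fun_sum fun k _ => HasFDerivAt.fun_sum fun l _ => ?_
      have h2 := (((hT k l).1 j).differentiable (by simp) v).hasFDerivAt
      have h3 := (ContinuousLinearMap.mul ℝ ℂ
        (((j.2.1 l : ℝ) : ℂ) * ((j.2.1 k : ℝ) : ℂ))).hasFDerivAt.comp v h2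
      refine h3.congr_of_eventuallyEq (.of_forall fun v => ?_)
      simp only [Function.comp_apply, ContinuousLinearMap.mul_apply']
      ring
    exact (A.hasFDerivAt.comp v h1).fderiv.symm
  have hre : ∀ j v, (h j v).re ≤ -(c / 2 * ‖j.2.1‖ ^ 2) := fun j v => by
    have h1 := hlow j.1 (g j v) j.2.1
    have h2 : (h j v).re = -(1 / 2 * (quadForm (Θ j.1 (g j v)) j.2.1).im) := by
      simp [hdef, Complex.mul_re]
    rw [h2]
    linarith
  have hE := Tame.exp hh hD hρ
  -- The amplitude carries the Gaussian with constant `c / 2`; half of it cancels the prefactor and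
  -- half absorbs the powers of `1 + |w|`.
  have hE0 : UniformSymbol 0 (fun j v =>
      ((Real.exp (c / 4 * ‖j.2.1‖ ^ 2) : ℝ) : ℂ) * Complex.exp (h j v)) := by
    refine ⟨fun j => contDiff_const.mul (hh j).cexp, fun n _ => ?_⟩
    obtain ⟨m, C, hC⟩ := hE.2 n
    obtain ⟨D, hD0, hD⟩ := exp_decay_nonneg m (c := c / 4) (by positivity)
    refine ⟨|C| * D, fun j v => ?_⟩
    have h1 := iteratedFDeriv_const_smul_apply' (𝕜 := ℝ) (i := n) (x := v)
      (a := ((Real.exp (c / 4 * ‖j.2.1‖ ^ 2) : ℝ) : ℂ)) (f := fun v => Complex.exp (h j v))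
      ((hh j).cexp.contDiffAt.of_le (mod_cast le_top))
    simp only [smul_eq_mul] at h1
    rw [h1, norm_smul, Complex.norm_real, Real.norm_of_nonneg (Real.exp_pos _).le]
    calc _ ≤ Real.exp (c / 4 * ‖j.2.1‖ ^ 2)
          * (|C| * (1 + ‖j.2.1‖) ^ m * Real.exp (-(c / 2 * ‖j.2.1‖ ^ 2))) := by
          refine mul_le_mul_of_nonneg_left ((hC j v).trans ?_) (Real.exp_pos _).le
          simp only [hρdef]
          gcongr
          · exact le_abs_self C
          · exact hre j v
      _ = |C| * ((1 + ‖j.2.1‖) ^ m * Real.exp (-(c / 4 * ‖j.2.1‖ ^ 2))) := by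
          rw [show -(c / 4 * ‖j.2.1‖ ^ 2)
            = c / 4 * ‖j.2.1‖ ^ 2 + -(c / 2 * ‖j.2.1‖ ^ 2) by ring, Real.exp_add]
          ring
      _ ≤ _ := by
          gcongr
          exact hD _ (norm_nonneg _)
  have hfin := (uniformSymbol_zero_iff.1 hE0).mul_one (uniformSymbol_zero_iff.1 ha')
    (fun _ _ => le_rfl)
  refine uniformSymbol_zero_iff.2 (hfin.congr fun j v => ?_)
  simp only [conjAmplitude, hdef, g]
  ring

end OperatorI

/-! ### Operators with `2d` frequency variables as superpositions -/

section GraphKernelI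

variable {d : ℕ} {ι : Type*} {φ : ι → Phase d ≃ Phase d} {S : ι → Phase d → ℝ}
  {Θ : ι → Phase d → Matrix (Fin d) (Fin d) ℂ} {Γ : Matrix (Fin d) (Fin d) ℂ}
  {a : ι → Conf d × Phase d → ℂ} {c : ℝ}

/-- The frequency `z` such that `φ z = (x - w, P)`. -/
def frequency (φ : Phase d ≃ Phase d) (x : Conf d) (τ : Phase d) : Phase d :=
  φ.symm (x - τ.1, τ.2)

/-- Since `φ⁻¹` preserves volume, the change of variables from `z` to `(w, P)` at fixed `x` has no
Jacobian. -/
lemma IsCanonicalFamily.measurePreserving_frequency (hφ : IsCanonicalFamily φ) (i : ι)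
    (x : Conf d) : MeasurePreserving (frequency (φ i) x) (volume : Measure (Phase d)) volume :=
  (hφ.symm.measurePreserving i).comp
    ((Measure.measurePreserving_sub_left volume x).prod (MeasurePreserving.id volume))

lemma IsCanonicalFamily.measurableEmbedding_frequency (hφ : IsCanonicalFamily φ) (i : ι)
    (x : Conf d) : MeasurableEmbedding (frequency (φ i) x) :=
  (hφ.symm.measurableEmbedding i).comp ((MeasurableEquiv.subLeft x).prodCongr
    (MeasurableEquiv.refl (Conf d))).measurableEmbedding

lemma stronglyMeasurable_innerI {φ : Phase d → Phase d} (hφ : Continuous φ) {S : Phase d → ℝ}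
    (hS : Continuous S) {Θ : Phase d → Matrix (Fin d) (Fin d) ℂ}
    (hΘ : ∀ k l, Continuous fun z => Θ z k l) {a : Conf d × Phase d → ℂ} (ha : Continuous a)
    (ψ : 𝓢(Conf d, ℂ)) (x : Conf d) : StronglyMeasurable (innerI φ S Θ Γ a ψ x) := by
  refine StronglyMeasurable.integral_prod_right' (f := fun r : Phase d × Conf d =>
    Complex.exp (Complex.I * phaseI φ S Θ Γ r.1 x r.2) * a (x, r.1) * ψ r.2)
    (Continuous.stronglyMeasurable ?_)
  have h1 := (continuous_phaseI hφ hS hΘ Γ).comp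
    (by fun_prop : Continuous fun r : Phase d × Conf d => (r.1, x, r.2))
  have h2 := ψ.continuous
  simp only [Function.comp_def] at h1
  fun_prop

lemma integrable_innerI {φ : Phase d → Phase d} (hφ : Continuous φ) {S : Phase d → ℝ}
    (hS : Continuous S) {Θ : Phase d → Matrix (Fin d) (Fin d) ℂ}
    (hΘ : ∀ k l, Continuous fun z => Θ z k l) {a : Conf d × Phase d → ℂ} (ha : Continuous a)
    (hc : 0 < c) (hlow : ∀ z v, c * ‖v‖ ^ 2 ≤ (quadForm (Θ z) v).im) (hΓ : Γ ∈ siegel d) {A : ℝ}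
    (hA : ∀ t, ‖a t‖ ≤ A) (ψ : 𝓢(Conf d, ℂ)) (x : Conf d) :
    Integrable (innerI φ S Θ Γ a ψ x) :=
  ((integrable_windowedFourier hΓ ψ).norm.const_mul A).mono'
    (stronglyMeasurable_innerI hφ hS hΘ ha ψ x).aestronglyMeasurable
    (.of_forall (norm_innerI_le hc hlow hA ψ x))

/-- Packet decay is applied to `φ⁻¹`, from the packet at `(Y.1 - w, Y.2)` to the one at `X`. It
gives decay in `P - Y.2` and in `φ⁻¹(Y.1 - w, P) - X`, while the Gaussian amplitude gives the decay
in `w`. -/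
theorem IsCanonicalFamily.packetElement_kernelI_decay (hφ : IsCanonicalFamily φ)
    (hS : ∀ i, IsAction (φ i) (S i)) (hΘ : ∀ k l, UniformSymbol 1 (fun i z => Θ i z k l))
    (hc : 0 < c) (hlow : ∀ i z v, c * ‖v‖ ^ 2 ≤ (quadForm (Θ i z) v).im) (hΓ : Γ ∈ siegel d)
    (ha : UniformSymbol 0 a) (N : ℕ) : ∃ C : ℝ, 0 ≤ C ∧ ∀ i (τ X Y : Phase d),
      ‖packetElement (kernelI (φ i) (S i) (Θ i) Γ (a i) τ) (X, Y)‖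
        ≤ C * (((1 + ‖τ.1‖) ^ (d + 1))⁻¹ * ((1 + ‖τ.2 - Y.2‖) ^ (d + 1))⁻¹)
          * ((1 + ‖Y - φ i X‖) ^ N)⁻¹ := by
  obtain ⟨c', hc', hlow'⟩ := siegel_lower hΓ
  have hF := hφ.symm.isPhaseFamily (Θ := fun _ _ => Γ)
    (fun i => (hS i).symm ((hφ.symbol.1 i).differentiable (by simp))
      ((hφ.symbol_symm.1 i).differentiable (by simp)))
    (fun k l => by
      simpa using (uniformSymbol_affine (0 : Phase d →L[ℝ] ℂ) (fun _ : ι => Γ k l)).of_bound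
        (C := ‖Γ k l‖) (by simp)) hc' (fun _ _ => hlow')
  have hb := uniformSymbol_conjAmplitude hφ hΘ hc hlow ha
  obtain ⟨K₁, hK₁, hL₁⟩ := hφ.symbol.lipschitz
  obtain ⟨K₂, hK₂, hL₂⟩ := hφ.symbol_symm.lipschitz
  obtain ⟨C, hC0, hC⟩ := (hF.reindex (κ := (ι × Phase d) × (Phase d × Phase d))
      (fun j => (j.1.1, j.1.2.2))).packet_decay (hb.reindex Prod.fst)
      (fun j => j.2.2.1 - j.1.2.1) (fun j => j.2.2.2)
      (fun j => j.2.1.1) (fun j => j.2.1.2) ((d + 1) + N)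
  -- The Gaussian in `w` must provide `d + 1` powers for integrability and `N` for the comparison of
  -- `φ⁻¹(Y.1 - w, P)` with `φ⁻¹(Y)`.
  obtain ⟨D, hD0, hD⟩ := exp_decay_nonneg (N + (d + 1)) (c := c / 4) (by positivity)
  set K := K₁ * K₂
  have hK : 1 ≤ K := one_le_mul_of_one_le_of_one_le hK₁ hK₂
  refine ⟨C * K ^ N * D, by positivity, fun i τ X Y => ?_⟩
  have h1 := hC ((i, τ), (X, Y))
  simp only [] at h1
  rw [norm_packetElement_kernelI]
  set J := ∫ v : Conf d × Conf d, Complex.exp (Complex.I *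
          frozenPhase (fun y => -(S i) ((φ i).symm (y, τ.2)))
          (fun y => ((φ i).symm (y, τ.2)).1) (fun y => ((φ i).symm (y, τ.2)).2) (fun _ => Γ) v.1 v.2)
          * conjAmplitude (φ i) (Θ i) (a i) τ v
          * (gaussWave (Y.1 - τ.1) Y.2 v.1 * gaussWave X.1 (-X.2) v.2) with hJ
  set E : ℝ := Real.exp (c / 4 * ‖τ.1‖ ^ 2) with hE
  have hE0 : 0 < E := Real.exp_pos _
  set Z := (φ i).symm (Y.1 - τ.1, τ.2) with hZ
  set β := ‖τ.2 - Y.2‖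
  set W := 1 + β + ‖Z.2 - X.2‖ + ‖Z.1 - X.1‖ with hW
  have hEJ : W ^ (d + 1 + N) * (E * ‖J‖) ≤ C := by
    refine (le_of_eq ?_).trans h1
    congr 1
    have hEJ' : E * ‖J‖ = ‖(E : ℂ) * J‖ := by
      rw [norm_mul, Complex.norm_real, Real.norm_of_nonneg hE0.le]
    rw [hEJ', hJ, ← integral_const_mul]
    congr 2
    ext1 v
    ring
  have hW0 : 0 < W := by positivity
  have hβ0 : 0 ≤ β := norm_nonneg _
  have ht0 : 0 ≤ ‖τ.1‖ := norm_nonneg _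
  have h2 : 1 + β ≤ W := by
    rw [hW]
    linarith [norm_nonneg (Z.2 - X.2), norm_nonneg (Z.1 - X.1)]
  -- The distance to the graph is measured in the source, via `Z`: from `φ⁻¹(Y)` to `Z` it costs
  -- `|w|` and `|P - Y.2|`, from `Z` to `X` it is part of `W`.
  have h3 : 1 + ‖Y - φ i X‖ ≤ K * ((1 + ‖τ.1‖) * W) := by
    have e1 : ‖Y - φ i X‖ ≤ K₁ * ‖(φ i).symm Y - X‖ := by
      simpa using hL₁ i ((φ i).symm Y) X
    have e2 : ‖(φ i).symm Y - X‖ ≤ ‖(φ i).symm Y - Z‖ + ‖Z - X‖ :=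
      norm_sub_le_norm_sub_add_norm_sub _ _ _
    have e3 : ‖(φ i).symm Y - Z‖ ≤ K₂ * (‖τ.1‖ + β) := by
      refine (hL₂ i _ _).trans ?_
      gcongr
      rw [Prod.norm_def, Prod.fst_sub, Prod.snd_sub, sub_sub_cancel, norm_sub_rev Y.2]
      exact max_le (le_add_of_nonneg_right hβ0) (le_add_of_nonneg_left ht0)
    have e4 : ‖Z - X‖ ≤ ‖Z.2 - X.2‖ + ‖Z.1 - X.1‖ := by
      rw [Prod.norm_def, Prod.fst_sub, Prod.snd_sub]
      exact max_le (le_add_of_nonneg_left (norm_nonneg _))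
        (le_add_of_nonneg_right (norm_nonneg _))
    set α := ‖Z.2 - X.2‖ + ‖Z.1 - X.1‖ with hα
    have hα0 : 0 ≤ α := by positivity
    have hWα : W = 1 + β + α := by rw [hW, hα]; ring
    have e5 : 1 + ‖(φ i).symm Y - X‖ ≤ K₂ * ((1 + ‖τ.1‖) * W) := by
      have : 1 + α ≤ K₂ * (1 + α) := le_mul_of_one_le_left (by positivity) hK₂
      calc 1 + ‖(φ i).symm Y - X‖ ≤ K₂ * (1 + α) + K₂ * (‖τ.1‖ + β) := by linarith
        _ = K₂ * (1 + α + ‖τ.1‖ + β) := by ring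
        _ ≤ _ := by
          gcongr
          rw [hWα]
          nlinarith [mul_nonneg ht0 hα0, mul_nonneg ht0 hβ0]
    calc 1 + ‖Y - φ i X‖ ≤ K₁ * (1 + ‖(φ i).symm Y - X‖) := by linarith
      _ ≤ K₁ * (K₂ * ((1 + ‖τ.1‖) * W)) := by gcongr
      _ = _ := by ring
  have h4 : ‖J‖ ≤ C * (W ^ (d + 1 + N))⁻¹ * E⁻¹ := by
    rw [mul_assoc, ← mul_inv, ← div_eq_mul_inv, le_div_iff₀ (by positivity)]
    linarith
  have h5 : (W ^ N)⁻¹ ≤ K ^ N * (1 + ‖τ.1‖) ^ N * ((1 + ‖Y - φ i X‖) ^ N)⁻¹ := by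
    rw [← div_eq_mul_inv, ← one_div, div_le_div_iff₀ (by positivity) (by positivity), one_mul,
      ← mul_pow, ← mul_pow]
    gcongr
    linarith
  have h6 : (1 + ‖τ.1‖) ^ N * E⁻¹ ≤ D * ((1 + ‖τ.1‖) ^ (d + 1))⁻¹ := by
    rw [hE, ← Real.exp_neg, ← div_eq_mul_inv D, le_div_iff₀ (by positivity), mul_right_comm,
      ← pow_add]
    exact hD _ ht0
  calc ‖J‖ ≤ C * (((1 + β) ^ (d + 1))⁻¹
        * (K ^ N * (1 + ‖τ.1‖) ^ N * ((1 + ‖Y - φ i X‖) ^ N)⁻¹)) * E⁻¹ := by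
        refine h4.trans ?_
        rw [pow_add, mul_inv]
        gcongr
    _ = C * K ^ N * ((1 + ‖τ.1‖) ^ N * E⁻¹) * ((1 + β) ^ (d + 1))⁻¹
        * ((1 + ‖Y - φ i X‖) ^ N)⁻¹ := by ring
    _ ≤ C * K ^ N * (D * ((1 + ‖τ.1‖) ^ (d + 1))⁻¹) * ((1 + β) ^ (d + 1))⁻¹
        * ((1 + ‖Y - φ i X‖) ^ N)⁻¹ := by gcongr
    _ = _ := by ring

/-- The majorant of the matrix elements factors into integrable functions of `w` and of `P - Y.2`.
For the convergence in `τ` the variable `z` is restored, where an integrable windowed Fourier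
transform dominates uniformly in `x`. -/
theorem isGraphKernel_I (hφ : IsCanonicalFamily φ)
    (hS : ∀ i, IsAction (φ i) (S i)) (hΘ : ∀ k l, UniformSymbol 1 (fun i z => Θ i z k l))
    (hc : 0 < c) (hlow : ∀ i z v, c * ‖v‖ ^ 2 ≤ (quadForm (Θ i z) v).im) (hΓ : Γ ∈ siegel d)
    (ha : UniformSymbol 0 a) :
    IsGraphKernel volume φ (fun i => kernelI (φ i) (S i) (Θ i) Γ (a i)) := by
  have hφc := fun i => (hφ.symbol.1 i).continuous
  have hSc := fun i => (hS i).1.continuous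
  have hΘc := fun i k l => ((hΘ k l).1 i).continuous
  have hac := fun i => (ha.1 i).continuous
  have hcont : ∀ i, Continuous (fun t : Phase d × (Conf d × Conf d) =>
      kernelI (φ i) (S i) (Θ i) Γ (a i) t.1 t.2) := fun i => by
    have h1 := (hφ.symbol_symm.1 i).continuous
    have h2 := (continuous_phaseI (hφc i) (hSc i) (hΘc i) Γ).comp
      (by fun_prop : Continuous fun t : Phase d × (Conf d × Conf d) =>
        ((φ i).symm (t.2.2 - t.1.1, t.1.2), t.2.2, t.2.1))
    have h3 := hac i
    simp only [Function.comp_def] at h2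
    unfold kernelI
    fun_prop
  obtain ⟨A, hA0, hA⟩ := ha.bound
  have hn : Module.finrank ℝ (Conf d) < d + 1 := by simp
  have hI0 : 0 ≤ ∫ y : Conf d, ((1 + ‖y‖) ^ (d + 1))⁻¹ := integral_nonneg fun y => by positivity
  refine ⟨⟨fun i τ => ((hcont i).comp (by fun_prop :
    Continuous fun v : Conf d × Conf d => (τ, v))).measurable, ⟨A, fun i τ v => ?_⟩, fun N => ?_⟩,
    fun i => (hcont i).measurable, fun i ψ x => ?_, fun i ψ => ⟨∫ z, A * ‖windowedFourier Γ ψ z‖,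
      fun x => ?_⟩⟩
  · rw [kernelI, norm_mul]
    exact (mul_le_of_le_one_left (norm_nonneg _)
      (norm_exp_phaseI_le hc (hlow i) hΓ _ _ _)).trans (hA i _)
  · obtain ⟨C, hC0, hC⟩ := hφ.packetElement_kernelI_decay hS hΘ hc hlow hΓ ha N
    refine ⟨fun t => C * (((1 + ‖t.1.1‖) ^ (d + 1))⁻¹ * ((1 + ‖t.1.2 - t.2.2.2‖) ^ (d + 1))⁻¹),
      by fun_prop, fun t => by positivity, ⟨C * ((∫ y : Conf d, ((1 + ‖y‖) ^ (d + 1))⁻¹)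
        * ∫ y : Conf d, ((1 + ‖y‖) ^ (d + 1))⁻¹), by positivity, fun X Y => ?_⟩, hC⟩
    have hz := lintegral_graph_weight (Conf d) hn 0
    simp only [sub_zero] at hz
    have hp : ∀ w : Conf d, 0 ≤ ((1 + ‖w‖) ^ (d + 1))⁻¹ := fun w => by positivity
    simp only [ENNReal.ofReal_mul hC0, ENNReal.ofReal_mul (hp _)]
    rw [lintegral_const_mul' _ _ ENNReal.ofReal_ne_top, ENNReal.ofReal_mul hI0,
      show (volume : Measure (Phase d)) = volume.prod volume from rfl,
      lintegral_prod_mul (f := fun w : Conf d => ENNReal.ofReal ((1 + ‖w‖) ^ (d + 1))⁻¹)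
        (g := fun P : Conf d => ENNReal.ofReal ((1 + ‖P - Y.2‖) ^ (d + 1))⁻¹)
        (by fun_prop) (by fun_prop), hz, lintegral_graph_weight _ hn]
  · exact (hφ.measurePreserving_frequency i x).integrable_comp_of_integrable
      (integrable_innerI (hφc i) (hSc i) (hΘc i) (hac i) hc (hlow i) hΓ (hA i) ψ x)
  · refine ((hφ.measurePreserving_frequency i x).integral_comp
      (hφ.measurableEmbedding_frequency i x)
      (fun z => ‖innerI (φ i) (S i) (Θ i) Γ (a i) ψ x z‖)).trans_le ?_
    exact integral_mono (integrable_innerI (hφc i) (hSc i) (hΘc i) (hac i) hc (hlow i) hΓ (hA i)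
      ψ x).norm ((integrable_windowedFourier hΓ ψ).norm.const_mul A)
      (norm_innerI_le hc (hlow i) (hA i) ψ x)

lemma IsCanonicalFamily.integral_kernelI (hφ : IsCanonicalFamily φ) (i : ι) (ψ : 𝓢(Conf d, ℂ))
    (x : Conf d) : ∫ τ, ∫ y, kernelI (φ i) (S i) (Θ i) Γ (a i) τ (y, x) * ψ y
      = ∫ z, innerI (φ i) (S i) (Θ i) Γ (a i) ψ x z :=
  (hφ.measurePreserving_frequency i x).integral_comp (hφ.measurableEmbedding_frequency i x)
    (innerI (φ i) (S i) (Θ i) Γ (a i) ψ x)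

end GraphKernelI

/-! ### Operators from bounded pairings -/

section Extension

variable {d : ℕ}

/-- Complex conjugation of Schwartz functions. -/
def conjSchwartz (ψ : 𝓢(Conf d, ℂ)) : 𝓢(Conf d, ℂ) :=
  SchwartzMap.postcompCLM (𝕜 := ℝ) (Complex.conjCLE : ℂ →L[ℝ] ℂ) ψ

@[simp]
lemma conjSchwartz_apply (ψ : 𝓢(Conf d, ℂ)) (x : Conf d) : conjSchwartz ψ x = conj (ψ x) := rfl

lemma l2norm_conjSchwartz (ψ : 𝓢(Conf d, ℂ)) : l2norm (conjSchwartz ψ) = l2norm ψ := by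
  simp [l2norm]

lemma norm_toLp_eq_l2norm (ψ : 𝓢(Conf d, ℂ)) : ‖ψ.toLp 2 volume‖ = l2norm ψ := by
  rw [SchwartzMap.norm_toLp, eLpNorm_eq_lintegral_rpow_enorm_toReal (by norm_num) (by norm_num),
    l2norm, Real.sqrt_eq_rpow, ← ENNReal.toReal_rpow,
    integral_eq_lintegral_of_nonneg_ae (.of_forall fun x => by positivity)
      (by have := ψ.continuous; exact Continuous.aestronglyMeasurable (by fun_prop))]
  congr 2
  · refine lintegral_congr fun x => ?_
    rw [ENNReal.ofReal_pow (norm_nonneg _), ofReal_norm]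
    norm_num

/-- Schwartz functions as elements of `L²`. -/
def schwartzL2 (d : ℕ) : 𝓢(Conf d, ℂ) →L[ℂ] Lp ℂ 2 (volume : Measure (Conf d)) :=
  SchwartzMap.toLpCLM ℂ ℂ 2 volume

lemma norm_schwartzL2 (ψ : 𝓢(Conf d, ℂ)) : ‖schwartzL2 d ψ‖ = l2norm ψ := norm_toLp_eq_l2norm ψ

lemma denseRange_schwartzL2 : DenseRange (schwartzL2 d) :=
  SchwartzMap.denseRange_toLpCLM (E := Conf d) (F := ℂ) (p := 2) (by norm_num) (μ := volume)

lemma inner_schwartzL2 (χ : 𝓢(Conf d, ℂ)) (f : Lp ℂ 2 (volume : Measure (Conf d))) :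
    inner ℂ (schwartzL2 d χ) f = ∫ x, conj (χ x) * f x := by
  rw [L2.inner_def]
  refine integral_congr_ae ?_
  filter_upwards [SchwartzMap.coeFn_toLp χ 2 (volume : Measure (Conf d))] with x hx
  rw [show (schwartzL2 d χ) x = χ x from hx, RCLike.inner_apply, mul_comm]

variable {A : 𝓢(Conf d, ℂ) → Conf d → ℂ} {C : ℝ}

/-- The bounded sesquilinear form on Schwartz functions extends by density, first in one variable
and then in the other, and is represented by an operator on `L²`. Continuity into tempered
distributions comes from the factorisation through `L²`. -/
theorem exists_operator_of_pairing (hadd : ∀ ψ ψ' x, A (ψ + ψ') x = A ψ x + A ψ' x)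
    (hsmul : ∀ (t : ℂ) ψ x, A (t • ψ) x = t * A ψ x)
    (hint : ∀ ψ χ : 𝓢(Conf d, ℂ), Integrable (fun x => χ x * A ψ x)) (hC : 0 ≤ C)
    (hb : ∀ ψ χ : 𝓢(Conf d, ℂ), ‖∫ x, χ x * A ψ x‖ ≤ C * (l2norm ψ * l2norm χ)) :
    ∃ T : 𝓢(Conf d, ℂ) →L[ℂ] 𝓢'(Conf d, ℂ), IsGivenBy T A ∧ IsL2BoundedBy T C := by
  have hint' : ∀ ψ χ : 𝓢(Conf d, ℂ), Integrable (fun x => conj (χ x) * A ψ x) :=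
    fun ψ χ => hint ψ (conjSchwartz χ)
  let ℓ : 𝓢(Conf d, ℂ) → 𝓢(Conf d, ℂ) →ₗ[ℂ] ℂ := fun χ =>
    { toFun := fun ψ => ∫ x, conj (χ x) * A ψ x
      map_add' := fun ψ ψ' => by
        rw [← integral_add (hint' ψ χ) (hint' ψ' χ)]
        simp only [hadd, mul_add]
      map_smul' := fun t ψ => by
        simp only [hsmul, mul_left_comm _ t, integral_const_mul, smul_eq_mul, RingHom.id_apply] }
  have hℓ : ∀ χ ψ, ‖ℓ χ ψ‖ ≤ C * l2norm χ * ‖schwartzL2 d ψ‖ := fun χ ψ => by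
    rw [norm_schwartzL2]
    refine (hb ψ (conjSchwartz χ)).trans (le_of_eq ?_)
    rw [l2norm_conjSchwartz]
    ring
  have hd := denseRange_schwartzL2 (d := d)
  set e : 𝓢(Conf d, ℂ) →ₗ[ℂ] Lp ℂ 2 (volume : Measure (Conf d)) := (schwartzL2 d).toLinearMap
  let G : 𝓢(Conf d, ℂ) → Lp ℂ 2 (volume : Measure (Conf d)) →L[ℂ] ℂ :=
    fun χ => (ℓ χ).extendOfNorm e
  have hG : ∀ χ ψ, G χ (schwartzL2 d ψ) = ∫ x, conj (χ x) * A ψ x := fun χ ψ =>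
    LinearMap.extendOfNorm_eq (f := ℓ χ) (e := e) hd ⟨_, hℓ χ⟩ ψ
  have hGn : ∀ χ, ‖G χ‖ ≤ C * l2norm χ := fun χ =>
    LinearMap.opNorm_extendOfNorm_le (f := ℓ χ) (e := e) hd
      (by unfold l2norm; positivity) (hℓ χ)
  have hext : ∀ F F' : Lp ℂ 2 (volume : Measure (Conf d)) →L[ℂ] ℂ,
      (∀ ψ, F (schwartzL2 d ψ) = F' (schwartzL2 d ψ)) → F = F' := fun F F' h =>
    ContinuousLinearMap.ext fun v =>
      congrFun (hd.equalizer F.continuous F'.continuous (funext h)) v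
  let Gs : 𝓢(Conf d, ℂ) →ₛₗ[starRingEnd ℂ] (Lp ℂ 2 (volume : Measure (Conf d)) →L[ℂ] ℂ) :=
    { toFun := G
      map_add' := fun χ χ' => hext _ _ fun ψ => by
        rw [add_apply, hG, hG, hG, ← integral_add (hint' ψ χ) (hint' ψ χ')]
        simp only [add_apply, map_add, add_mul]
      map_smul' := fun t χ => hext _ _ fun ψ => by
        rw [smul_apply, hG, hG, smul_eq_mul, ← integral_const_mul]
        simp only [smul_apply, smul_eq_mul, map_mul, mul_assoc] }
  have hGs : ∀ χ, ‖Gs χ‖ ≤ C * ‖e χ‖ := fun χ =>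
    (hGn χ).trans_eq (by rw [← norm_schwartzL2]; rfl)
  let H : Lp ℂ 2 (volume : Measure (Conf d)) →L⋆[ℂ] Lp ℂ 2 (volume : Measure (Conf d)) →L[ℂ] ℂ :=
    Gs.extendOfNorm e
  have hH : ∀ χ ψ, H (schwartzL2 d χ) (schwartzL2 d ψ) = ∫ x, conj (χ x) * A ψ x := fun χ ψ => by
    rw [← hG]
    exact DFunLike.congr_fun (LinearMap.extendOfNorm_eq (f := Gs) (e := e) hd ⟨C, hGs⟩ χ) _
  have hHn : ‖H‖ ≤ C := LinearMap.opNorm_extendOfNorm_le (f := Gs) (e := e) hd hC hGs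
  let D := InnerProductSpace.continuousLinearMapOfBilin H
  have hDn : ‖D‖ ≤ C := by
    refine ContinuousLinearMap.opNorm_le_bound _ hC fun v => ?_
    have h1 : inner ℂ (D v) (D v) = H v (D v) :=
      InnerProductSpace.continuousLinearMapOfBilin_apply H v (D v)
    have h2 : ‖D v‖ * ‖D v‖ ≤ C * ‖v‖ * ‖D v‖ := by
      have h3 := congrArg norm h1
      rw [inner_self_eq_norm_sq_to_K, norm_pow, RCLike.norm_ofReal, abs_norm] at h3
      rw [← sq, h3]
      refine ((H v).le_opNorm _).trans ?_
      gcongr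
      exact (H.le_opNorm v).trans (by gcongr)
    rcases (norm_nonneg (D v)).eq_or_lt with h0 | h0
    · rw [← h0]
      positivity
    · exact le_of_mul_le_mul_right h2 h0
  -- The representing operator acts on the conjugate-linear variable `χ`; the operator on `ψ` is its
  -- adjoint.
  let B := ContinuousLinearMap.adjoint D
  have hB : ∀ χ ψ : 𝓢(Conf d, ℂ), ∫ x, conj (χ x) * (B (schwartzL2 d ψ)) x = ∫ x, conj (χ x) * A ψ x :=
    fun χ ψ => by
      rw [← inner_schwartzL2, ContinuousLinearMap.adjoint_inner_right, ← hH]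
      exact InnerProductSpace.continuousLinearMapOfBilin_apply H _ _
  refine ⟨(Lp.toTemperedDistributionCLM ℂ volume 2).comp (B.comp (schwartzL2 d)),
    fun ψ χ => ⟨hint ψ χ, ?_⟩, B, ?_, fun ψ => rfl⟩
  · have h := hB (conjSchwartz χ) ψ
    simp only [conjSchwartz_apply, Complex.conj_conj] at h
    rw [← h]
    exact Lp.toTemperedDistribution_apply (B (schwartzL2 d ψ)) χ
  · exact (LinearIsometryEquiv.norm_map ContinuousLinearMap.adjoint D).trans_le hDn

end Extension

/-! ### Semiclassical scaling -/

section ScalingSymbols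

variable {V W : Type*} [NormedAddCommGroup V] [NormedSpace ℝ V] [NormedAddCommGroup W]
  [NormedSpace ℝ W]

/-- The square root of the semiclassical parameter. -/
def scale (ħ : Set.Ioc (0 : ℝ) 1) : ℝ := Real.sqrt ħ

lemma scale_pos (ħ : Set.Ioc (0 : ℝ) 1) : 0 < scale ħ := Real.sqrt_pos.2 ħ.2.1

lemma scale_le_one (ħ : Set.Ioc (0 : ℝ) 1) : scale ħ ≤ 1 := Real.sqrt_le_one.2 ħ.2.2

lemma scale_sq (ħ : Set.Ioc (0 : ℝ) 1) : scale ħ ^ 2 = ħ := Real.sq_sqrt ħ.2.1.le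

lemma IsSymbol.scaled {m : ℕ} {f : V → W} (hf : IsSymbol m f) :
    UniformSymbol m (fun (ħ : Set.Ioc (0 : ℝ) 1) x => f (scale ħ • x)) := by
  refine ⟨fun ħ => hf.1.comp (contDiff_const_smul _), fun k hk => ?_⟩
  obtain ⟨C, hC⟩ := hf.2 k hk
  refine ⟨C, fun ħ x => ?_⟩
  rw [iteratedFDeriv_comp_const_smul _ (hf.1.of_le (mod_cast le_top))]
  simp only [norm_smul, norm_pow, Real.norm_of_nonneg (scale_pos ħ).le]
  exact (mul_le_of_le_one_left (norm_nonneg _)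
    (pow_le_one₀ (scale_pos ħ).le (scale_le_one ħ))).trans (hC _)

/-- A derivative of order `k` gains `√ħ ^ (k - 1)`, which is at most one exactly when `k ≥ 1` is
guaranteed; this is where the class of order one is used. -/
lemma IsSymbol.scaled_inv {f : V → W} (hf : IsSymbol 1 f) :
    UniformSymbol 1 (fun (ħ : Set.Ioc (0 : ℝ) 1) x => (scale ħ)⁻¹ • f (scale ħ • x)) := by
  have hs : ∀ ħ : Set.Ioc (0 : ℝ) 1, ContDiff ℝ ∞ (fun x => f (scale ħ • x)) :=
    fun ħ => hf.1.comp (contDiff_const_smul _)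
  refine ⟨fun ħ => (hs ħ).const_smul _, fun k hk => ?_⟩
  obtain ⟨C, hC⟩ := hf.2 k hk
  refine ⟨C, fun ħ x => ?_⟩
  have h0 := scale_pos ħ
  rw [iteratedFDeriv_const_smul_apply' ((hs ħ).contDiffAt.of_le (mod_cast le_top)),
    iteratedFDeriv_comp_const_smul _ (hf.1.of_le (mod_cast le_top))]
  simp only [norm_smul, norm_pow, norm_inv, Real.norm_of_nonneg h0.le]
  obtain ⟨k, rfl⟩ : ∃ j, k = j + 1 := ⟨k - 1, by omega⟩
  rw [pow_succ', mul_assoc, inv_mul_cancel_left₀ h0.ne']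
  exact (mul_le_of_le_one_left (norm_nonneg _) (pow_le_one₀ h0.le (scale_le_one ħ))).trans (hC _)

end ScalingSymbols

/-! ### Scaling of maps, actions, phases and functions -/

section ScalingMaps

variable {d : ℕ}

/-- Conjugation of a map by the dilation with factor `√ħ`. -/
def scaledMap (φ : Phase d ≃ Phase d) (ħ : Set.Ioc (0 : ℝ) 1) : Phase d ≃ Phase d where
  toFun z := (scale ħ)⁻¹ • φ (scale ħ • z)
  invFun z := (scale ħ)⁻¹ • φ.symm (scale ħ • z)
  left_inv z := by
    simp only []
    rw [smul_inv_smul₀ (scale_pos ħ).ne', φ.symm_apply_apply, inv_smul_smul₀ (scale_pos ħ).ne']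
  right_inv z := by
    simp only []
    rw [smul_inv_smul₀ (scale_pos ħ).ne', φ.apply_symm_apply, inv_smul_smul₀ (scale_pos ħ).ne']

/-- The action of a scaled map. -/
def scaledAction (S : Phase d → ℝ) (ħ : Set.Ioc (0 : ℝ) 1) (z : Phase d) : ℝ :=
  (scale ħ ^ 2)⁻¹ * S (scale ħ • z)

lemma smul_scaledMap (φ : Phase d ≃ Phase d) (ħ : Set.Ioc (0 : ℝ) 1) (z : Phase d) :
    scale ħ • scaledMap φ ħ z = φ (scale ħ • z) :=
  smul_inv_smul₀ (scale_pos ħ).ne' _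

lemma hasFDerivAt_scaledMap {φ : Phase d ≃ Phase d} (hφ : Differentiable ℝ φ)
    (ħ : Set.Ioc (0 : ℝ) 1) (z : Phase d) :
    HasFDerivAt (scaledMap φ ħ) (fderiv ℝ φ (scale ħ • z)) z := by
  have h1 : HasFDerivAt (fun z : Phase d => scale ħ • z) (scale ħ • .id ℝ (Phase d)) z :=
    (scale ħ • ContinuousLinearMap.id ℝ (Phase d)).hasFDerivAt
  have h2 := ((hφ (scale ħ • z)).hasFDerivAt.comp z h1).const_smul (scale ħ)⁻¹
  refine HasFDerivAt.congr_fderiv (f := scaledMap φ ħ) h2 ?_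
  refine ContinuousLinearMap.ext fun v => ?_
  simp [inv_smul_smul₀ (scale_pos ħ).ne']

lemma IsCanonical.isCanonicalFamily {φ : Phase d ≃ Phase d} (hφ : IsCanonical φ) :
    IsCanonicalFamily (scaledMap φ) where
  symbol := hφ.symbol.scaled_inv
  symbol_symm := hφ.isSymbol_symm.scaled_inv
  symplectic ħ z u v := by
    rw [(hasFDerivAt_scaledMap (hφ.symbol.1.differentiable (by simp)) ħ z).fderiv]
    exact hφ.symplectic _ _ _

/-- The one-form is quadratic in phase space, so its primitive scales with `ħ⁻¹`. -/
lemma IsAction.scaled {φ : Phase d ≃ Phase d} (hφ : Differentiable ℝ φ) {S : Phase d → ℝ}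
    (hS : IsAction φ S) (ħ : Set.Ioc (0 : ℝ) 1) :
    IsAction (scaledMap φ ħ) (scaledAction S ħ) := by
  have h0 := (scale_pos ħ).ne'
  have key : ∀ z, HasFDerivAt (scaledAction S ħ)
      ((scale ħ ^ 2)⁻¹ • (fderiv ℝ S (scale ħ • z)).comp (scale ħ • .id ℝ (Phase d))) z := by
    intro z
    have h1 : HasFDerivAt (fun z : Phase d => scale ħ • z) (scale ħ • .id ℝ (Phase d)) z :=
      (scale ħ • ContinuousLinearMap.id ℝ (Phase d)).hasFDerivAt
    have h2 := (hS.1 (scale ħ • z)).hasFDerivAt.comp z h1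
    exact h2.const_smul ((scale ħ ^ 2)⁻¹ : ℝ)
  refine ⟨fun z => (key z).differentiableAt, fun z v => ?_⟩
  rw [(key z).fderiv, (hasFDerivAt_scaledMap hφ ħ z).fderiv]
  simp only [smul_apply, ContinuousLinearMap.comp_apply, ContinuousLinearMap.id_apply, hS.2,
    ← smul_scaledMap, map_smul, Prod.smul_fst, Prod.smul_snd, inner_smul_left, inner_smul_right,
    smul_eq_mul]
  simp only [conj_trivial]
  field_simp

/-- Every term is quadratic in the phase space variables, once those of `φ` are included, so the
dilation absorbs `1 / ħ`. -/
lemma phaseI_scaled (φ : Phase d ≃ Phase d) (S : Phase d → ℝ)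
    (Θ : Phase d → Matrix (Fin d) (Fin d) ℂ) (Γ : Matrix (Fin d) (Fin d) ℂ)
    (ħ : Set.Ioc (0 : ℝ) 1) (z : Phase d) (x y : Conf d) :
    Complex.I / ((ħ : ℝ) : ℂ) * phaseI φ S Θ Γ (scale ħ • z) (scale ħ • x) (scale ħ • y)
      = Complex.I * phaseI (scaledMap φ ħ) (scaledAction S ħ) (fun z => Θ (scale ħ • z)) Γ z x y := by
  have h0 : (scale ħ : ℂ) ≠ 0 := Complex.ofReal_ne_zero.2 (scale_pos ħ).ne'
  rw [← scale_sq]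
  simp only [phaseI, scaledAction, ← smul_scaledMap, Prod.smul_fst, Prod.smul_snd, ← smul_sub,
    inner_smul_left, inner_smul_right, quadForm_smul, conj_trivial]
  push_cast
  field_simp

lemma phaseJ_scaled (φ : Phase d ≃ Phase d) (S : Phase d → ℝ)
    (Θ : Phase d → Matrix (Fin d) (Fin d) ℂ)
    (ħ : Set.Ioc (0 : ℝ) 1) (p x y : Conf d) :
    Complex.I / ((ħ : ℝ) : ℂ) * phaseJ φ S Θ (scale ħ • p) (scale ħ • x) (scale ħ • y)
      = Complex.I * phaseJ (scaledMap φ ħ) (scaledAction S ħ) (fun z => Θ (scale ħ • z)) p x y := by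
  have h0 : (scale ħ : ℂ) ≠ 0 := Complex.ofReal_ne_zero.2 (scale_pos ħ).ne'
  have hp : ((scale ħ • y, scale ħ • p) : Phase d) = scale ħ • (y, p) := rfl
  rw [← scale_sq]
  simp only [phaseJ, scaledAction, hp, ← smul_scaledMap, Prod.smul_fst, Prod.smul_snd, ← smul_sub,
    inner_smul_left, inner_smul_right, quadForm_smul, conj_trivial]
  push_cast
  field_simp

/-- Dilation of Schwartz functions by the factor `√ħ`. -/
def dilate (ħ : Set.Ioc (0 : ℝ) 1) : 𝓢(Conf d, ℂ) →L[ℂ] 𝓢(Conf d, ℂ) :=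
  SchwartzMap.compCLMOfContinuousLinearEquiv ℂ
    (ContinuousLinearEquiv.smulLeft (R₁ := ℝ) (M₁ := Conf d) (Units.mk0 (scale ħ) (scale_pos ħ).ne'))

@[simp]
lemma dilate_apply (ħ : Set.Ioc (0 : ℝ) 1) (ψ : 𝓢(Conf d, ℂ)) (x : Conf d) :
    dilate ħ ψ x = ψ (scale ħ • x) := rfl

lemma integral_scale_smul {F : Type*} [NormedAddCommGroup F] [NormedSpace ℝ F]
    (ħ : Set.Ioc (0 : ℝ) 1) (f : Conf d → F) :
    ∫ x, f x = scale ħ ^ d • ∫ x, f (scale ħ • x) := by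
  have h0 := scale_pos ħ
  rw [Measure.integral_comp_smul, finrank_euclideanSpace, Fintype.card_fin,
    abs_of_pos (by positivity), smul_inv_smul₀ (by positivity)]

lemma integral_scale_smul_phase {F : Type*} [NormedAddCommGroup F] [NormedSpace ℝ F]
    (ħ : Set.Ioc (0 : ℝ) 1) (f : Phase d → F) :
    ∫ z, f z = scale ħ ^ (2 * d) • ∫ z, f (scale ħ • z) := by
  have h0 := scale_pos ħ
  have hd : Module.finrank ℝ (Phase d) = 2 * d := by simp; ring
  rw [Measure.integral_comp_smul, hd, abs_of_pos (by positivity), smul_inv_smul₀ (by positivity)]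

lemma l2norm_dilate (ħ : Set.Ioc (0 : ℝ) 1) (ψ χ : 𝓢(Conf d, ℂ)) :
    scale ħ ^ d * (l2norm (dilate ħ ψ) * l2norm (dilate ħ χ)) = l2norm ψ * l2norm χ := by
  have h0 := scale_pos ħ
  have h : ∀ ψ : 𝓢(Conf d, ℂ), l2norm ψ = Real.sqrt (scale ħ ^ d) * l2norm (dilate ħ ψ) :=
    fun ψ => by
      rw [l2norm, l2norm, integral_scale_smul ħ, ← Real.sqrt_mul (by positivity)]
      rfl
  rw [h ψ, h χ, mul_mul_mul_comm, Real.mul_self_sqrt (by positivity)]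

end ScalingMaps

/-! ### From unit scale back to all values of the parameter -/

section Assembly

variable {d : ℕ} {T : Type} [MeasurableSpace T] {μ : Measure T} [SFinite μ]
  {φ : Phase d ≃ Phase d} {k : Set.Ioc (0 : ℝ) 1 → T → Conf d × Conf d → ℂ}
  {A : ℝ → 𝓢(Conf d, ℂ) → Conf d → ℂ} {c₀ : ℂ}

lemma phaseNorm_le (z : Phase d) : phaseNorm z ≤ 2 * ‖z‖ := by
  refine Real.sqrt_le_iff.2 ⟨by positivity, ?_⟩
  have h1 : ‖z.1‖ ≤ ‖z‖ := norm_fst_le z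
  have h2 : ‖z.2‖ ≤ ‖z‖ := norm_snd_le z
  nlinarith [norm_nonneg z.1, norm_nonneg z.2, norm_nonneg z]

lemma phaseNorm_nonneg (z : Phase d) : 0 ≤ phaseNorm z := Real.sqrt_nonneg _

/-- The phase factor and normalisation of a dilated coherent state. -/
lemma dilate_coherentState (ħ : Set.Ioc (0 : ℝ) 1) (X : Phase d) (x : Conf d) :
    dilate ħ (coherentState ħ.2.1 X) x
      = ((((Real.pi * ħ) ^ (-((d : ℝ) / 4)) : ℝ) : ℂ)
          * Complex.exp (-(Complex.I * ((inner ℝ X.2 X.1 / (2 * ħ) : ℝ) : ℂ))))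
        * gaussWave ((scale ħ)⁻¹ • X.1) ((scale ħ)⁻¹ • X.2) x := by
  have h0 := (scale_pos ħ).ne'
  have hn : ‖scale ħ • x - X.1‖ ^ 2 = scale ħ ^ 2 * ‖x - (scale ħ)⁻¹ • X.1‖ ^ 2 := by
    rw [← Real.norm_of_nonneg (scale_pos ħ).le, ← mul_pow, ← norm_smul,
      Real.norm_of_nonneg (scale_pos ħ).le, smul_sub, smul_inv_smul₀ h0]
  change (((Real.pi * ħ) ^ (-((d : ℝ) / 4)) : ℝ) : ℂ)
    * Complex.exp (coherentExponent ħ X (scale ħ • x)) = _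
  rw [mul_assoc, gaussWave, ← Complex.exp_add]
  congr 2
  rw [coherentExponent, hn, ← scale_sq, inner_smul_right, real_inner_smul_left]
  have h0' : (scale ħ : ℂ) ≠ 0 := Complex.ofReal_ne_zero.2 h0
  push_cast
  field_simp
  ring

lemma dilate_conjCoherentState (ħ : Set.Ioc (0 : ℝ) 1) (X : Phase d) (x : Conf d) :
    dilate ħ (conjCoherentState ħ.2.1 X) x
      = ((((Real.pi * ħ) ^ (-((d : ℝ) / 4)) : ℝ) : ℂ)
          * Complex.exp (Complex.I * ((inner ℝ X.2 X.1 / (2 * ħ) : ℝ) : ℂ)))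
        * gaussWave ((scale ħ)⁻¹ • X.1) (-((scale ħ)⁻¹ • X.2)) x := by
  change conj (dilate ħ (coherentState ħ.2.1 X) x) = _
  rw [dilate_coherentState, map_mul, conj_gaussWave, map_mul, Complex.conj_ofReal,
    ← Complex.exp_conj, map_neg, map_mul, Complex.conj_I, Complex.conj_ofReal]
  simp

lemma pairing_scaled (hk : IsGraphKernel μ (scaledMap φ) k)
    (hA : ∀ (ħ : Set.Ioc (0 : ℝ) 1) ψ x, A ħ ψ (scale ħ • x)
      = c₀ * ∫ τ, (∫ y, k ħ τ (y, x) * dilate ħ ψ y) ∂μ)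
    (ħ : Set.Ioc (0 : ℝ) 1) (ψ χ : 𝓢(Conf d, ℂ)) :
    ∫ x, χ x * A ħ ψ x = ((scale ħ ^ d : ℝ) : ℂ) * (c₀ * ∫ τ, (∫ v : Conf d × Conf d,
      k ħ τ v * (dilate ħ ψ v.1 * dilate ħ χ v.2)) ∂μ) := by
  rw [integral_scale_smul (F := ℂ) ħ (fun x => χ x * A ħ ψ x), Complex.real_smul,
    ← hk.pairing_eq ħ (dilate ħ ψ) (dilate ħ χ), ← integral_const_mul c₀]
  refine congrArg (((scale ħ ^ d : ℝ) : ℂ) * ·) (integral_congr_ae (.of_forall fun x => ?_))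
  simp only [hA, dilate_apply]
  ring

/-- The constant `c₀` does not depend on `ħ`, and the Jacobian of the dilation in `x` is offset by
the norms of the two dilated functions. The bound is therefore uniform. -/
lemma exists_operator_scaled (hφ : IsCanonical φ) (hk : IsGraphKernel μ (scaledMap φ) k)
    (hA : ∀ (ħ : Set.Ioc (0 : ℝ) 1) ψ x, A ħ ψ (scale ħ • x)
      = c₀ * ∫ τ, (∫ y, k ħ τ (y, x) * dilate ħ ψ y) ∂μ) :
    ∃ C : ℝ, ∀ ħ : Set.Ioc (0 : ℝ) 1, ∃ U : 𝓢(Conf d, ℂ) →L[ℂ] 𝓢'(Conf d, ℂ),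
      IsGivenBy U (A ħ) ∧ IsL2BoundedBy U C := by
  obtain ⟨C, hC0, hC⟩ := hk.l2_bound hφ.isCanonicalFamily
  refine ⟨‖c₀‖ * C, fun ħ => ?_⟩
  have hs := scale_pos ħ
  have hx : ∀ x : Conf d, scale ħ • ((scale ħ)⁻¹ • x) = x := fun x => smul_inv_smul₀ hs.ne' x
  refine exists_operator_of_pairing (fun ψ ψ' x => ?_) (fun t ψ x => ?_) (fun ψ χ => ?_)
    (by positivity) (fun ψ χ => ?_)
  · rw [← hx x, hA, hA, hA, ← mul_add,
      ← integral_add (hk.integrable ħ _ _) (hk.integrable ħ _ _)]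
    refine congrArg (c₀ * ·) (integral_congr_ae (.of_forall fun τ => ?_))
    simp only []
    rw [← integral_add (hk.integrable_fst ħ τ _ _) (hk.integrable_fst ħ τ _ _)]
    simp only [map_add, add_apply, mul_add]
  · rw [← hx x, hA, hA, mul_left_comm t c₀, ← integral_const_mul t]
    refine congrArg (c₀ * ·) (integral_congr_ae (.of_forall fun τ => ?_))
    simp only []
    rw [← integral_const_mul]
    simp only [map_smul, smul_apply, smul_eq_mul, mul_left_comm t]
  · rw [← integrable_comp_smul_iff volume _ hs.ne']
    refine ((hk.integrable_pairing ħ (dilate ħ ψ) (dilate ħ χ)).const_mul c₀).congr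
      (.of_forall fun x => ?_)
    simp only [hA, dilate_apply]
    ring
  · rw [pairing_scaled hk hA, norm_mul, norm_mul, Complex.norm_real,
      Real.norm_of_nonneg (by positivity), ← l2norm_dilate ħ]
    calc _ ≤ scale ħ ^ d * (‖c₀‖ * (C * (l2norm (dilate ħ ψ) * l2norm (dilate ħ χ)))) := by
          gcongr
          exact hC ħ _ _
      _ = _ := by ring

lemma bargmannKernel_eq {ħ : ℝ} (hħ : 0 < ħ) {U : 𝓢(Conf d, ℂ) →L[ℂ] 𝓢'(Conf d, ℂ)}
    {B : 𝓢(Conf d, ℂ) → Conf d → ℂ} (hU : IsGivenBy U B) (X Y : Phase d) :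
    bargmannKernel hħ U X Y = (((2 * Real.pi * ħ) ^ (-((d : ℝ) / 2)) : ℝ) : ℂ)
      * ((((2 * Real.pi * ħ) ^ (-((d : ℝ) / 2)) : ℝ) : ℂ)
        * ∫ x, conjCoherentState hħ Y x * B (coherentState hħ X) x) := by
  rw [bargmannKernel, fourierBargmann, bargmannAdjointDelta, map_smul, ← (hU _ _).2]
  rfl

/-- The powers of `ħ` are `-d` from the two Bargmann normalisations, `d / 2` from the Jacobian in
`x` and `-d / 2` from the two coherent states, so `-d` in total. -/
lemma bargmannKernel_scaled (hk : IsGraphKernel μ (scaledMap φ) k)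
    (hA : ∀ (ħ : Set.Ioc (0 : ℝ) 1) ψ x, A ħ ψ (scale ħ • x)
      = c₀ * ∫ τ, (∫ y, k ħ τ (y, x) * dilate ħ ψ y) ∂μ)
    (ħ : Set.Ioc (0 : ℝ) 1) {U : 𝓢(Conf d, ℂ) →L[ℂ] 𝓢'(Conf d, ℂ)} (hU : IsGivenBy U (A ħ))
    (X Y : Phase d) : ‖bargmannKernel ħ.2.1 U X Y‖
      = (2 * Real.pi) ^ (-(d : ℝ)) * Real.pi ^ (-((d : ℝ) / 2)) * ‖c₀‖ * (ħ : ℝ) ^ ((0 : ℝ) - d)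
        * ‖∫ τ, packetElement (k ħ τ) ((scale ħ)⁻¹ • X, (scale ħ)⁻¹ • Y) ∂μ‖ := by
  have hħ := ħ.2.1
  have hπ := Real.pi_pos
  have hs := scale_pos ħ
  have hn : ∀ r : ℝ, ‖Complex.exp (Complex.I * (r : ℂ))‖ = 1 := fun r => by
    rw [Complex.norm_exp]
    simp
  have hn' : ∀ r : ℝ, ‖Complex.exp (-(Complex.I * (r : ℂ)))‖ = 1 := fun r => by
    rw [Complex.norm_exp]
    simp
  set κ₁ : ℂ := (((Real.pi * ħ) ^ (-((d : ℝ) / 4)) : ℝ) : ℂ)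
          * Complex.exp (-(Complex.I * ((inner ℝ X.2 X.1 / (2 * ħ) : ℝ) : ℂ))) with hκ₁
  set κ₂ : ℂ := (((Real.pi * ħ) ^ (-((d : ℝ) / 4)) : ℝ) : ℂ)
          * Complex.exp (Complex.I * ((inner ℝ Y.2 Y.1 / (2 * ħ) : ℝ) : ℂ)) with hκ₂
  have hint : ∫ τ, (∫ v : Conf d × Conf d, k ħ τ v * (dilate ħ (coherentState ħ.2.1 X) v.1
        * dilate ħ (conjCoherentState ħ.2.1 Y) v.2)) ∂μ
      = κ₁ * κ₂ * ∫ τ, packetElement (k ħ τ) ((scale ħ)⁻¹ • X, (scale ħ)⁻¹ • Y) ∂μ := by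
    rw [← integral_const_mul]
    congr 1
    ext1 τ
    rw [packetElement, ← integral_const_mul]
    congr 1
    ext1 v
    rw [dilate_coherentState, dilate_conjCoherentState]
    simp only [Prod.smul_fst, Prod.smul_snd]
    ring
  have h1 : ‖κ₁ * κ₂‖ = (Real.pi * ħ) ^ (-((d : ℝ) / 4)) * (Real.pi * ħ) ^ (-((d : ℝ) / 4)) := by
    rw [norm_mul, hκ₁, hκ₂, norm_mul, norm_mul, hn, hn', mul_one, Complex.norm_real,
      Real.norm_of_nonneg (by positivity)]
  have h2 : scale ħ ^ d = (ħ : ℝ) ^ ((d : ℝ) / 2) := by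
    rw [scale, Real.sqrt_eq_rpow, ← Real.rpow_natCast, ← Real.rpow_mul hħ.le]
    congr 1
    ring
  rw [bargmannKernel_eq ħ.2.1 hU, pairing_scaled hk hA, hint, norm_mul, norm_mul, norm_mul,
    norm_mul, norm_mul (κ₁ * κ₂), h1, Complex.norm_real, Complex.norm_real,
    Real.norm_of_nonneg (by positivity), Real.norm_of_nonneg (by positivity), h2,
    Real.mul_rpow (by positivity) hħ.le, Real.mul_rpow (by positivity) hħ.le]
  have e1 : (2 * Real.pi) ^ (-(d : ℝ))
      = (2 * Real.pi) ^ (-((d : ℝ) / 2)) * (2 * Real.pi) ^ (-((d : ℝ) / 2)) := by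
    rw [← Real.rpow_add (by positivity)]
    congr 1
    ring
  have e2 : Real.pi ^ (-((d : ℝ) / 2))
      = Real.pi ^ (-((d : ℝ) / 4)) * Real.pi ^ (-((d : ℝ) / 4)) := by
    rw [← Real.rpow_add (by positivity)]
    congr 1
    ring
  have e3 : (ħ : ℝ) ^ ((0 : ℝ) - d) = (ħ : ℝ) ^ (-((d : ℝ) / 2)) * (ħ : ℝ) ^ (-((d : ℝ) / 2))
      * ((ħ : ℝ) ^ ((d : ℝ) / 2) * ((ħ : ℝ) ^ (-((d : ℝ) / 4)) * (ħ : ℝ) ^ (-((d : ℝ) / 4)))) := by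
    rw [← Real.rpow_add hħ, ← Real.rpow_add hħ, ← Real.rpow_add hħ, ← Real.rpow_add hħ]
    congr 1
    ring
  rw [e1, e2, e3]
  ring

lemma bargmannKernelDecay_scaled (hk : IsGraphKernel μ (scaledMap φ) k)
    (hA : ∀ (ħ : Set.Ioc (0 : ℝ) 1) ψ x, A ħ ψ (scale ħ • x)
      = c₀ * ∫ τ, (∫ y, k ħ τ (y, x) * dilate ħ ψ y) ∂μ)
    {U : ℝ → 𝓢(Conf d, ℂ) →L[ℂ] 𝓢'(Conf d, ℂ)}
    (hU : ∀ ħ ∈ Set.Ioc (0 : ℝ) 1, IsGivenBy (U ħ) (A ħ)) : BargmannKernelDecay 0 φ U := by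
  intro N
  obtain ⟨C, hC0, hC⟩ := hk.packetElement_decay N
  have hπ := Real.pi_pos
  set D := (2 * Real.pi) ^ (-(d : ℝ)) * Real.pi ^ (-((d : ℝ) / 2)) * ‖c₀‖ with hD
  have hD0 : 0 ≤ D := by positivity
  refine ⟨D * (C * 2 ^ N), fun ħ hħ hħ1 X Y => ?_⟩
  let η : Set.Ioc (0 : ℝ) 1 := ⟨ħ, hħ, hħ1⟩
  have hs := scale_pos η
  refine (bargmannKernel_scaled hk hA η (hU ħ ⟨hħ, hħ1⟩) X Y).trans_le ?_
  have e : ‖(scale η)⁻¹ • Y - scaledMap φ η ((scale η)⁻¹ • X)‖ = ‖Y - φ X‖ / scale η := by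
    have : scaledMap φ η ((scale η)⁻¹ • X) = (scale η)⁻¹ • φ X := by
      change (scale η)⁻¹ • φ (scale η • (scale η)⁻¹ • X) = _
      rw [smul_inv_smul₀ hs.ne']
    rw [this, ← smul_sub, norm_smul, norm_inv, Real.norm_of_nonneg hs.le, inv_mul_eq_div]
  have h1 := hC η ((scale η)⁻¹ • X) ((scale η)⁻¹ • Y)
  rw [e] at h1
  -- The factor `2 ^ N` passes from the maximum norm to the Euclidean norm of phase space.
  have h2 : ((1 + ‖Y - φ X‖ / scale η) ^ N)⁻¹
      ≤ 2 ^ N * ((1 + phaseNorm (Y - φ X) / scale η) ^ N)⁻¹ := by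
    have h3 := phaseNorm_nonneg (Y - φ X)
    rw [← div_eq_mul_inv, ← one_div, div_le_div_iff₀ (by positivity) (by positivity), one_mul,
      ← mul_pow]
    gcongr
    calc 1 + phaseNorm (Y - φ X) / scale η ≤ 2 + 2 * ‖Y - φ X‖ / scale η := by
          gcongr
          · norm_num
          · exact phaseNorm_le _
      _ = _ := by ring
  calc _ ≤ D * ħ ^ ((0 : ℝ) - d) * (C * (2 ^ N * ((1 + phaseNorm (Y - φ X) / scale η) ^ N)⁻¹)) := by
        gcongr
        exact h1.trans (by gcongr)
    _ = _ := by
        rw [show Real.sqrt ħ = scale η from rfl]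
        ring

lemma isL2BoundedBy_zero : IsL2BoundedBy (0 : 𝓢(Conf d, ℂ) →L[ℂ] 𝓢'(Conf d, ℂ)) 0 :=
  ⟨0, by simp, fun ψ => ((Lp.toTemperedDistributionCLM ℂ (volume : Measure (Conf d)) 2).map_zero).symm⟩

/-- The remainder can be taken to vanish for every `N'`. -/
lemma BargmannKernelDecay.isSemiclassicalFIO {m : ℝ}
    {U : ℝ → 𝓢(Conf d, ℂ) →L[ℂ] 𝓢'(Conf d, ℂ)} (h : BargmannKernelDecay m φ U) :
    IsSemiclassicalFIO m φ U := fun _ =>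
  ⟨U, 0, fun ħ _ => (add_zero (U ħ)).symm, ⟨0, fun ħ _ => by
    rw [zero_mul]
    exact isL2BoundedBy_zero⟩, h⟩

theorem exists_semiclassicalFIO (hφ : IsCanonical φ) (hk : IsGraphKernel μ (scaledMap φ) k)
    (hA : ∀ (ħ : Set.Ioc (0 : ℝ) 1) ψ x, A ħ ψ (scale ħ • x)
      = c₀ * ∫ τ, (∫ y, k ħ τ (y, x) * dilate ħ ψ y) ∂μ) :
    ∃ U : ℝ → 𝓢(Conf d, ℂ) →L[ℂ] 𝓢'(Conf d, ℂ),
      (∀ ħ ∈ Set.Ioc (0 : ℝ) 1, IsGivenBy (U ħ) (A ħ)) ∧ IsSemiclassicalFIO 0 φ U ∧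
      BargmannKernelDecay 0 φ U ∧ ∃ C : ℝ, ∀ ħ ∈ Set.Ioc (0 : ℝ) 1, IsL2BoundedBy (U ħ) C := by
  classical
  obtain ⟨C, hC⟩ := exists_operator_scaled hφ hk hA
  choose V hV hVC using hC
  -- The family is indexed by all real numbers; its values outside `(0, 1]` are immaterial.
  let U : ℝ → 𝓢(Conf d, ℂ) →L[ℂ] 𝓢'(Conf d, ℂ) := fun ħ =>
    if h : ħ ∈ Set.Ioc (0 : ℝ) 1 then V ⟨ħ, h⟩ else 0
  have hUV : ∀ ħ (h : ħ ∈ Set.Ioc (0 : ℝ) 1), U ħ = V ⟨ħ, h⟩ := fun ħ h => dif_pos h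
  have hU : ∀ ħ ∈ Set.Ioc (0 : ℝ) 1, IsGivenBy (U ħ) (A ħ) := fun ħ h => by
    rw [hUV ħ h]
    exact hV ⟨ħ, h⟩
  have hdecay := bargmannKernelDecay_scaled hk hA hU
  exact ⟨U, hU, hdecay.isSemiclassicalFIO, hdecay, C, fun ħ h => by
    rw [hUV ħ h]
    exact hVC ⟨ħ, h⟩⟩

end Assembly

/-! ### The defining integrals in scaled variables -/

section ScaledIntegrals

variable {d : ℕ}

lemma iteratedIntegrable_of_scaled {V : Type*} [NormedAddCommGroup V] [NormedSpace ℝ V]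
    [FiniteDimensional ℝ V] [MeasureSpace V] [BorelSpace V]
    [(volume : Measure V).IsAddHaarMeasure] (ħ : Set.Ioc (0 : ℝ) 1) {F : V → Conf d → ℂ}
    (h : IteratedIntegrable (fun v y => F (scale ħ • v) (scale ħ • y))) :
    IteratedIntegrable F := by
  have h0 := scale_pos ħ
  refine ⟨fun v => ?_, ?_⟩
  · have h1 := h.1 ((scale ħ)⁻¹ • v)
    simp only [smul_inv_smul₀ h0.ne'] at h1
    exact (integrable_comp_smul_iff volume (F v) h0.ne').1 h1
  · refine (integrable_comp_smul_iff volume _ h0.ne').1 ?_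
    refine (h.2.smul (scale ħ ^ d : ℝ)).congr (.of_forall fun v => ?_)
    exact (integral_scale_smul ħ (F (scale ħ • v))).symm

lemma integrandI_scaled (φ : Phase d ≃ Phase d) (S : Phase d → ℝ)
    (Θ : Phase d → Matrix (Fin d) (Fin d) ℂ) (Γ : Matrix (Fin d) (Fin d) ℂ)
    (a : Conf d × Phase d → ℂ) (ħ : Set.Ioc (0 : ℝ) 1) (ψ : 𝓢(Conf d, ℂ)) (x : Conf d)
    (z : Phase d) (y : Conf d) :
    integrandI φ S Θ Γ a ħ ψ (scale ħ • x) (scale ħ • z) (scale ħ • y)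
      = Complex.exp (Complex.I * phaseI (scaledMap φ ħ) (scaledAction S ħ)
        (fun z => Θ (scale ħ • z)) Γ z x y) * a (scale ħ • (x, z)) * dilate ħ ψ y := by
  rw [integrandI, phaseI_scaled]
  rfl

lemma integrandJ_scaled (φ : Phase d ≃ Phase d) (S : Phase d → ℝ)
    (Θ : Phase d → Matrix (Fin d) (Fin d) ℂ)
    (u : Conf d × Conf d × Conf d → ℂ) (ħ : Set.Ioc (0 : ℝ) 1) (ψ : 𝓢(Conf d, ℂ))
    (x p y : Conf d) :
    integrandJ φ S Θ u ħ ψ (scale ħ • x) (scale ħ • p) (scale ħ • y)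
      = kernelJ (scaledMap φ ħ) (scaledAction S ħ) (fun z => Θ (scale ħ • z))
        (fun t => u (scale ħ • t)) p (y, x) * dilate ħ ψ y := by
  rw [integrandJ, phaseJ_scaled]
  rfl

/-- The Jacobians in `y` and in the frequency give `√ħ` to the power `3d` for `ℐ` and `2d` for `𝒥`,
exactly cancelling the power of `ħ` in front of the operator. -/
lemma rpow_scale (ħ : Set.Ioc (0 : ℝ) 1) (r : ℝ) (n : ℕ) (hr : r = -(n : ℝ) / 2) :
    (2 * Real.pi * (ħ : ℝ)) ^ r * scale ħ ^ n = (2 * Real.pi) ^ r := by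
  have hπ := Real.pi_pos
  have hħ := ħ.2.1
  have h : scale ħ ^ n = (ħ : ℝ) ^ (-r) := by
    rw [scale, Real.sqrt_eq_rpow, ← Real.rpow_natCast, ← Real.rpow_mul hħ.le, hr]
    congr 1
    ring
  rw [h, Real.mul_rpow (by positivity) hħ.le, mul_assoc, ← Real.rpow_add hħ, add_neg_cancel,
    Real.rpow_zero, mul_one]

lemma opI_scaled {φ : Phase d ≃ Phase d} (hφ : IsCanonical φ) (S : Phase d → ℝ)
    (Θ : Phase d → Matrix (Fin d) (Fin d) ℂ) (Γ : Matrix (Fin d) (Fin d) ℂ)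
    (a : Conf d × Phase d → ℂ) (ħ : Set.Ioc (0 : ℝ) 1) (ψ : 𝓢(Conf d, ℂ)) (x : Conf d) :
    opI φ S Θ Γ a ħ ψ (scale ħ • x) = (((2 * Real.pi) ^ (-(3 * (d : ℝ) / 2)) : ℝ) : ℂ)
      * ∫ τ, ∫ y, kernelI (scaledMap φ ħ) (scaledAction S ħ) (fun z => Θ (scale ħ • z)) Γ
          (fun t => a (scale ħ • t)) τ (y, x) * dilate ħ ψ y := by
  have h1 := rpow_scale ħ (-(3 * (d : ℝ) / 2)) (2 * d + d) (by push_cast; ring)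
  rw [hφ.isCanonicalFamily.integral_kernelI (S := scaledAction S)
    (Θ := fun ħ z => Θ (scale ħ • z)) (a := fun ħ t => a (scale ħ • t)) ħ (dilate ħ ψ) x, opI,
    integral_scale_smul_phase ħ, ← h1, pow_add]
  simp only [integral_scale_smul ħ (integrandI φ S Θ Γ a ħ ψ (scale ħ • x) _), integrandI_scaled,
    Complex.real_smul, integral_const_mul, innerI]
  push_cast
  ring

lemma opJ_scaled (φ : Phase d ≃ Phase d) (S : Phase d → ℝ)
    (Θ : Phase d → Matrix (Fin d) (Fin d) ℂ) (u : Conf d × Conf d × Conf d → ℂ)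
    (ħ : Set.Ioc (0 : ℝ) 1) (ψ : 𝓢(Conf d, ℂ)) (x : Conf d) :
    opJ φ S Θ u ħ ψ (scale ħ • x) = (((2 * Real.pi) ^ (-(d : ℝ)) : ℝ) : ℂ)
      * ∫ p, ∫ y, kernelJ (scaledMap φ ħ) (scaledAction S ħ) (fun z => Θ (scale ħ • z))
          (fun t => u (scale ħ • t)) p (y, x) * dilate ħ ψ y := by
  have h1 := rpow_scale ħ (-(d : ℝ)) (d + d) (by push_cast; ring)
  rw [opJ, integral_scale_smul ħ (fun p => ∫ y, integrandJ φ S Θ u ħ ψ (scale ħ • x) p y), ← h1,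
    pow_add]
  simp only [integral_scale_smul ħ (integrandJ φ S Θ u ħ ψ (scale ħ • x) _), integrandJ_scaled,
    Complex.real_smul, integral_const_mul]
  push_cast
  ring

end ScaledIntegrals

end SemiclassicalFIO

end


/-! ### The proposition -/

open SemiclassicalFIO

theorem mainTheorem7 (d : ℕ) (φ : Phase d ≃ Phase d) (hφ : IsCanonical φ)
    (S : Phase d → ℝ) (hS : IsAction φ S) :
    (∀ (Γ : Matrix (Fin d) (Fin d) ℂ) (Θ : Phase d → Matrix (Fin d) (Fin d) ℂ)
        (a : Conf d × Phase d → ℂ),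
      Γ ∈ siegel d → IsSiegelField Θ → IsSymbol 0 a →
      (∀ ħ ∈ Set.Ioc (0 : ℝ) 1, ∀ (ψ : 𝓢(Conf d, ℂ)) (x : Conf d),
        IteratedIntegrable (integrandI φ S Θ Γ a ħ ψ x)) ∧
      ∃ U : ℝ → 𝓢(Conf d, ℂ) →L[ℂ] 𝓢'(Conf d, ℂ),
        (∀ ħ ∈ Set.Ioc (0 : ℝ) 1, IsGivenBy (U ħ) (opI φ S Θ Γ a ħ)) ∧
        IsSemiclassicalFIO 0 φ U ∧
        BargmannKernelDecay 0 φ U ∧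
        ∃ C : ℝ, ∀ ħ ∈ Set.Ioc (0 : ℝ) 1, IsL2BoundedBy (U ħ) C) ∧
    (∀ (Θ : Phase d → Matrix (Fin d) (Fin d) ℂ) (u : Conf d × Conf d × Conf d → ℂ),
      IsSiegelField Θ → (∃ C : ℝ, ∀ z i j, ‖Θ z i j‖ ≤ C) → IsSymbol 0 u →
      (∀ ħ ∈ Set.Ioc (0 : ℝ) 1, ∀ (ψ : 𝓢(Conf d, ℂ)) (x : Conf d),
        IteratedIntegrable (integrandJ φ S Θ u ħ ψ x)) ∧
      ∃ U : ℝ → 𝓢(Conf d, ℂ) →L[ℂ] 𝓢'(Conf d, ℂ),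
        (∀ ħ ∈ Set.Ioc (0 : ℝ) 1, IsGivenBy (U ħ) (opJ φ S Θ u ħ)) ∧
        IsSemiclassicalFIO 0 φ U ∧
        BargmannKernelDecay 0 φ U ∧
        ∃ C : ℝ, ∀ ħ ∈ Set.Ioc (0 : ℝ) 1, IsL2BoundedBy (U ħ) C) := by
  have hφd : Differentiable ℝ φ := hφ.symbol.1.differentiable (by simp)
  have hF := hφ.isCanonicalFamily
  have hSs := hS.scaled hφd
  refine ⟨fun Γ Θ a hΓ hΘ ha => ?_, fun Θ u hΘ hΘb hu => ?_⟩
  · obtain ⟨c, hc, hlow⟩ := hΘ.lower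
    have hlow' : ∀ (ħ : Set.Ioc (0 : ℝ) 1) (z : Phase d) (v : Conf d),
      c * ‖v‖ ^ 2 ≤ (quadForm (Θ (scale ħ • z)) v).im := fun _ _ => hlow _
    have hΘs := fun k l => (hΘ.symbol k l).scaled
    have has := ha.scaled
    refine ⟨fun ħ hħ ψ x => ?_, exists_semiclassicalFIO hφ
      (isGraphKernel_I hF hSs hΘs hc hlow' hΓ has) (opI_scaled hφ S Θ Γ a)⟩
    let η : Set.Ioc (0 : ℝ) 1 := ⟨ħ, hħ⟩
    -- Every point is a dilate, so the scaled formulas apply at arbitrary `x`.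
    obtain ⟨x, rfl⟩ : ∃ x', x = scale η • x' :=
      ⟨(scale η)⁻¹ • x, (smul_inv_smul₀ (scale_pos η).ne' x).symm⟩
    obtain ⟨B, hB0, hB⟩ := has.bound
    have hφc := (hF.symbol.1 η).continuous
    have hSc := (hSs η).1.continuous
    have hΘc := fun k l => ((hΘs k l).1 η).continuous
    refine iteratedIntegrable_of_scaled η ⟨fun z => ?_, ?_⟩
    · refine Integrable.congr ?_
        (.of_forall fun y => (integrandI_scaled φ S Θ Γ a η ψ x z y).symm)
      refine (dilate η ψ).integrable.bdd_mul (c := 1 * B) ?_ (.of_forall fun y => ?_)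
      · have h1 := (continuous_phaseI hφc hSc hΘc Γ).comp
          (by fun_prop : Continuous fun y : Conf d => (z, x, y))
        simp only [Function.comp_def] at h1
        exact Continuous.aestronglyMeasurable (by fun_prop)
      · rw [norm_mul]
        gcongr
        · exact norm_exp_phaseI_le hc (hlow' η) hΓ z x y
        · exact hB η (x, z)
    · exact (integrable_innerI hφc hSc hΘc (has.1 η).continuous hc (hlow' η) hΓ (hB η)
        (dilate η ψ) x).congr (.of_forall fun z => integral_congr_ae
          (.of_forall fun y => (integrandI_scaled φ S Θ Γ a η ψ x z y).symm))
  · obtain ⟨c, hc, hlow⟩ := hΘ.lower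
    obtain ⟨C, hC⟩ := hΘb
    -- The bound on `Θ` itself raises the scaled field from order one to order zero, as frozen
    -- phases require.
    have hk := isGraphKernel_J hF hSs
      (fun k l => (hΘ.symbol k l).scaled.of_bound (C := C) fun _ _ => hC _ k l) hc
      (fun ħ z => hlow (scale ħ • z)) hu.scaled
    refine ⟨fun ħ hħ ψ x => ?_, exists_semiclassicalFIO hφ hk (opJ_scaled φ S Θ u)⟩
    let η : Set.Ioc (0 : ℝ) 1 := ⟨ħ, hħ⟩
    obtain ⟨x, rfl⟩ : ∃ x', x = scale η • x' :=
      ⟨(scale η)⁻¹ • x, (smul_inv_smul₀ (scale_pos η).ne' x).symm⟩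
    have e : (fun p y => integrandJ φ S Θ u ħ ψ (scale η • x) (scale η • p) (scale η • y))
        = fun p y => kernelJ (scaledMap φ η) (scaledAction S η) (fun z => Θ (scale η • z))
          (fun t => u (scale η • t)) p (y, x) * dilate η ψ y := by
      ext p y
      exact integrandJ_scaled φ S Θ u η ψ x p y
    refine iteratedIntegrable_of_scaled η ?_
    rw [e]
    exact ⟨fun p => hk.integrable_fst η p x _, hk.integrable η _ x⟩
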